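/- Setting. Fix an integer $d\ge 2$ and a compact subset $\mathcal K$ of $\{1,\dots,d-1\}\times \mathrm{GL}(d,\mathbb R)\times M_d(\mathbb R)\times M_d(\mathbb R)$, whose elements are written $\sigma=(\ell,P,\Lambda,R)$. Write $\Lambda P^{-1}=\begin{pmatrix}A&B\\ C&D\end{pmatrix}$ with $A\in M_\ell(\mathbb R)$ and $D\in M_{d-\ell}(\mathbb R)$, and assume that for every $\sigma\in\mathcal K$ the matrix $D=D(\sigma)$ is Hurwitz (all its eigenvalues have negative real part). Put $$M=A-BD^{-1}C,\qquad T=\begin{pmatrix}I_\ell&0\\ D^{-1}C&I_{d-\ell}\end{pmatrix}P,\qquad E^\varepsilon_\ell=\mathrm{diag}(\underbrace{1,\dots,1}_{\ell},\varepsilon,\dots,\varepsilon).$$ Signals. For $\tau\ge 0$, a signal in $\mathcal S_{\mathcal K,\tau}$ consists of finitely many (possibly no) or infinitely many, locally finite, switching times $0=t_0<t_1<t_2<\cdots$ with $t_{k+1}\ge t_k+\tau$ for all $k\ge 0$, together with modes $\sigma_k=(\ell_k,P_k,\Lambda_k,R_k)\in\mathcal K$, $\sigma_k$ being active on $[t_k,t_{k+1})$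 (with $t_{n+1}=+\infty$ if there are exactly $n$ switching times); consecutive modes are allowed to coincide. Quantities indexed by $k$ are evaluated at $\sigma_k$. Systems. For $\varepsilon>0$ and signals in $\mathcal S_{\mathcal K,\tau}$ consider - $\Sigma^\varepsilon_{\mathcal K,\tau}$: $\;E^\varepsilon_{\ell_k}P_k\dot X=\Lambda_kX$ on $[t_k,t_{k+1})$, $\;X(t_k)=R_{k-1}X(t_k^-)$ for $k\ge1$; - $\bar\Sigma_\tau$: $\;\dot x=M_kx$ on $[t_k,t_{k+1})$ with $x(t)\in\mathbb R^{\ell_k}$, $\;x(t_k)=(T_kR_{k-1}T_{k-1}^{-1})_{\ell_k,\ell_{k-1}}x(t_k^-)$ for $k\ge1$, where $(Q)_{\ell,m}$ consists of the first $\ell$ rows and the first $m$ columns of $Q$; and, for signals in $\mathcal S_{\mathcal K,0}$, - $\hat\Sigma$: $\;\dot y=\begin{pmatrix}0&0\\0&D_k\end{pmatrix}y$ on $[t_k,t_{k+1})$, $\;y(t_k)=T_kR_{k-1}T_{k-1}^{-1}y(t_k^-)$ for $k\ge1$. Write $\Sigma^\varepsilon_{\mathcal K}=\Sigma^\varepsilon_{\mathcal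 K,0}$ and $\bar\Sigma=\bar\Sigma_0$. For each of these systems $\Sigma$, with flow $\Phi_\sigma(t,0)$ and set of signals $\mathcal S$, the maximal Lyapunov exponent is $$\lambda(\Sigma)=\limsup_{t\to+\infty}\ \sup_{\sigma\in\mathcal S}\frac{\log\|\Phi_\sigma(t,0)\|}{t}\in[-\infty,+\infty],\qquad \log 0=-\infty,$$ where $\|\cdot\|$ is the operator norm induced by the Euclidean norms, and $\Sigma$ is exponentially unstable (EU) if there exist $c>0$, $\delta>0$, a signal $\sigma\in\mathcal S$ and an initial state $x_0\ne0$ such that $|\Phi_\sigma(t,0)x_0|\ge c\,e^{\delta t}|x_0|$ for all $t\ge0$. For $\mathcal Y\subset M_d(\mathbb R)$, the discrete-time switched system $\Xi_{\mathcal Y}$ is bounded if there is $C>0$ with $\|Y_k\cdots Y_1\|\le C$ for all $k\ge 1$ and all $Y_1,\dots,Y_k\in\mathcal Y$. Finally let $$\mathcal R=\{R\mid(\ell,P,\Lambda,R)\in\mathcal K\},\qquad \bar{\mathcal R}=\Big\{RT^{-1}\begin{pmatrix}I_\ell&0\\0&0\end{pmatrix}T\ \Big|\ (\ell,P,\Lambda,R)\in\mathcal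 K\Big\}.$$ Theorem. Under the above assumptions: (i) For every $\tau>0$, $$\lambda(\bar\Sigma_\tau)\le\liminf_{\varepsilon\searrow0}\lambda(\Sigma^\varepsilon_{\mathcal K,\tau}).$$ If moreover $\bar\Sigma_\tau$ is EU, then $\Sigma^\varepsilon_{\mathcal K,\tau}$ is EU for every sufficiently small $\varepsilon>0$. (ii) If both $\Xi_{\mathcal R}$ and $\Xi_{\bar{\mathcal R}}$ are bounded, then $\lambda(\bar\Sigma)\le\liminf_{\varepsilon\searrow0}\lambda(\Sigma^\varepsilon_{\mathcal K})$, and if moreover $\bar\Sigma$ is EU, then $\Sigma^\varepsilon_{\mathcal K}$ is EU for every sufficiently small $\varepsilon>0$. (iii) If $\Xi_{\mathcal R}$ is bounded, then $$\lambda(\hat\Sigma)\le\max\Big\{0,\ \liminf_{\varepsilon\searrow0}\varepsilon\,\lambda(\Sigma^\varepsilon_{\mathcal K})\Big\}.$$ In particular, if $\hat\Sigma$ is EU, then $\Sigma^\varepsilon_{\mathcal K}$ is EU for every sufficiently small $\varepsilon>0$, and there is $c>0$ such that $\lambda(\Sigma^\varepsilon_{\mathcal K})\ge c/\varepsilon$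 for every sufficiently small $\varepsilon>0$. -/

import Mathlib

open Filter Topology

noncomputable section

namespace SingPert

/-! ### Switching signals -/

/-- A switching signal with values in `K` and dwell time `τ`.  It has `num ∈ {0, 1, 2, …, ∞}`
switching times `time 1 < time 2 < ⋯` in `(0, ∞)`, which are locally finite, and takes the value
`mode k` on `[time k, time (k + 1))`, where `time 0 = 0` and, if `num` is finite,
`time (num + 1)` is read as `+∞`.  Values of `time` and `mode` at indices beyond `num` are
irrelevant.  Consecutive modes may coincide (the switching times are part of the signal). -/
structure Signal {S : Type*} (K : Set S) (τ : ℝ) where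
  num : ℕ∞
  time : ℕ → ℝ
  mode : ℕ → S
  time_zero : time 0 = 0
  time_lt : ∀ k : ℕ, ((k + 1 : ℕ) : ℕ∞) ≤ num → time k < time (k + 1)
  dwell : ∀ k : ℕ, ((k + 1 : ℕ) : ℕ∞) ≤ num → time k + τ ≤ time (k + 1)
  locallyFinite : num = ⊤ → Tendsto time atTop atTop
  mode_mem : ∀ k : ℕ, (k : ℕ∞) ≤ num → mode k ∈ K

namespace Signal

variable {S : Type*} {K : Set S} {τ : ℝ}

/-- The index `k` such that `t ∈ [t_k, t_{k+1})`, for `t ≥ 0`. -/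
def index (s : Signal K τ) (t : ℝ) : ℕ :=
  sSup {k : ℕ | (k : ℕ∞) ≤ s.num ∧ s.time k ≤ t}

/-- The defining property of `index`. -/
theorem index_spec (s : Signal K τ) {t : ℝ} (ht : 0 ≤ t) :
    ((s.index t : ℕ) : ℕ∞) ≤ s.num ∧ s.time (s.index t) ≤ t ∧
      ∀ k : ℕ, (k : ℕ∞) ≤ s.num → s.index t < k → t < s.time k := by
  have hne : {k : ℕ | (k : ℕ∞) ≤ s.num ∧ s.time k ≤ t}.Nonempty :=
    ⟨0, by simp [s.time_zero, ht]⟩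
  have hbdd : BddAbove {k : ℕ | (k : ℕ∞) ≤ s.num ∧ s.time k ≤ t} := by
    by_cases hN : s.num = ⊤
    · obtain ⟨n, hn⟩ := eventually_atTop.1 ((s.locallyFinite hN).eventually_gt_atTop t)
      refine ⟨n, fun k hk => ?_⟩
      by_contra! h
      exact absurd hk.2 (not_le.2 (hn k h.le))
    · obtain ⟨n, hn⟩ := ENat.ne_top_iff_exists.1 hN
      refine ⟨n, fun k hk => ?_⟩
      have := hk.1
      rw [← hn] at this
      exact_mod_cast this
  have hmem := Nat.sSup_mem hne hbdd
  refine ⟨hmem.1, hmem.2, fun k hk hlt => ?_⟩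
  by_contra! h
  exact absurd (le_csSup hbdd (show k ∈ {k : ℕ | (k : ℕ∞) ≤ s.num ∧ s.time k ≤ t} from ⟨hk, h⟩))
    (not_le.2 hlt)

end Signal

/-! ### Impulsive linear switched systems with mode-dependent dimension -/

/-- The data of the switched system
`ẋ(t) = gen σ_k x(t)` for `t ∈ [t_k, t_{k+1})`, `x(t_k) = jump σ_k σ_{k-1} x(t_k⁻)`,
whose state has dimension `dim σ_k` on `[t_k, t_{k+1})`. -/
structure ImpulsiveSystem (S : Type*) where
  dim : S → ℕ
  gen : (σ : S) → Matrix (Fin (dim σ)) (Fin (dim σ)) ℝ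
  jump : (new old : S) → Matrix (Fin (dim new)) (Fin (dim old)) ℝ

namespace ImpulsiveSystem

variable {S : Type*} {K : Set S} {τ : ℝ}

/-- The flow from time `0` to time `t_k` (after the jump at `t_k`). -/
def flowAt (Sys : ImpulsiveSystem S) (s : Signal K τ) :
    (k : ℕ) → Matrix (Fin (Sys.dim (s.mode k))) (Fin (Sys.dim (s.mode 0))) ℝ
  | 0 => 1
  | k + 1 => Sys.jump (s.mode (k + 1)) (s.mode k) *
      NormedSpace.exp ((s.time (k + 1) - s.time k) • Sys.gen (s.mode k)) * Sys.flowAt s k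

/-- The flow from time `0` to time `t ∈ [t_k, t_{k+1})`. -/
def flowOn (Sys : ImpulsiveSystem S) (s : Signal K τ) (k : ℕ) (t : ℝ) :
    Matrix (Fin (Sys.dim (s.mode k))) (Fin (Sys.dim (s.mode 0))) ℝ :=
  NormedSpace.exp ((t - s.time k) • Sys.gen (s.mode k)) * Sys.flowAt s k

/-- The flow from time `0` to time `t ≥ 0`. -/
def flow (Sys : ImpulsiveSystem S) (s : Signal K τ) (t : ℝ) :
    Matrix (Fin (Sys.dim (s.mode (s.index t)))) (Fin (Sys.dim (s.mode 0))) ℝ :=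
  Sys.flowOn s (s.index t) t

end ImpulsiveSystem

/-- The operator norm of a real matrix induced by the Euclidean norms. -/
def opNorm {m n : ℕ} (A : Matrix (Fin m) (Fin n) ℝ) : ℝ :=
  ‖LinearMap.toContinuousLinearMap (Matrix.toEuclideanLin A)‖

namespace ImpulsiveSystem

variable {S : Type*}

/-- The maximal Lyapunov exponent
`limsup_{t → ∞} sup_s log ‖Φ_s(t, 0)‖ / t ∈ [-∞, ∞]`, with `log 0 = -∞`, the supremum being over
all signals with values in `K` and dwell time `τ`. -/
def lyapunovExponent (Sys : ImpulsiveSystem S) (K : Set S) (τ : ℝ) : EReal :=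
  limsup (fun t : ℝ => ⨆ s : Signal K τ,
    ENNReal.log (ENNReal.ofReal (opNorm (Sys.flow s t))) / (t : EReal)) atTop

/-- Exponential instability: some trajectory grows at least exponentially. -/
def ExpUnstable (Sys : ImpulsiveSystem S) (K : Set S) (τ : ℝ) : Prop :=
  ∃ c > (0 : ℝ), ∃ δ > (0 : ℝ), ∃ s : Signal K τ,
    ∃ x₀ : EuclideanSpace ℝ (Fin (Sys.dim (s.mode 0))), x₀ ≠ 0 ∧
      ∀ t : ℝ, 0 ≤ t →
        c * Real.exp (δ * t) * ‖x₀‖ ≤ ‖Matrix.toEuclideanLin (Sys.flow s t) x₀‖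

end ImpulsiveSystem

/-- Boundedness of the discrete-time switched system `x(k) = Y_k x(k-1)`, `Y_k ∈ Y`:
all finite products of elements of `Y` are uniformly bounded. -/
def DiscreteBounded {n : ℕ} (Y : Set (Matrix (Fin n) (Fin n) ℝ)) : Prop :=
  ∃ C > (0 : ℝ), ∀ L : List (Matrix (Fin n) (Fin n) ℝ), (∀ A ∈ L, A ∈ Y) → opNorm L.prod ≤ C

/-- A real square matrix is Hurwitz if all its complex eigenvalues have negative real part. -/
def IsHurwitz {n : ℕ} (A : Matrix (Fin n) (Fin n) ℝ) : Prop :=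
  ∀ z ∈ spectrum ℂ (A.map (algebraMap ℝ ℂ)), z.re < 0

/-! ### Singularly perturbed systems -/

/-- The set `{1, …, d-1} × GL(d, ℝ) × M_d(ℝ) × M_d(ℝ)` of modes `(ℓ, P, Λ, R)`, with its product
topology. -/
abbrev Mode (d : ℕ) : Type :=
  ↥(Set.Icc 1 (d - 1)) × GL (Fin d) ℝ × Matrix (Fin d) (Fin d) ℝ × Matrix (Fin d) (Fin d) ℝ

namespace Mode

variable {d : ℕ}

/-- The number of slow variables. -/
def ell (σ : Mode d) : ℕ := σ.1

def P (σ : Mode d) : Matrix (Fin d) (Fin d) ℝ := σ.2.1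

def Lam (σ : Mode d) : Matrix (Fin d) (Fin d) ℝ := σ.2.2.1

def R (σ : Mode d) : Matrix (Fin d) (Fin d) ℝ := σ.2.2.2

theorem ell_add (σ : Mode d) : σ.ell + (d - σ.ell) = d := by
  have h : σ.ell ≤ d - 1 := σ.1.2.2
  omega

/-- The splitting of the coordinates into the first `ℓ` and the last `d - ℓ` ones. -/
def split (σ : Mode d) : Fin σ.ell ⊕ Fin (d - σ.ell) ≃ Fin d :=
  finSumFinEquiv.trans (finCongr σ.ell_add)

/-- The `d × d` matrix with the given blocks. -/
def ofBlocks (σ : Mode d) (A : Matrix (Fin σ.ell) (Fin σ.ell) ℝ)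
    (B : Matrix (Fin σ.ell) (Fin (d - σ.ell)) ℝ) (C : Matrix (Fin (d - σ.ell)) (Fin σ.ell) ℝ)
    (D : Matrix (Fin (d - σ.ell)) (Fin (d - σ.ell)) ℝ) : Matrix (Fin d) (Fin d) ℝ :=
  (Matrix.fromBlocks A B C D).submatrix σ.split.symm σ.split.symm

/-- `Λ P⁻¹`, in block form `(A B; C D)` with `A` of size `ℓ × ℓ`. -/
def LamPinv (σ : Mode d) : Matrix (Fin σ.ell ⊕ Fin (d - σ.ell)) (Fin σ.ell ⊕ Fin (d - σ.ell)) ℝ :=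
  (σ.Lam * σ.P⁻¹).submatrix σ.split σ.split

def A (σ : Mode d) : Matrix (Fin σ.ell) (Fin σ.ell) ℝ := σ.LamPinv.toBlocks₁₁

def B (σ : Mode d) : Matrix (Fin σ.ell) (Fin (d - σ.ell)) ℝ := σ.LamPinv.toBlocks₁₂

def C (σ : Mode d) : Matrix (Fin (d - σ.ell)) (Fin σ.ell) ℝ := σ.LamPinv.toBlocks₂₁

def D (σ : Mode d) : Matrix (Fin (d - σ.ell)) (Fin (d - σ.ell)) ℝ := σ.LamPinv.toBlocks₂₂

/-- `M = A - B D⁻¹ C`. -/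
def M (σ : Mode d) : Matrix (Fin σ.ell) (Fin σ.ell) ℝ := σ.A - σ.B * σ.D⁻¹ * σ.C

/-- `T = (I 0; D⁻¹ C I) P`. -/
def T (σ : Mode d) : Matrix (Fin d) (Fin d) ℝ := σ.ofBlocks 1 0 (σ.D⁻¹ * σ.C) 1 * σ.P

/-- `E_ℓ^ε`: diagonal, with entries `1` on the first `ℓ` lines and `ε` elsewhere. -/
def E (σ : Mode d) (ε : ℝ) : Matrix (Fin d) (Fin d) ℝ :=
  Matrix.diagonal fun i : Fin d => if (i : ℕ) < σ.ell then 1 else ε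

end Mode

variable (d : ℕ)

/-- The singularly perturbed system: `E_{ℓ_k}^ε P_k Ẋ = Λ_k X` on `[t_k, t_{k+1})`,
`X(t_k) = R_{k-1} X(t_k⁻)`. -/
def sysEps (ε : ℝ) : ImpulsiveSystem (Mode d) where
  dim _ := d
  gen σ := (σ.E ε * σ.P)⁻¹ * σ.Lam
  jump _ old := old.R

/-- The reduced slow system: `x' = M_k x` on `[t_k, t_{k+1})`,
`x(t_k) = (T_k R_{k-1} T_{k-1}⁻¹)_{ℓ_k, ℓ_{k-1}} x(t_k⁻)`, where `(Q)_{ℓ, m}` keeps the first `ℓ`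
lines and the first `m` columns of `Q`. -/
def sysBar : ImpulsiveSystem (Mode d) where
  dim σ := σ.ell
  gen σ := σ.M
  jump new old :=
    (new.T * old.R * old.T⁻¹).submatrix (fun i => new.split (Sum.inl i))
      (fun j => old.split (Sum.inl j))

/-- The transient system: `(x, z)' = (0, D_k z)` on `[s_k, s_{k+1})`,
`(x, z)(s_k) = T_k R_{k-1} T_{k-1}⁻¹ (x, z)(s_k⁻)`. -/
def sysHat : ImpulsiveSystem (Mode d) where
  dim _ := d
  gen σ := σ.ofBlocks 0 0 0 σ.D
  jump new old := new.T * old.R * old.T⁻¹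

variable {d}

/-- The set of all `R` with `(ℓ, P, Λ, R) ∈ K`. -/
def setR (K : Set (Mode d)) : Set (Matrix (Fin d) (Fin d) ℝ) := {Y | ∃ σ ∈ K, Y = σ.R}

/-- The set of all `R T⁻¹ (I_ℓ 0; 0 0) T` with `(ℓ, P, Λ, R) ∈ K`. -/
def setRbar (K : Set (Mode d)) : Set (Matrix (Fin d) (Fin d) ℝ) :=
  {Y | ∃ σ ∈ K, Y = σ.R * σ.T⁻¹ * σ.ofBlocks 1 0 0 0 * σ.T}

end SingPert

end

/-! The growth rate of a limit system is detected by the spectral radius of a single finite product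
of propagators, and such a spectral radius survives small perturbations.

Upper bound on the limit system. A `Realization` writes the flow, up to bounded outer factors, as a
product of `d × d` letters `step (σ, t)`, namely the reset of `σ` times its propagator over a
duration `t`. The varying dimensions disappear because each jump factors through `R` of the old mode
alone. If every product of total duration `W` has eigenvalues of modulus at most `e^{μW}`, and so
has every bare propagator, then the Lyapunov exponent is at most `μ`
(`Realization.lyapunovExponent_le`). This is a Berger-Wang theorem weighted by durations,
`exists_norm_prod_le_exp`, proved by induction on the dimension. An irreducible semigroup with
bounded traces is bounded, by Burnside; a reducible one is block triangular, and its off-diagonal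
block costs only a factor linear in the weight. Since the number of letters is not controlled by the
duration, the theorem needs a bound on products of duration at most one. That bound comes from the
dwell time or from the boundedness of the discrete system obtained by letting all durations vanish.

Convergence of propagators. For a fixed mode and `t > 0`, the `ε`-propagator over time `t` tends to
`T⁻¹ diag(e^{tM}, 0) T` (`tendsto_exp_slow_fast`, a Tikhonov limit resting on the decay of
`e^{tD}`). Over time `ε t` it tends to `T⁻¹ diag(I, e^{tD}) T`, by continuity of the exponential.

Transfer. If `μ` is below the exponent of the limit system, some word has an eigenvalue of modulus
above `e^{μW}`. The corresponding word of the `ε`-system then has one too for small `ε`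
(`eventually_exists_mem_spectrum`). Repeating that word periodically, or holding a single mode
forever, gives a real trajectory of rate `μ' > μ`, or `μ'/ε` on the fast scale
(`eventually_hasGrowth`). This yields the inequalities between exponents and, taking `μ = 0`,
exponential instability. -/

namespace SingPert

/-! ### Irreducible matrix semigroups -/

section Irreducible

variable {V : Type*} [NormedAddCommGroup V] [NormedSpace ℂ V] [FiniteDimensional ℂ V]

/-- **Burnside's theorem**: an irreducible algebra of operators on a finite-dimensional complex
space contains all operators. -/
theorem eq_top_of_irreducible [Nontrivial V] (A : Subalgebra ℂ (Module.End ℂ V))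
    (hA : ∀ W : Submodule ℂ V, (∀ f ∈ A, ∀ x ∈ W, f x ∈ W) → W = ⊥ ∨ W = ⊤) : A = ⊤ := by
  have hsimple : IsSimpleModule A V := by
    refine { toIsSimpleOrder := { exists_pair_ne := ⟨⊥, ⊤, bot_ne_top⟩, eq_bot_or_eq_top := ?_ } }
    intro W
    have hW := hA { W with
        smul_mem' := fun c x hx => by
          have := W.smul_mem (algebraMap ℂ A c) hx
          simpa [algebraMap_smul] using this } fun f hf x hx => W.smul_mem ⟨f, hf⟩ hx
    refine hW.imp (fun h => ?_) fun h => ?_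
    · ext x; exact Submodule.ext_iff.1 h x
    · ext x; exact Submodule.ext_iff.1 h x
  -- Schur: the endomorphisms of a simple module are scalars, so any linear `f` commutes with them.
  -- Jacobson density then gives an element of `A` agreeing with `f` on a basis.
  have hsurj := (IsSimpleModule.algebraMap_end_bijective_of_isAlgClosed (A := A) (V := V) ℂ).2
  rw [eq_top_iff]
  classical
  rintro f -
  have b := Module.finBasis ℂ V
  let F : Module.End (Module.End A V) V :=
    { toFun := f
      map_add' := f.map_add
      map_smul' := fun c x => by
        obtain ⟨t, rfl⟩ := hsurj c
        simp }
  obtain ⟨r, hr⟩ := jacobson_density (R := A) (M := V) F (Finset.univ.image b)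
  have : f = r := b.ext fun i => hr (b i) (by simp)
  rw [this]; exact r.2

/-- An irreducible semigroup of operators with bounded traces is bounded. -/
theorem exists_norm_le_of_irreducible (S : Submonoid (V →L[ℂ] V))
    (hS : ∀ W : Submodule ℂ V, (∀ f ∈ S, ∀ x ∈ W, f x ∈ W) → W = ⊥ ∨ W = ⊤) {c : ℝ}
    (hc : ∀ f ∈ S, ‖LinearMap.trace ℂ V (f : V →ₗ[ℂ] V)‖ ≤ c) : ∃ C, ∀ f ∈ S, ‖f‖ ≤ C := by
  rcases subsingleton_or_nontrivial V with hV | hV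
  · exact ⟨0, fun f _ => by rw [Subsingleton.elim f 0, norm_zero]⟩
  let φ : (V →L[ℂ] V) →* Module.End ℂ V :=
    { toFun := fun f => f, map_one' := rfl, map_mul' := fun _ _ => rfl }
  have htop : Submodule.span ℂ ((S.map φ : Submonoid _) : Set (Module.End ℂ V)) = ⊤ := by
    have h := Algebra.adjoin_eq_span ℂ
      ((S.map φ : Submonoid _) : Set (Module.End ℂ V))
    rw [Submonoid.closure_eq] at h
    rw [← h, eq_top_of_irreducible (Algebra.adjoin ℂ _) ?_]
    · rfl
    · intro W hW
      refine hS W fun f hf x hx => hW f (Algebra.subset_adjoin ⟨f, hf, rfl⟩) x hx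
  -- For `g` in the semigroup, `f g` lies in it too, so its trace is bounded; linearity extends the
  -- bound to the span, which is everything.
  have key : ∀ g : Module.End ℂ V, ∃ C, ∀ f ∈ S, ‖LinearMap.trace ℂ V (φ f * g)‖ ≤ C := by
    intro g
    have hg : g ∈ Submodule.span ℂ ((S.map φ : Submonoid _) : Set (Module.End ℂ V)) := by
      rw [htop]; trivial
    induction hg using Submodule.span_induction with
    | mem x hx =>
      obtain ⟨y, hy, rfl⟩ := hx
      exact ⟨c, fun f hf => by rw [← map_mul]; exact hc _ (S.mul_mem hf hy)⟩
    | zero => exact ⟨0, fun f _ => by simp⟩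
    | add x y _ _ hx hy =>
      obtain ⟨C, hC⟩ := hx
      obtain ⟨C', hC'⟩ := hy
      refine ⟨C + C', fun f hf => ?_⟩
      rw [mul_add, map_add]
      exact (norm_add_le _ _).trans (add_le_add (hC f hf) (hC' f hf))
    | smul a x _ hx =>
      obtain ⟨C, hC⟩ := hx
      refine ⟨‖a‖ * C, fun f hf => ?_⟩
      rw [mul_smul_comm, map_smul, norm_smul]
      exact mul_le_mul_of_nonneg_left (hC f hf) (norm_nonneg _)
  let b := Module.finBasis ℂ V
  -- A matrix coefficient of `f` is the trace of `f` against a rank-one operator.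
  have key2 : ∀ i j, ∃ C, ∀ f ∈ S, ‖b.coord i (f (b j))‖ ≤ C := by
    intro i j
    obtain ⟨C, hC⟩ := key ((b.coord i).smulRight (b j))
    refine ⟨C, fun f hf => ?_⟩
    have : φ f * (b.coord i).smulRight (b j) = (b.coord i).smulRight (f (b j)) := by
      ext x
      simp only [φ, Module.End.mul_apply, LinearMap.smulRight_apply, map_smul]
      rfl
    have h2 := hC f hf
    rwa [this, LinearMap.trace_smulRight] at h2
  choose C hC using key2
  obtain ⟨K, hK, hK'⟩ := b.exists_opNorm_le (F := V)
  have hnonneg : ∀ i j, 0 ≤ C i j := fun i j => (norm_nonneg _).trans (hC i j 1 S.one_mem)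
  refine ⟨K * ∑ j, ∑ i, C i j * ‖b i‖, fun f hf => hK' ?_ ?_⟩
  · exact Finset.sum_nonneg fun j _ => Finset.sum_nonneg fun i _ =>
      mul_nonneg (hnonneg i j) (norm_nonneg _)
  · intro j
    calc ‖f (b j)‖ = ‖∑ i, b.coord i (f (b j)) • b i‖ := by
          simp only [Module.Basis.coord_apply, b.sum_repr]
      _ ≤ ∑ i, C i j * ‖b i‖ := by
          refine (norm_sum_le _ _).trans (Finset.sum_le_sum fun i _ => ?_)
          rw [norm_smul]
          exact mul_le_mul_of_nonneg_right (hC i j f hf) (norm_nonneg _)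
      _ ≤ _ := Finset.single_le_sum (f := fun j => ∑ i, C i j * ‖b i‖)
          (fun j _ => Finset.sum_nonneg fun i _ => mul_nonneg (hnonneg i j) (norm_nonneg _))
          (Finset.mem_univ j)

/-- The trace is the sum of the eigenvalues with multiplicity. This turns the spectral hypothesis of
Berger-Wang into the trace bound of the irreducible case. -/
theorem norm_trace_le_of_eigenvalue (f : Module.End ℂ V)
    (hf : ∀ z, f.HasEigenvalue z → ‖z‖ ≤ 1) :
    ‖LinearMap.trace ℂ V f‖ ≤ Module.finrank ℂ V := by
  have hs : f.charpoly.Splits := IsAlgClosed.splits _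
  rw [Module.End.trace_eq_sum_roots_charpoly_of_splits hs]
  have h1 : ∀ s : Multiset ℂ, (∀ z ∈ s, ‖z‖ ≤ 1) → ‖s.sum‖ ≤ s.card := by
    intro s
    induction s using Multiset.induction with
    | empty => simp
    | cons a s ih =>
      intro h
      rw [Multiset.sum_cons, Multiset.card_cons, Nat.cast_add, Nat.cast_one, add_comm a]
      exact (norm_add_le _ _).trans (add_le_add
        (ih fun z hz => h z (Multiset.mem_cons_of_mem hz)) (h a (Multiset.mem_cons_self a s)))
  refine (h1 _ fun z hz => hf z ?_).trans ?_
  · rw [Module.End.hasEigenvalue_iff_isRoot_charpoly]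
    exact (Polynomial.mem_roots'.1 hz).2
  · rw [← f.charpoly_natDegree]
    exact_mod_cast Polynomial.card_roots' _

end Irreducible

/-! ### Growth of products of operators -/

section Growth

/-- A list of nonnegative weights either has total weight at most one, or a shortest prefix of
weight larger than one. -/
theorem exists_prefix_of_one_lt {ι : Type*} (w : ι → ℝ) (L : List ι) :
    (L.map w).sum ≤ 1 ∨ ∃ (Q : List ι) (i : ι) (R : List ι), L = Q ++ i :: R ∧
      (Q.map w).sum ≤ 1 ∧ 1 < ((Q ++ [i]).map w).sum := by
  induction L using List.reverseRecOn with
  | nil => left; simp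
  | append_singleton L i ih =>
    rcases ih with h | ⟨Q, j, R, rfl, h1, h2⟩
    · by_cases h' : ((L ++ [i]).map w).sum ≤ 1
      · exact Or.inl h'
      · exact Or.inr ⟨L, i, [], rfl, h, not_le.1 h'⟩
    · exact Or.inr ⟨Q, j, R ++ [i], by simp, h1, h2⟩

theorem sum_map_nonneg {ι : Type*} {w : ι → ℝ} (hw : ∀ i, 0 ≤ w i) (L : List ι) :
    0 ≤ (L.map w).sum :=
  List.sum_nonneg (by simpa using fun i _ => hw i)

variable {ι : Type*} {V : Type*} [NormedAddCommGroup V] [NormedSpace ℂ V]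

/-- Exponential bounds for products in block triangular form follow from those for the diagonal
blocks.  Here `e` is a projection onto an invariant subspace. -/
theorem exists_norm_prod_le_of_blocks {w : ι → ℝ} (hw : ∀ i, 0 ≤ w i) (g : ι → V →L[ℂ] V)
    {b : ℝ} (hb : ∀ i, ‖g i‖ ≤ b) (hb' : ∀ L : List ι, (L.map w).sum ≤ 1 → ‖(L.map g).prod‖ ≤ b)
    (e : V →L[ℂ] V) (he : ∀ (L : List ι), e * (L.map g).prod * e = (L.map g).prod * e)
    {η c₁ c₂ : ℝ} (hη : 0 < η)
    (h₁ : ∀ L : List ι, ‖(L.map g).prod * e‖ ≤ c₁ * Real.exp (η * (L.map w).sum))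
    (h₂ : ∀ L : List ι, ‖(1 - e) * (L.map g).prod‖ ≤ c₂ * Real.exp (η * (L.map w).sum)) :
    ∃ C, ∀ L : List ι, ‖(L.map g).prod‖ ≤ C * Real.exp (2 * η * (L.map w).sum) := by
  have hb0 : 0 ≤ b := (norm_nonneg _).trans (hb' [] (by simp))
  have hc₁ : 0 ≤ c₁ := by simpa using (norm_nonneg _).trans (h₁ [])
  have hc₂ : 0 ≤ c₂ := by simpa using (norm_nonneg _).trans (h₂ [])
  -- The first summand pays for a final piece of weight at most one, the second for one off-diagonal
  -- crossing.
  set K : ℝ := c₁ * b + c₁ * (b * b) * c₂ with hK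
  have hK0 : 0 ≤ K := by positivity
  -- The pieces peeled off `L` have weight just above one, so at most weight plus one terms arise,
  -- however long the list is. A piece has norm at most `b * b`: a prefix of weight at most one,
  -- then a single letter.
  have key : ∀ (n : ℕ) (L : List ι), L.length ≤ n → ∀ A : List ι,
      ‖(A.map g).prod * e * (L.map g).prod‖ ≤
        ((L.map w).sum + 1) * K * Real.exp (η * ((A.map w).sum + (L.map w).sum)) := by
    intro n
    induction n with
    | zero =>
      intro L hL A
      obtain rfl : L = [] := List.length_eq_zero_iff.1 (Nat.le_zero.1 hL)
      have h1b : ‖((A.map g).prod * e) * (List.map g []).prod‖ ≤ ‖(A.map g).prod * e‖ * b :=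
        (norm_mul_le _ _).trans (mul_le_mul_of_nonneg_left (hb' [] (by simp)) (norm_nonneg _))
      refine h1b.trans ?_
      have h2b := mul_le_mul_of_nonneg_right (h₁ A) hb0
      refine h2b.trans ?_
      simp only [List.map_nil, List.sum_nil, zero_add, one_mul, add_zero]
      have : c₁ * b ≤ K := le_add_of_nonneg_right (by positivity)
      nlinarith [Real.exp_pos (η * (A.map w).sum)]
    | succ n ih =>
      intro L hL A
      rcases exists_prefix_of_one_lt w L with h | ⟨Q, i, R, rfl, hQ, hQi⟩
      · have hL0 := sum_map_nonneg hw L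
        calc ‖(A.map g).prod * e * (L.map g).prod‖
            ≤ (c₁ * Real.exp (η * (A.map w).sum)) * b :=
              (norm_mul_le _ _).trans (mul_le_mul (h₁ A) (hb' L h) (norm_nonneg _)
                (by positivity))
          _ ≤ K * Real.exp (η * (A.map w).sum) := by
              have : c₁ * b ≤ K := le_add_of_nonneg_right (by positivity)
              nlinarith [Real.exp_pos (η * (A.map w).sum)]
          _ ≤ ((L.map w).sum + 1) * K * Real.exp (η * ((A.map w).sum + (L.map w).sum)) := by
              refine mul_le_mul ?_ (Real.exp_le_exp.2 ?_) (Real.exp_pos _).le (by positivity)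
              · nlinarith
              · nlinarith
      · set q := ((Q ++ [i]).map g).prod with hq
        have hLq : ((Q ++ i :: R).map g).prod = q * (R.map g).prod := by
          simp [hq, mul_assoc]
        have hLw : ((Q ++ i :: R).map w).sum = ((Q ++ [i]).map w).sum + (R.map w).sum := by
          simp [add_assoc]
        set s := ((Q ++ [i]).map w).sum with hs
        have hqn : ‖q‖ ≤ b * b := by
          rw [hq]; simp only [List.map_append, List.prod_append, List.map_cons, List.map_nil,
            List.prod_cons, List.prod_nil, mul_one]
          exact (norm_mul_le _ _).trans (mul_le_mul (hb' Q hQ) (hb i) (norm_nonneg _) hb0)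
        have hR0 := sum_map_nonneg hw R
        -- Insert `e + (1 - e)` after `q`. Invariance, `e q e = q e`, merges `q` into the prefix `A`
        -- in the first term, to which induction applies; in the second term all three factors are
        -- already bounded.
        have hsplit : (A.map g).prod * e * (q * (R.map g).prod) =
            ((A ++ (Q ++ [i])).map g).prod * e * (R.map g).prod +
              ((A.map g).prod * e) * q * ((1 - e) * (R.map g).prod) := by
          have : ((A ++ (Q ++ [i])).map g).prod * e = (A.map g).prod * (e * q * e) := by
            rw [he, List.map_append, List.prod_append, mul_assoc]
          rw [this]; noncomm_ring
        have hA' : ((A ++ (Q ++ [i])).map w).sum = (A.map w).sum + s := by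
          rw [List.map_append, List.sum_append]
        have hlen : R.length ≤ n := by
          simp only [List.length_append, List.length_cons] at hL; omega
        have t1 := ih R hlen (A ++ (Q ++ [i]))
        rw [hA'] at t1
        have t2 : ‖((A.map g).prod * e) * q * ((1 - e) * (R.map g).prod)‖ ≤
            (c₁ * Real.exp (η * (A.map w).sum)) * (b * b) *
              (c₂ * Real.exp (η * (R.map w).sum)) := by
          refine (norm_mul_le _ _).trans (mul_le_mul ((norm_mul_le _ _).trans
            (mul_le_mul (h₁ A) hqn (norm_nonneg _) (by positivity))) (h₂ R) (norm_nonneg _)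
            (by positivity))
        rw [hLq, hLw, hsplit]
        have t3 : (c₁ * Real.exp (η * (A.map w).sum)) * (b * b) *
              (c₂ * Real.exp (η * (R.map w).sum)) ≤
            K * Real.exp (η * ((A.map w).sum + (s + (R.map w).sum))) := by
          calc _ = (c₁ * (b * b) * c₂) * Real.exp (η * ((A.map w).sum + (R.map w).sum)) := by
                rw [mul_add, Real.exp_add]; ring
            _ ≤ _ := mul_le_mul (le_add_of_nonneg_left (by positivity))
                (Real.exp_le_exp.2 (by nlinarith)) (Real.exp_pos _).le hK0
        refine (norm_add_le _ _).trans ((add_le_add t1 (t2.trans t3)).trans ?_)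
        rw [add_assoc (A.map w).sum]
        set X := Real.exp (η * ((A.map w).sum + (s + (R.map w).sum)))
        have hX : 0 < X := Real.exp_pos _
        have : 0 ≤ K * X := by positivity
        nlinarith
  refine ⟨K * (1 + 1 / η) + c₂, fun L => ?_⟩
  have hL0 := sum_map_nonneg hw L
  set s := (L.map w).sum with hs
  have e1 := key L.length L le_rfl []
  simp only [List.map_nil, List.prod_nil, one_mul, List.sum_nil, zero_add] at e1
  have hdec : (L.map g).prod = e * (L.map g).prod + (1 - e) * (L.map g).prod := by noncomm_ring
  have hexp : Real.exp (2 * η * s) = Real.exp (η * s) * Real.exp (η * s) := by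
    rw [← Real.exp_add]; ring_nf
  -- The linear factor is absorbed by the second half of the rate `2 * η`.
  have hs1 : s + 1 ≤ (1 + 1 / η) * Real.exp (η * s) := by
    have h3 := Real.add_one_le_exp (η * s)
    have : (1 + 1 / η) * Real.exp (η * s) ≥ (1 + 1 / η) * (η * s + 1) := by gcongr
    have h4 : (1 + 1 / η) * (η * s + 1) = η * s + 1 + s + 1 / η := by field_simp; ring
    have : 0 ≤ η * s := by positivity
    have : 0 < 1 / η := by positivity
    linarith
  have hE1 : 1 ≤ Real.exp (η * s) := Real.one_le_exp (by positivity)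
  rw [hdec]
  refine (norm_add_le _ _).trans ((add_le_add e1 (h₂ L)).trans ?_)
  rw [hexp]
  have hE0 := Real.exp_pos (η * s)
  calc (s + 1) * K * Real.exp (η * s) + c₂ * Real.exp (η * s)
      ≤ ((1 + 1 / η) * Real.exp (η * s)) * K * Real.exp (η * s) +
        c₂ * (Real.exp (η * s) * Real.exp (η * s)) := by
        refine add_le_add (by gcongr) (mul_le_mul_of_nonneg_left ?_ hc₂)
        nlinarith
    _ = _ := by ring

end Growth

end SingPert

namespace SingPert

/-! ### The weighted Berger-Wang theorem -/

section BergerWang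

variable {ι : Type*}

/-- **Weighted Berger-Wang theorem**: if all eigenvalues of all products of a locally bounded family
of operators lie in the closed unit disc, then the products grow subexponentially with respect to
their weight. -/
theorem exists_norm_prod_le_exp {w : ι → ℝ} (hw : ∀ i, 0 ≤ w i) (n : ℕ) :
    ∀ (V : Type) [NormedAddCommGroup V] [NormedSpace ℂ V] [FiniteDimensional ℂ V],
      Module.finrank ℂ V ≤ n → ∀ (g : ι → V →L[ℂ] V) (b : ℝ), (∀ i, ‖g i‖ ≤ b) →
      (∀ L : List ι, (L.map w).sum ≤ 1 → ‖(L.map g).prod‖ ≤ b) →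
      (∀ (L : List ι) (z : ℂ),
        Module.End.HasEigenvalue ((L.map g).prod : V →ₗ[ℂ] V) z → ‖z‖ ≤ 1) →
      ∀ η : ℝ, 0 < η → ∃ C, ∀ L : List ι,
        ‖(L.map g).prod‖ ≤ C * Real.exp (η * (L.map w).sum) := by
  induction n with
  | zero =>
    intro V _ _ _ hn g b hb hb' hg η hη
    have : Subsingleton V := Module.finrank_zero_iff.1 (Nat.le_zero.1 hn)
    exact ⟨0, fun L => by rw [Subsingleton.elim (L.map g).prod 0]; simp⟩
  | succ n ih =>
    intro V _ _ _ hn g b hb hb' hg η hη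
    have hb0 : 0 ≤ b := (norm_nonneg _).trans (hb' [] (by simp))
    let S : Submonoid (V →L[ℂ] V) :=
      { carrier := {f | ∃ L : List ι, f = (L.map g).prod}
        one_mem' := ⟨[], rfl⟩
        mul_mem' := by
          rintro _ _ ⟨L, rfl⟩ ⟨L', rfl⟩
          exact ⟨L ++ L', by simp⟩ }
    by_cases hirr : ∀ W : Submodule ℂ V, (∀ f ∈ S, ∀ x ∈ W, f x ∈ W) → W = ⊥ ∨ W = ⊤
    · obtain ⟨C, hC⟩ := exists_norm_le_of_irreducible S hirr (c := Module.finrank ℂ V) (by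
        rintro _ ⟨L, rfl⟩
        exact norm_trace_le_of_eigenvalue _ (hg L))
      have hC0 : 0 ≤ C := (norm_nonneg _).trans (hC 1 S.one_mem)
      refine ⟨C, fun L => (hC _ ⟨L, rfl⟩).trans ?_⟩
      exact le_mul_of_one_le_right hC0
        (Real.one_le_exp (mul_nonneg hη.le (sum_map_nonneg hw L)))
    -- Reducible case: `W` is a proper nonzero invariant subspace. Compression to `W` is
    -- restriction, and compression to a complement `U` is the quotient action; both are
    -- multiplicative along products.
    push Not at hirr
    obtain ⟨W, hW, hWb, hWt⟩ := hirr
    obtain ⟨U, hWU⟩ := Submodule.exists_isCompl W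
    have hinv : ∀ (L : List ι), ∀ x ∈ W, (L.map g).prod x ∈ W := fun L => hW _ ⟨L, rfl⟩
    have hinvi : ∀ i, ∀ x ∈ W, g i x ∈ W := fun i => by simpa using hinv [i]
    let pW : V →L[ℂ] W := LinearMap.toContinuousLinearMap (W.projectionOnto U hWU)
    let pU : V →L[ℂ] U := LinearMap.toContinuousLinearMap (U.projectionOnto W hWU.symm)
    have hpW : ∀ x ∈ W, (pW x : V) = x := fun x hx =>
      congrArg Subtype.val (Submodule.projectionOnto_apply_of_mem_left hWU hx)
    have hpU0 : ∀ x ∈ W, pU x = 0 := fun x hx =>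
      (Submodule.projectionOnto_apply_eq_zero_iff hWU.symm).2 hx
    have hsum : ∀ x, (pW x : V) + pU x = x := fun x =>
      Submodule.projection_add_projection_eq_self hWU x
    let gW : ι → W →L[ℂ] W := fun i => pW ∘L g i ∘L W.subtypeL
    let gU : ι → U →L[ℂ] U := fun i => pU ∘L g i ∘L U.subtypeL
    have hgW : ∀ L : List ι, (L.map gW).prod = pW ∘L (L.map g).prod ∘L W.subtypeL := by
      intro L
      induction L with
      | nil => ext x; simp [hpW x x.2]
      | cons i L ih =>
        rw [List.map_cons, List.prod_cons, ih]
        ext x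
        simp only [gW, mul_apply_eq_comp, ContinuousLinearMap.comp_apply,
          List.map_cons, List.prod_cons, Submodule.subtypeL_apply]
        rw [hpW _ (hinv L x x.2)]
    have hpUg : ∀ (L : List ι) (x : V), pU ((L.map g).prod (pU x)) = pU ((L.map g).prod x) := by
      intro L x
      conv_rhs => rw [← hsum x]
      rw [map_add, map_add, hpU0 _ (hinv L _ (pW x).2), zero_add]
    have hgU : ∀ L : List ι, (L.map gU).prod = pU ∘L (L.map g).prod ∘L U.subtypeL := by
      intro L
      induction L with
      | nil =>
        ext x
        exact (congrArg Subtype.val (Submodule.projectionOnto_apply_left hWU.symm x)).symm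
      | cons i L ih =>
        rw [List.map_cons, List.prod_cons, ih]
        ext x
        simp only [gU, mul_apply_eq_comp, ContinuousLinearMap.comp_apply,
          List.map_cons, List.prod_cons, Submodule.subtypeL_apply]
        have := hpUg [i] ((L.map g).prod x)
        simp only [List.map_cons, List.map_nil, List.prod_cons, List.prod_nil, mul_one] at this
        rw [this]
    have hWlt : Module.finrank ℂ W ≤ n := by
      have := Submodule.finrank_lt hWt
      omega
    have hUlt : Module.finrank ℂ U ≤ n := by
      have h1 := Submodule.finrank_add_eq_of_isCompl hWU
      have h2 : 0 < Module.finrank ℂ W := by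
        rw [Module.finrank_pos_iff]
        exact Submodule.nontrivial_iff_ne_bot.2 hWb
      omega
    have hcomp : ∀ {X : Submodule ℂ V} (p : V →L[ℂ] X) (f : V →L[ℂ] V),
        ‖p ∘L f ∘L X.subtypeL‖ ≤ ‖p‖ * ‖f‖ := by
      intro X p f
      refine (ContinuousLinearMap.opNorm_comp_le _ _).trans
        (mul_le_mul_of_nonneg_left ?_ (norm_nonneg _))
      refine (ContinuousLinearMap.opNorm_comp_le _ _).trans ?_
      exact mul_le_of_le_one_right (norm_nonneg _) (Submodule.norm_subtypeL_le X)
    obtain ⟨C₁, hC₁⟩ := ih W hWlt gW (‖pW‖ * b)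
      (fun i => (hcomp _ _).trans (mul_le_mul_of_nonneg_left (hb i) (norm_nonneg pW)))
      (fun L hL => by
        rw [hgW]
        exact (hcomp _ _).trans (mul_le_mul_of_nonneg_left (hb' L hL) (norm_nonneg pW)))
      (fun L z hz => by
        obtain ⟨v, hv, hv0⟩ := hz.exists_hasEigenvector
        refine hg L z (Module.End.hasEigenvalue_of_hasEigenvector (x := (v : V)) ⟨?_, ?_⟩)
        · rw [Module.End.mem_eigenspace_iff] at hv ⊢
          have h := congrArg Subtype.val hv
          rw [hgW] at h
          simp only [ContinuousLinearMap.coe_coe, ContinuousLinearMap.comp_apply,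
            Submodule.subtypeL_apply] at h
          rw [hpW _ (hinv L v v.2)] at h
          simpa using h
        · simpa using hv0) (η / 2) (half_pos hη)
    obtain ⟨C₂, hC₂⟩ := ih U hUlt gU (‖pU‖ * b)
      (fun i => (hcomp _ _).trans (mul_le_mul_of_nonneg_left (hb i) (norm_nonneg pU)))
      (fun L hL => by
        rw [hgU]
        exact (hcomp _ _).trans (mul_le_mul_of_nonneg_left (hb' L hL) (norm_nonneg pU)))
      -- An eigenvalue of the quotient action is an eigenvalue of the product. Otherwise `T`, the
      -- product minus `z`, is injective, hence maps `W` onto `W`. An eigenvector `v ∈ U` of the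
      -- compression has `T v ∈ W`, so `T v = T x` with `x ∈ W`, and `v = x ∈ W ⊓ U = ⊥`.
      (fun L z hz => by
        by_contra hz1
        obtain ⟨v, hv, hv0⟩ := hz.exists_hasEigenvector
        set T : V →ₗ[ℂ] V := ((L.map g).prod : V →L[ℂ] V) - z • (1 : V →ₗ[ℂ] V) with hT
        have hTinj : Function.Injective T := by
          rw [injective_iff_map_eq_zero]
          intro x hx
          by_contra hx0
          refine hz1 (hg L z (Module.End.hasEigenvalue_of_hasEigenvector (x := x) ⟨?_, hx0⟩))
          rw [Module.End.mem_eigenspace_iff]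
          simpa [hT, sub_eq_zero] using hx
        have hTW : ∀ x ∈ W, T x ∈ W := fun x hx => by
          simpa [hT] using W.sub_mem (hinv L x hx) (W.smul_mem z hx)
        have hTv : T v ∈ W := by
          rw [← Submodule.projectionOnto_apply_eq_zero_iff hWU.symm]
          rw [Module.End.mem_eigenspace_iff] at hv
          change pU (T v) = 0
          have h : (pU ((L.map g).prod v)) = z • v := by
            rw [hgU] at hv
            simpa using hv
          have h3 : pU v = v := Submodule.projectionOnto_apply_left hWU.symm v
          simp [hT, h, h3]
        have hsurj : Function.Surjective (T.restrict hTW) := by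
          refine LinearMap.surjective_of_injective ?_
          intro x y hxy
          exact Subtype.ext (hTinj (congrArg Subtype.val hxy))
        obtain ⟨x, hx⟩ := hsurj ⟨T v, hTv⟩
        have hxv : (x : V) = v := hTinj (congrArg Subtype.val hx)
        have : (v : V) ∈ W ⊓ U := ⟨hxv ▸ x.2, v.2⟩
        rw [hWU.inf_eq_bot, Submodule.mem_bot] at this
        exact hv0 (by simpa using this)) (η / 2) (half_pos hη)
    let e : V →L[ℂ] V := W.subtypeL ∘L pW
    have heW : ∀ x ∈ W, e x = x := hpW
    have he1 : ∀ x, (1 - e) x = pU x := fun x => by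
      rw [sub_apply, one_apply_eq_self, sub_eq_iff_eq_add']
      exact (hsum x).symm
    obtain ⟨C, hC⟩ := exists_norm_prod_le_of_blocks hw g hb hb' e (η := η / 2)
      (c₁ := C₁ * ‖pW‖) (c₂ := C₂ * ‖pU‖) (fun L => by
        ext x
        exact heW _ (hinv L _ (pW x).2)) (half_pos hη) (fun L => by
        have : (L.map g).prod * e = W.subtypeL ∘L (L.map gW).prod ∘L pW := by
          ext x
          rw [hgW]
          exact (heW _ (hinv L _ (pW x).2)).symm
        rw [this]
        refine (ContinuousLinearMap.opNorm_comp_le _ _).trans ?_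
        refine (mul_le_of_le_one_left (norm_nonneg _) (Submodule.norm_subtypeL_le W)).trans ?_
        refine (ContinuousLinearMap.opNorm_comp_le _ _).trans ?_
        rw [mul_right_comm]
        exact mul_le_mul_of_nonneg_right (hC₁ L) (norm_nonneg _)) (fun L => by
        have : (1 - e) * (L.map g).prod = U.subtypeL ∘L (L.map gU).prod ∘L pU := by
          ext x
          rw [hgU, mul_apply_eq_comp, he1]
          exact congrArg Subtype.val (hpUg L x).symm
        rw [this]
        refine (ContinuousLinearMap.opNorm_comp_le _ _).trans ?_
        refine (mul_le_of_le_one_left (norm_nonneg _) (Submodule.norm_subtypeL_le U)).trans ?_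
        refine (ContinuousLinearMap.opNorm_comp_le _ _).trans ?_
        rw [mul_right_comm]
        exact mul_le_mul_of_nonneg_right (hC₂ L) (norm_nonneg _))
    refine ⟨C, fun L => ?_⟩
    have := hC L
    rwa [mul_div_cancel₀ η two_ne_zero] at this

end BergerWang

end SingPert

namespace SingPert

open scoped Matrix.Norms.Operator

/-! ### Real matrices -/

section RealMatrix

variable {n : Type} [Fintype n] [DecidableEq n]

/-- All complex eigenvalues of the real matrix `A` have modulus at most `r`. -/
def SpecBound (A : Matrix n n ℝ) (r : ℝ) : Prop :=
  ∀ z ∈ spectrum ℂ (A.map (algebraMap ℝ ℂ)), ‖z‖ ≤ r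

/-- The operator on `ℂⁿ` with a given real matrix. -/
noncomputable def complexOperator (n : Type) [Fintype n] [DecidableEq n] :
    Matrix n n ℝ →* ((n → ℂ) →L[ℂ] (n → ℂ)) where
  toFun A := ContinuousLinearMap.mk (Matrix.mulVecLin (A.map (algebraMap ℝ ℂ)))
  map_one' := by
    ext x : 1
    simp [Matrix.map_one]
  map_mul' A B := by
    ext x : 1
    change ((A * B).map (algebraMap ℝ ℂ)).mulVec x = _
    rw [Matrix.map_mul, ← Matrix.mulVec_mulVec]
    rfl

/-- The row-sum norm is the operator norm for the sup norm over `ℝ` and over `ℂ`, so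
complexification costs no constant. -/
theorem norm_complexOperator (A : Matrix n n ℝ) : ‖complexOperator n A‖ = ‖A‖ := by
  change ‖ContinuousLinearMap.mk (Matrix.mulVecLin (A.map (algebraMap ℝ ℂ)))‖ = _
  rw [← Matrix.linfty_opNorm_eq_opNorm, Matrix.linfty_opNorm_def, Matrix.linfty_opNorm_def]
  simp

theorem complexOperator_smul (c : ℝ) (A : Matrix n n ℝ) :
    complexOperator n (c • A) = (c : ℂ) • complexOperator n A := by
  ext x i
  simp [complexOperator, Matrix.mulVec, dotProduct, Finset.mul_sum, mul_assoc]

theorem hasEigenvalue_complexOperator (A : Matrix n n ℝ) (z : ℂ) :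
    Module.End.HasEigenvalue (complexOperator n A : (n → ℂ) →ₗ[ℂ] (n → ℂ)) z ↔
      z ∈ spectrum ℂ (A.map (algebraMap ℝ ℂ)) := by
  rw [Module.End.hasEigenvalue_iff_mem_spectrum, ← Matrix.spectrum_toLin']
  rfl

theorem prod_map_smul {ι : Type*} (c : ι → ℝ) (g : ι → Matrix n n ℝ) (L : List ι) :
    (L.map fun i => c i • g i).prod = (L.map c).prod • (L.map g).prod := by
  induction L with
  | nil => simp
  | cons i L ih => simp [ih, smul_smul, mul_comm]

theorem prod_map_exp {ι : Type*} (μ : ℝ) (w : ι → ℝ) (L : List ι) :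
    (L.map fun i => Real.exp (μ * w i)).prod = Real.exp (μ * (L.map w).sum) := by
  induction L with
  | nil => simp
  | cons i L ih => simp [ih, mul_add, Real.exp_add]

/-- Weighted Berger-Wang theorem for real matrices: the spectral radii of the products determine
their exponential growth rate. -/
theorem exists_norm_prod_le_of_specBound {ι : Type*} (T : Set ι) {w : ι → ℝ}
    (hw : ∀ i ∈ T, 0 ≤ w i) (g : ι → Matrix n n ℝ) {b b' μ : ℝ}
    (hb : ∀ i ∈ T, ‖g i‖ ≤ b * Real.exp (μ * w i))
    (hb' : ∀ L : List ι, (∀ i ∈ L, i ∈ T) → (L.map w).sum ≤ 1 → ‖(L.map g).prod‖ ≤ b')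
    (hg : ∀ L : List ι, L ≠ [] → (∀ i ∈ L, i ∈ T) →
      SpecBound (L.map g).prod (Real.exp (μ * (L.map w).sum)))
    {η : ℝ} (hη : 0 < η) :
    ∃ C, ∀ L : List ι, (∀ i ∈ L, i ∈ T) →
      ‖(L.map g).prod‖ ≤ C * Real.exp ((μ + η) * (L.map w).sum) := by
  let w' : T → ℝ := fun i => w i
  -- Dividing each letter by `e^{μ w}` normalizes the spectral bound to the unit disc.
  let g' : T → Matrix n n ℝ := fun i => Real.exp (-μ * w i) • g i
  have hval : ∀ L : List T, (L.map g').prod =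
      Real.exp (-μ * ((L.map Subtype.val).map w).sum) • ((L.map Subtype.val).map g).prod := by
    intro L
    simp only [g']
    rw [prod_map_smul (fun i : T => Real.exp (-μ * w i)) (fun i : T => g i),
      prod_map_exp (-μ) (fun i : T => w i), List.map_map, List.map_map]
    rfl
  have hww : ∀ L : List T, (L.map w').sum = ((L.map Subtype.val).map w).sum := fun L => by
    rw [List.map_map]; rfl
  have hmem : ∀ L : List T, ∀ i ∈ L.map Subtype.val, i ∈ T := by
    intro L i hi
    obtain ⟨j, -, rfl⟩ := List.mem_map.1 hi
    exact j.2
  have hw' : ∀ i, 0 ≤ w' i := fun i => hw i i.2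
  have hb'0 : 0 ≤ b' := (norm_nonneg _).trans (hb' [] (by simp) (by simp))
  let G : T → (n → ℂ) →L[ℂ] (n → ℂ) := fun i => complexOperator n (g' i)
  have hG : ∀ L : List T, (L.map G).prod = complexOperator n (L.map g').prod := fun L => by
    rw [map_list_prod, List.map_map]; rfl
  -- For total weight in `[0, 1]` the normalizing factor is at most `e^{|μ|}`.
  obtain ⟨C, hC⟩ := exists_norm_prod_le_exp hw' _ (n → ℂ) le_rfl G
    (max b (Real.exp |μ| * b')) (fun i => by
      refine le_max_of_le_left ?_
      rw [norm_complexOperator, norm_smul, Real.norm_eq_abs, Real.abs_exp]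
      refine (mul_le_mul_of_nonneg_left (hb i i.2) (Real.exp_pos _).le).trans ?_
      rw [mul_left_comm, ← Real.exp_add]; simp)
    (fun L hL => by
      refine le_max_of_le_right ?_
      rw [hG, norm_complexOperator, hval, norm_smul, Real.norm_eq_abs, Real.abs_exp]
      have h0 := sum_map_nonneg hw' L
      rw [hww] at hL h0
      refine mul_le_mul (Real.exp_le_exp.2 ?_) (hb' _ (hmem L) hL) (norm_nonneg _)
        (Real.exp_pos _).le
      have := neg_abs_le μ
      nlinarith [abs_nonneg μ])
    (fun L z hz => by
      rw [hG, hval, complexOperator_smul] at hz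
      rcases eq_or_ne L [] with rfl | hLne
      · obtain ⟨v, hv, hv0⟩ := hz.exists_hasEigenvector
        rw [Module.End.mem_eigenspace_iff] at hv
        have hv' : (1 - z) • v = 0 := by
          simp only [List.map_nil, List.sum_nil, mul_zero, Real.exp_zero, Complex.ofReal_one,
            List.prod_nil, map_one, one_smul] at hv
          rw [sub_smul, one_smul, sub_eq_zero]
          exact hv
        rcases smul_eq_zero.1 hv' with h | h
        · rw [← sub_eq_zero.1 h]; simp
        · exact absurd h hv0
      obtain ⟨v, hv, hv0⟩ := hz.exists_hasEigenvector
      rw [Module.End.mem_eigenspace_iff] at hv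
      set c : ℝ := Real.exp (-μ * ((L.map Subtype.val).map w).sum) with hc
      have hc0 : (c : ℂ) ≠ 0 := by
        rw [Ne, Complex.ofReal_eq_zero]; exact (Real.exp_pos _).ne'
      have hev : Module.End.HasEigenvalue
          (complexOperator n ((L.map Subtype.val).map g).prod : (n → ℂ) →ₗ[ℂ] (n → ℂ))
          ((c : ℂ)⁻¹ * z) := by
        refine Module.End.hasEigenvalue_of_hasEigenvector (x := v) ⟨?_, hv0⟩
        rw [Module.End.mem_eigenspace_iff, mul_smul, ← hv]
        exact (inv_smul_smul₀ hc0 _).symm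
      have h := hg _ (mt List.map_eq_nil_iff.1 hLne) (hmem L) _
        ((hasEigenvalue_complexOperator _ _).1 hev)
      rw [norm_mul, norm_inv, Complex.norm_real, Real.norm_eq_abs, hc, Real.abs_exp,
        ← Real.exp_neg, neg_mul, neg_neg] at h
      exact (mul_le_iff_le_one_right (Real.exp_pos _)).1 h) η hη
  refine ⟨C, fun L hL => ?_⟩
  lift L to List T using hL
  have h := hC L
  rw [hG, norm_complexOperator, hval, norm_smul, Real.norm_eq_abs, Real.abs_exp, hww] at h
  rw [add_mul, Real.exp_add, mul_left_comm]
  refine le_trans ?_ (mul_le_mul_of_nonneg_left h (Real.exp_pos _).le)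
  rw [← mul_assoc, ← Real.exp_add]
  simp

/-- Uniform exponential bounds for a compact family of one-parameter semigroups. -/
theorem exists_norm_semigroup_le {X : Type*} [TopologicalSpace X] {K : Set X} (hK : IsCompact K)
    (G : X → ℝ → Matrix n n ℝ)
    (hadd : ∀ x ∈ K, ∀ s t, G x (s + t) = G x s * G x t)
    (hcont : ∀ s, ContinuousOn (fun x => G x s) K)
    (hbdd : ∀ S : ℝ, ∃ b, ∀ x ∈ K, ∀ s ∈ Set.Icc 0 S, ‖G x s‖ ≤ b) {μ : ℝ}
    (hG : ∀ x ∈ K, ∀ s, 0 < s → SpecBound (G x s) (Real.exp (μ * s))) {η : ℝ} (hη : 0 < η) :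
    ∃ C, 0 < C ∧ ∀ x ∈ K, ∀ s, 0 ≤ s → ‖G x s‖ ≤ C * Real.exp ((μ + η) * s) := by
  -- Only positive powers: `G x 0` need not be the identity, being merely a projection for the
  -- reduced system.
  have hpow : ∀ x ∈ K, ∀ (t : ℝ) (k : ℕ), G x ((k + 1 : ℕ) * t) = G x t ^ (k + 1) := by
    intro x hx t k
    induction k with
    | zero => simp
    | succ k ih => rw [pow_succ, ← ih, ← hadd x hx]; congr 1; push_cast; ring
  suffices h : ∃ C, 0 < C ∧ ∀ x ∈ K ∩ K, ∀ s, 0 ≤ s → ‖G x s‖ ≤ C * Real.exp ((μ + η) * s) by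
    simpa using h
  refine hK.induction_on (p := fun T => ∃ C, 0 < C ∧ ∀ x ∈ T ∩ K, ∀ s, 0 ≤ s →
    ‖G x s‖ ≤ C * Real.exp ((μ + η) * s)) ⟨1, one_pos, by simp⟩ ?_ ?_ ?_
  · rintro s t hst ⟨C, hC0, hC⟩
    exact ⟨C, hC0, fun x hx => hC x ⟨hst hx.1, hx.2⟩⟩
  · rintro s t ⟨C, hC0, hC⟩ ⟨C', -, hC'⟩
    refine ⟨max C C', lt_max_of_lt_left hC0, fun x hx r hr => ?_⟩
    rcases hx with ⟨hx | hx, hxK⟩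
    · exact (hC x ⟨hx, hxK⟩ r hr).trans
        (mul_le_mul_of_nonneg_right (le_max_left _ _) (Real.exp_pos _).le)
    · exact (hC' x ⟨hx, hxK⟩ r hr).trans
        (mul_le_mul_of_nonneg_right (le_max_right _ _) (Real.exp_pos _).le)
  -- Local bound near `x`: Berger-Wang for the powers of `G x 1` alone makes the norm at some large
  -- time strictly smaller than the target. Strictness persists at nearby points, and the semigroup
  -- law propagates it to all times.
  intro x hx
  obtain ⟨C, hC⟩ := exists_norm_prod_le_of_specBound (Set.univ : Set Unit) (w := fun _ => 1)
    (by simp) (fun _ => G x 1) (b := ‖G x 1‖ * Real.exp (-μ)) (μ := μ)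
    (b' := ‖(1 : Matrix n n ℝ)‖ + ‖G x 1‖) (by
      intro _ _
      rw [mul_assoc, ← Real.exp_add]; simp)
    (by
      intro L _ hL
      have hlen : L.length ≤ 1 := by
        simp only [List.map_const', List.sum_replicate, nsmul_eq_mul, mul_one] at hL
        exact_mod_cast hL
      rcases L with _ | ⟨i, _ | ⟨j, L⟩⟩
      · simp
      · simp
      · simp at hlen)
    (by
      intro L hL _
      rw [List.map_const', List.prod_replicate, List.map_const', List.sum_replicate, nsmul_eq_mul]
      obtain ⟨k, hk⟩ := Nat.exists_eq_succ_of_ne_zero (by simpa using hL : L.length ≠ 0)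
      rw [hk, Nat.succ_eq_add_one, ← hpow x hx]
      exact hG x hx _ (by positivity)) (half_pos hη)
  have hC0 : 0 < |C| + 1 := by positivity
  -- Large enough that `e^{(η/2)(k+1)}` exceeds `C`.
  obtain ⟨k, hk⟩ := exists_nat_gt ((|C| + 1) / (η / 2))
  have hklt : ‖G x ((k + 1 : ℕ) * 1)‖ < Real.exp ((μ + η) * (k + 1 : ℕ)) := by
    have h := hC (List.replicate (k + 1) ()) (by simp)
    rw [List.map_const', List.prod_replicate, List.map_const', List.sum_replicate, nsmul_eq_mul,
      List.length_replicate, ← hpow x hx, mul_one] at h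
    rw [mul_one]
    refine h.trans_lt ?_
    have h1 : (μ + η) * (k + 1 : ℕ) = (η / 2) * (k + 1 : ℕ) + (μ + η / 2) * (k + 1 : ℕ) := by ring
    rw [h1, Real.exp_add]
    refine mul_lt_mul_of_pos_right ?_ (Real.exp_pos _)
    have h2 := Real.add_one_le_exp (η / 2 * (k + 1 : ℕ))
    rw [div_lt_iff₀ (half_pos hη)] at hk
    push_cast at h2 ⊢
    nlinarith [le_abs_self C]
  have hev : ∀ᶠ y in 𝓝[K] x, ‖G y ((k + 1 : ℕ) * 1)‖ < Real.exp ((μ + η) * (k + 1 : ℕ)) :=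
    ((hcont _ x hx).norm).eventually_lt_const hklt
  obtain ⟨b, hb⟩ := hbdd ((k + 1 : ℕ) : ℝ)
  have hb0 : 0 ≤ b := (norm_nonneg _).trans (hb x hx 0 ⟨le_rfl, by positivity⟩)
  -- The constant pays for the remainder of `s` modulo `k + 1`: its propagator, and the exponential
  -- missing over it.
  refine ⟨_, hev, (b + 1) * Real.exp (|μ + η| * (k + 1 : ℕ)), by positivity, ?_⟩
  rintro y ⟨hy, hyK⟩ s hs
  set N : ℝ := ((k + 1 : ℕ) : ℝ) with hN
  have hN0 : 0 < N := by positivity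
  set m := ⌊s / N⌋₊ with hm
  have hm1 : m * N ≤ s := by
    rw [← le_div_iff₀ hN0]; exact Nat.floor_le (by positivity)
  have hm2 : s < (m + 1) * N := by
    rw [← div_lt_iff₀ hN0]; exact Nat.lt_floor_add_one _
  have hbr : ‖G y (s - m * N)‖ ≤ b + 1 :=
    (hb y hyK _ ⟨by linarith, by linarith⟩).trans (by linarith)
  have hGm : ‖G y s‖ ≤ Real.exp ((μ + η) * (m * N)) * (b + 1) := by
    rcases Nat.eq_zero_or_pos m with h0 | h0
    · simpa [h0] using hbr
    · obtain ⟨j, hj⟩ := Nat.exists_eq_succ_of_ne_zero h0.ne'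
      have hs' : G y s = G y N ^ m * G y (s - m * N) := by
        rw [hj, Nat.succ_eq_add_one, ← hpow y hyK, ← hadd y hyK]; congr 1; ring
      rw [hs']
      refine (norm_mul_le _ _).trans (mul_le_mul ?_ hbr (norm_nonneg _) (Real.exp_pos _).le)
      have h1 : Real.exp ((μ + η) * (m * N)) = Real.exp ((μ + η) * N) ^ m := by
        rw [← Real.exp_nat_mul]; congr 1; ring
      rw [h1]
      have hy' : ‖G y (N * 1)‖ < Real.exp ((μ + η) * N) := hy
      rw [mul_one] at hy'
      exact (norm_pow_le' _ h0).trans (pow_le_pow_left₀ (norm_nonneg _) hy'.le _)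
  refine hGm.trans ?_
  rw [mul_comm, mul_assoc, ← Real.exp_add]
  refine mul_le_mul_of_nonneg_left (Real.exp_le_exp.2 ?_) (by positivity)
  have h1 := neg_abs_le (μ + η)
  have h2 : (μ + η) * s = (μ + η) * (m * N) + (μ + η) * (s - m * N) := by ring
  have h3 : 0 ≤ s - m * N := by linarith
  have h4 : s - m * N ≤ N := by linarith
  nlinarith [abs_nonneg (μ + η)]

end RealMatrix

end SingPert

namespace SingPert

open scoped Matrix.Norms.Operator

/-! ### Matrix exponentials -/

section Exponential

theorem norm_exp_sub_one_le {𝔸 : Type*} [NormedRing 𝔸] [NormedAlgebra ℝ 𝔸] [CompleteSpace 𝔸]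
    (x : 𝔸) : ‖NormedSpace.exp x - 1‖ ≤ ‖x‖ * Real.exp ‖x‖ := by
  have h1 := NormedSpace.exp_series_hasSum_exp' (𝕂 := ℝ) x
  have h2 := NormedSpace.exp_series_hasSum_exp' (𝕂 := ℝ) ‖x‖
  rw [← hasSum_nat_add_iff' 1] at h1 h2
  simp only [Finset.range_one, Finset.sum_singleton, Nat.factorial_zero, Nat.cast_one, inv_one,
    pow_zero, one_smul, smul_eq_mul, mul_one, ← Real.exp_eq_exp_ℝ] at h1 h2
  have h3 := h1.norm_le_of_bounded h2 fun n => by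
    rw [norm_smul, Real.norm_of_nonneg (by positivity)]
    exact mul_le_mul_of_nonneg_left (norm_pow_le' _ n.succ_pos) (by positivity)
  refine h3.trans ?_
  -- Used as `1 - a ≤ e^{-a}`, that is, `e^a - 1 ≤ a e^a`.
  have h4 := Real.add_one_le_exp (-‖x‖)
  have h5 : Real.exp ‖x‖ * Real.exp (-‖x‖) = 1 := by rw [← Real.exp_add]; simp
  nlinarith [Real.exp_pos ‖x‖]

variable {m n : ℕ}

/-- Only an inequality, because `n = 0` is allowed. -/
theorem norm_matrix_one_le : ‖(1 : Matrix (Fin n) (Fin n) ℝ)‖ ≤ 1 := by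
  rw [← Matrix.diagonal_one, Matrix.linfty_opNorm_diagonal]
  exact (pi_norm_le_iff_of_nonneg zero_le_one).2 fun _ => by simp

theorem norm_matrix_exp_le (A : Matrix (Fin n) (Fin n) ℝ) :
    ‖NormedSpace.exp A‖ ≤ 1 + ‖A‖ * Real.exp ‖A‖ := by
  have h := norm_add_le (1 : Matrix (Fin n) (Fin n) ℝ) (NormedSpace.exp A - 1)
  rw [add_sub_cancel] at h
  exact h.trans (add_le_add norm_matrix_one_le (norm_exp_sub_one_le A))

theorem exp_add_smul (A : Matrix (Fin n) (Fin n) ℝ) (s t : ℝ) :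
    NormedSpace.exp ((s + t) • A) = NormedSpace.exp (s • A) * NormedSpace.exp (t • A) := by
  rw [add_smul, Matrix.exp_add_of_commute]
  exact ((Commute.refl A).smul_left s).smul_right t

/-- The exponential intertwines whatever the generators intertwine. -/
theorem exp_mul_of_intertwine {A : Matrix (Fin m) (Fin m) ℝ} {B : Matrix (Fin n) (Fin n) ℝ}
    {U : Matrix (Fin m) (Fin n) ℝ} (h : A * U = U * B) :
    NormedSpace.exp A * U = U * NormedSpace.exp B := by
  have hp : ∀ k : ℕ, A ^ k * U = U * B ^ k := by
    intro k
    induction k with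
    | zero => simp
    | succ k ih => rw [pow_succ, Matrix.mul_assoc, h, ← Matrix.mul_assoc, ih, Matrix.mul_assoc,
        pow_succ]
  have h1 := (NormedSpace.exp_series_hasSum_exp' (𝕂 := ℝ) A).map
    (AddMonoidHom.mk' (fun X : Matrix (Fin m) (Fin m) ℝ => X * U) fun X Y => Matrix.add_mul X Y U)
    (continuous_id.matrix_mul continuous_const)
  have h2 := (NormedSpace.exp_series_hasSum_exp' (𝕂 := ℝ) B).map
    (AddMonoidHom.mk' (fun X : Matrix (Fin n) (Fin n) ℝ => U * X) fun X Y => Matrix.mul_add U X Y)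
    (continuous_const.matrix_mul continuous_id)
  have h3 : HasSum (fun k : ℕ => ((k.factorial : ℝ)⁻¹ • A ^ k) * U) (U * NormedSpace.exp B) := by
    simp only [Matrix.smul_mul, hp]
    simp only [← Matrix.mul_smul]
    exact h2
  exact h1.unique h3

/-- Estimates are made in the row-sum norm, exponents are defined with the Euclidean one. The
constants comparing the two do not affect exponential rates. -/
theorem opNorm_le (A : Matrix (Fin m) (Fin n) ℝ) : opNorm A ≤ m * ‖A‖ := by
  refine ContinuousLinearMap.opNorm_le_bound _ (by positivity) fun x => ?_
  have h1 : ∀ i, ‖(Matrix.toEuclideanLin A x) i‖ ≤ ‖A‖ * ‖x‖ := fun i => by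
    have h2 := norm_le_pi_norm (A.mulVec (WithLp.ofLp x)) i
    refine h2.trans ((Matrix.linfty_opNorm_mulVec _ _).trans
      (mul_le_mul_of_nonneg_left ?_ (norm_nonneg _)))
    exact (pi_norm_le_iff_of_nonneg (norm_nonneg x)).2 fun j => PiLp.norm_apply_le x j
  change ‖Matrix.toEuclideanLin A x‖ ≤ _
  rw [EuclideanSpace.norm_eq]
  refine Real.sqrt_le_iff.2 ⟨by positivity, ?_⟩
  have h3 : ∑ i, ‖(Matrix.toEuclideanLin A x) i‖ ^ 2 ≤ ∑ _i : Fin m, (‖A‖ * ‖x‖) ^ 2 :=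
    Finset.sum_le_sum fun i _ => pow_le_pow_left₀ (norm_nonneg _) (h1 i) 2
  refine h3.trans ?_
  rw [Finset.sum_const, Finset.card_univ, Fintype.card_fin, nsmul_eq_mul, mul_assoc,
    mul_pow (m : ℝ)]
  refine mul_le_mul_of_nonneg_right ?_ (by positivity)
  rcases Nat.eq_zero_or_pos m with rfl | hm
  · simp
  · have : (1 : ℝ) ≤ m := by exact_mod_cast hm
    nlinarith

theorem exists_norm_le_opNorm : ∃ c : ℝ, 0 ≤ c ∧ ∀ A : Matrix (Fin m) (Fin n) ℝ,
    ‖A‖ ≤ c * opNorm A := by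
  refine ⟨n, by positivity, fun A => ?_⟩
  have h0 : 0 ≤ opNorm A := norm_nonneg _
  have h1 : ∀ i j, ‖A i j‖ ≤ opNorm A := fun i j => by
    have h2 := (LinearMap.toContinuousLinearMap (Matrix.toEuclideanLin A)).le_opNorm
      (EuclideanSpace.single j 1)
    rw [PiLp.norm_single, norm_one, mul_one] at h2
    refine le_trans (le_of_eq ?_) ((PiLp.norm_apply_le _ i).trans h2)
    simp [Matrix.toEuclideanLin]
  rw [Matrix.linfty_opNorm_def]
  have h3 : (Finset.univ.sup fun i => ∑ j, ‖A i j‖₊) ≤ n * (opNorm A).toNNReal := by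
    refine Finset.sup_le fun i _ => ?_
    refine (Finset.sum_le_sum fun j _ => show ‖A i j‖₊ ≤ (opNorm A).toNNReal from ?_).trans ?_
    · rw [← NNReal.coe_le_coe, Real.coe_toNNReal _ h0]; exact h1 i j
    · simp
  have h4 := NNReal.coe_le_coe.2 h3
  rwa [NNReal.coe_mul, Real.coe_toNNReal _ h0, NNReal.coe_natCast] at h4

end Exponential

/-! ### Bounds on Lyapunov exponents -/

section Exponent

variable {S : Type*} {Sys : ImpulsiveSystem S} {K : Set S} {τ : ℝ}

theorem lyapunovExponent_le_of_bound {C ν : ℝ}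
    (h : ∀ (s : Signal K τ) (t : ℝ), 0 ≤ t → opNorm (Sys.flow s t) ≤ C * Real.exp (ν * t)) :
    Sys.lyapunovExponent K τ ≤ ν := by
  refine EReal.le_of_forall_lt_iff_le.1 fun z hz => ?_
  have hz' : 0 < z - ν := sub_pos.2 (by exact_mod_cast hz)
  -- Any rate `z > ν` swallows the constant `C` for large `t`.
  have hC : ∀ᶠ t : ℝ in atTop, C ≤ Real.exp ((z - ν) * t) :=
    (Real.tendsto_exp_atTop.comp (tendsto_id.const_mul_atTop hz')).eventually_ge_atTop C
  refine limsup_le_of_le (h := ?_)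
  filter_upwards [hC, eventually_gt_atTop 0] with t hCt ht
  refine iSup_le fun s => ?_
  rw [EReal.div_le_iff_le_mul (by exact_mod_cast ht) (EReal.coe_ne_top t)]
  have h1 : opNorm (Sys.flow s t) ≤ Real.exp (t * z) := by
    refine (h s t ht.le).trans ((mul_le_mul_of_nonneg_right hCt (Real.exp_pos _).le).trans ?_)
    rw [← Real.exp_add]
    exact Real.exp_le_exp.2 (le_of_eq (by ring))
  refine (ENNReal.log_le_log (ENNReal.ofReal_le_ofReal h1)).trans ?_
  rw [ENNReal.log_ofReal_of_pos (Real.exp_pos _), Real.log_exp, EReal.coe_mul]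

theorem le_lyapunovExponent_of_bound {c ν : ℝ} (hc : 0 < c) (s : Signal K τ)
    (h : ∀ t : ℝ, 0 ≤ t → c * Real.exp (ν * t) ≤ opNorm (Sys.flow s t)) :
    (ν : EReal) ≤ Sys.lyapunovExponent K τ := by
  refine EReal.ge_of_forall_gt_iff_ge.1 fun z hz => ?_
  have hz' : 0 < ν - z := sub_pos.2 (by exact_mod_cast hz)
  have hC : ∀ᶠ t : ℝ in atTop, c⁻¹ ≤ Real.exp ((ν - z) * t) :=
    (Real.tendsto_exp_atTop.comp (tendsto_id.const_mul_atTop hz')).eventually_ge_atTop _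
  refine le_limsup_of_frequently_le (Eventually.frequently ?_)
  filter_upwards [hC, eventually_gt_atTop 0] with t hCt ht
  refine le_iSup_of_le s ?_
  rw [EReal.le_div_iff_mul_le (by exact_mod_cast ht) (EReal.coe_ne_top t)]
  have h1 : Real.exp (z * t) ≤ opNorm (Sys.flow s t) := by
    refine le_trans ?_ (h t ht.le)
    have h2 : ν * t = (ν - z) * t + z * t := by ring
    rw [h2, Real.exp_add, ← mul_assoc]
    refine le_mul_of_one_le_left (Real.exp_pos _).le ?_
    rwa [inv_le_iff_one_le_mul₀' hc] at hCt
  refine le_trans ?_ (ENNReal.log_le_log (ENNReal.ofReal_le_ofReal h1))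
  rw [ENNReal.log_ofReal_of_pos (Real.exp_pos _), Real.log_exp, EReal.coe_mul]

theorem le_lyapunovExponent_of_trajectory {c ν : ℝ} (hc : 0 < c) (s : Signal K τ)
    (x₀ : EuclideanSpace ℝ (Fin (Sys.dim (s.mode 0)))) (hx₀ : x₀ ≠ 0)
    (h : ∀ t : ℝ, 0 ≤ t → c * Real.exp (ν * t) * ‖x₀‖ ≤ ‖Matrix.toEuclideanLin (Sys.flow s t) x₀‖) :
    (ν : EReal) ≤ Sys.lyapunovExponent K τ := by
  refine le_lyapunovExponent_of_bound hc s fun t ht => ?_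
  have h1 := (LinearMap.toContinuousLinearMap (Matrix.toEuclideanLin (Sys.flow s t))).le_opNorm x₀
  exact le_of_mul_le_mul_right ((h t ht).trans h1) (norm_pos_iff.2 hx₀)

end Exponent

end SingPert

namespace SingPert

open scoped Matrix.Norms.Operator

/-! ### Switched systems realized in a space of fixed dimension -/

namespace Signal

variable {S : Type*} {K : Set S} {τ : ℝ}

/-- The modes and durations of the first `k` pieces of a signal, latest first. -/
noncomputable def steps (s : Signal K τ) : ℕ → List (S × ℝ)
  | 0 => []
  | k + 1 => (s.mode k, s.time (k + 1) - s.time k) :: s.steps k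

theorem le_num_of_succ_le (s : Signal K τ) {k : ℕ} (hk : ((k + 1 : ℕ) : ℕ∞) ≤ s.num) :
    (k : ℕ∞) ≤ s.num :=
  le_trans (by exact_mod_cast k.le_succ) hk

theorem steps_mem (s : Signal K τ) {k : ℕ} (hk : (k : ℕ∞) ≤ s.num) :
    ∀ p ∈ s.steps k, p.1 ∈ K ∧ τ ≤ p.2 ∧ 0 < p.2 := by
  induction k with
  | zero => simp [steps]
  | succ k ih =>
    intro p hp
    rcases List.mem_cons.1 hp with rfl | hp
    · exact ⟨s.mode_mem k (s.le_num_of_succ_le hk), by linarith [s.dwell k hk],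
        by linarith [s.time_lt k hk]⟩
    · exact ih (s.le_num_of_succ_le hk) p hp

theorem sum_steps (s : Signal K τ) (k : ℕ) : ((s.steps k).map Prod.snd).sum = s.time k := by
  induction k with
  | zero => simp [steps, s.time_zero]
  | succ k ih => simp [steps, ih]

end Signal

/-- A presentation of a switched system with state spaces of varying dimension as a system of
`d × d` matrices with mode-dependent reset maps, by injections and projections. -/
structure Realization {S : Type*} (Sys : ImpulsiveSystem S) (K : Set S) (d : ℕ) where
  inn : ∀ σ, Matrix (Fin d) (Fin (Sys.dim σ)) ℝ
  out : ∀ σ, Matrix (Fin (Sys.dim σ)) (Fin d) ℝ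
  reset : S → Matrix (Fin d) (Fin d) ℝ
  out_mul_inn : ∀ σ ∈ K, out σ * inn σ = 1
  jump_eq : ∀ new ∈ K, ∀ old ∈ K, Sys.jump new old = out new * reset old * inn old

namespace Realization

variable {S : Type*} {Sys : ImpulsiveSystem S} {K : Set S} {d : ℕ} {τ : ℝ}
  (r : Realization Sys K d)

/-- The propagator of a mode. -/
noncomputable def prop (σ : S) (t : ℝ) : Matrix (Fin d) (Fin d) ℝ :=
  r.inn σ * NormedSpace.exp (t • Sys.gen σ) * r.out σ

/-- The propagator of a mode followed by the reset. -/
noncomputable def step (p : S × ℝ) : Matrix (Fin d) (Fin d) ℝ := r.reset p.1 * r.prop p.1 p.2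

theorem prop_add {σ : S} (hσ : σ ∈ K) (s t : ℝ) :
    r.prop σ (s + t) = r.prop σ s * r.prop σ t := by
  have h : r.prop σ s * r.prop σ t = r.inn σ * NormedSpace.exp (s • Sys.gen σ) *
      (r.out σ * r.inn σ) * NormedSpace.exp (t • Sys.gen σ) * r.out σ := by
    simp only [prop, Matrix.mul_assoc]
  rw [h, r.out_mul_inn σ hσ, Matrix.mul_one, prop, exp_add_smul]
  simp only [Matrix.mul_assoc]

/-- The `inn` of each jump and the `out` that closes the preceding flow enclose an exponential and
form a propagator, so only the outermost `out` and `inn` remain. -/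
theorem flowAt_eq (s : Signal K τ) {k : ℕ} (hk : (k : ℕ∞) ≤ s.num) :
    Sys.flowAt s k = r.out (s.mode k) * ((s.steps k).map r.step).prod * r.inn (s.mode 0) := by
  induction k with
  | zero => simp [ImpulsiveSystem.flowAt, Signal.steps, r.out_mul_inn _ (s.mode_mem 0 hk)]
  | succ k ih =>
    have hk' := s.le_num_of_succ_le hk
    rw [ImpulsiveSystem.flowAt, ih hk', r.jump_eq _ (s.mode_mem _ hk) _ (s.mode_mem _ hk')]
    simp only [Signal.steps, List.map_cons, List.prod_cons, step, prop, Matrix.mul_assoc]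

theorem flow_eq (s : Signal K τ) {t : ℝ} (ht : 0 ≤ t) :
    Sys.flow s t = r.out (s.mode (s.index t)) *
      (r.prop (s.mode (s.index t)) (t - s.time (s.index t)) *
        ((s.steps (s.index t)).map r.step).prod) * r.inn (s.mode 0) := by
  have hk := (s.index_spec ht).1
  rw [ImpulsiveSystem.flow, ImpulsiveSystem.flowOn, r.flowAt_eq s hk]
  generalize s.index t = k at hk ⊢
  have h : r.out (s.mode k) * (r.inn (s.mode k) *
        NormedSpace.exp ((t - s.time k) • Sys.gen (s.mode k)) * r.out (s.mode k) *
        ((s.steps k).map r.step).prod) * r.inn (s.mode 0) =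
      (r.out (s.mode k) * r.inn (s.mode k)) *
        (NormedSpace.exp ((t - s.time k) • Sys.gen (s.mode k)) *
          (r.out (s.mode k) * ((s.steps k).map r.step).prod * r.inn (s.mode 0))) := by
    simp only [Matrix.mul_assoc]
  rw [prop, h, r.out_mul_inn _ (s.mode_mem k hk), Matrix.one_mul]

end Realization

/-! ### Products of perturbed matrices -/

section Perturbation

variable {d : ℕ}

/-- Replace `Z` by `Y` one factor at a time. The induction carries a prefix made of `Y` only,
bounded by `C` whatever its length. Each replacement then costs a factor `1 + C k w i ≤ e^{C k w
i}`, so the number of factors does not matter, only the total weight. -/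
theorem norm_prod_perturbed_le {ι : Type*} (T : Set ι) (Y Z : ι → Matrix (Fin d) (Fin d) ℝ)
    {C : ℝ} (hC0 : 0 ≤ C) (hC : ∀ L : List ι, (∀ i ∈ L, i ∈ T) → ‖(L.map Y).prod‖ ≤ C) {k : ℝ}
    (w : ι → ℝ) (hZ : ∀ i ∈ T, ‖Z i - Y i‖ ≤ k * w i) (L : List ι) (hL : ∀ i ∈ L, i ∈ T) :
    ‖(L.map Z).prod‖ ≤ C * Real.exp (C * k * (L.map w).sum) := by
  suffices h : ∀ A : List ι, (∀ i ∈ A, i ∈ T) →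
      ‖(A.map Y).prod * (L.map Z).prod‖ ≤ C * Real.exp (C * k * (L.map w).sum) by
    simpa using h [] (by simp)
  induction L with
  | nil => intro A hA; simpa using hC A hA
  | cons i L ih =>
    intro A hA
    have ih := ih fun j hj => hL j (List.mem_cons_of_mem _ hj)
    have hi : i ∈ T := hL i List.mem_cons_self
    have h1 := ih (A ++ [i]) (by
      intro j hj
      rcases List.mem_append.1 hj with h | h
      · exact hA j h
      · rw [List.mem_singleton.1 h]; exact hi)
    have h2 := ih [] (by simp)
    rw [List.map_nil, List.prod_nil, one_mul] at h2
    set E := C * Real.exp (C * k * (L.map w).sum) with hE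
    have hE0 : 0 ≤ E := by positivity
    have hsplit : (A.map Y).prod * ((i :: L).map Z).prod =
        ((A ++ [i]).map Y).prod * (L.map Z).prod +
          (A.map Y).prod * (Z i - Y i) * (L.map Z).prod := by
      simp only [List.map_cons, List.prod_cons, List.map_append, List.prod_append, List.map_nil,
        List.prod_nil, mul_one]
      noncomm_ring
    have h3 : ‖(A.map Y).prod * (Z i - Y i) * (L.map Z).prod‖ ≤ C * (k * w i) * E := by
      have hkw := (norm_nonneg _).trans (hZ i hi)
      exact (norm_mul_le _ _).trans (mul_le_mul ((norm_mul_le _ _).trans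
        (mul_le_mul (hC A hA) (hZ i hi) (norm_nonneg _) hC0)) h2 (norm_nonneg _)
        (mul_nonneg hC0 hkw))
    rw [hsplit]
    refine (norm_add_le _ _).trans ((add_le_add h1 h3).trans ?_)
    rw [List.map_cons, List.sum_cons, mul_add, Real.exp_add]
    have h4 := Real.add_one_le_exp (C * k * w i)
    calc E + C * (k * w i) * E = (C * k * w i + 1) * E := by ring
      _ ≤ Real.exp (C * k * w i) * E := mul_le_mul_of_nonneg_right h4 hE0
      _ = _ := by rw [hE]; ring

end Perturbation

/-! ### Lyapunov exponents and spectral radii -/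

namespace Realization

variable {S : Type*} [TopologicalSpace S] {Sys : ImpulsiveSystem S} {K : Set S} {d : ℕ} {τ : ℝ}

/-- The flow at time `t` is a product of completed steps, governed by the weighted Berger-Wang
theorem, followed by the propagator of the running mode, governed by compactness. The latter has no
reset and may last less than `τ`, hence the separate hypothesis `hmode`. -/
theorem lyapunovExponent_le (r : Realization Sys K d) (hK : IsCompact K)
    (hdim : ∀ σ, Sys.dim σ ≤ d) {b : ℝ} (hb : 0 ≤ b)
    (hinn : ∀ σ ∈ K, ‖r.inn σ‖ ≤ b) (hout : ∀ σ ∈ K, ‖r.out σ‖ ≤ b)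
    (hreset : ∀ σ ∈ K, ‖r.reset σ‖ ≤ b) (hgen : ∀ σ ∈ K, ‖Sys.gen σ‖ ≤ b)
    (hcont : ∀ t, ContinuousOn (fun σ => r.prop σ t) K)
    (hdisc : 0 < τ ∨ ∃ C, ∀ L : List S, (∀ σ ∈ L, σ ∈ K) →
      ‖(L.map fun σ => r.reset σ * (r.inn σ * r.out σ)).prod‖ ≤ C)
    {μ : ℝ} (hmode : ∀ σ ∈ K, ∀ t, 0 < t → SpecBound (r.prop σ t) (Real.exp (μ * t)))
    (hlist : ∀ L : List (S × ℝ), L ≠ [] → (∀ p ∈ L, p.1 ∈ K ∧ τ ≤ p.2 ∧ 0 < p.2) →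
      SpecBound (L.map r.step).prod (Real.exp (μ * (L.map Prod.snd).sum))) :
    Sys.lyapunovExponent K τ ≤ μ := by
  refine EReal.le_of_forall_lt_iff_le.1 fun z hz => ?_
  -- One `η` is lost in the bound on single propagators, which then serves as base rate for
  -- products, where the second is lost.
  obtain ⟨η, hη, rfl⟩ : ∃ η, 0 < η ∧ z = μ + η + η :=
    ⟨(z - μ) / 2, half_pos (sub_pos.2 (by exact_mod_cast hz)), by ring⟩
  have hexpn : ∀ σ ∈ K, ∀ T : ℝ, ∀ t ∈ Set.Icc 0 T, ‖t • Sys.gen σ‖ ≤ T * b := by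
    intro σ hσ T t ht
    rw [norm_smul, Real.norm_of_nonneg ht.1]
    exact mul_le_mul ht.2 (hgen σ hσ) (norm_nonneg _) (ht.1.trans ht.2)
  have hsand : ∀ σ ∈ K, ∀ (X : Matrix (Fin (Sys.dim σ)) (Fin (Sys.dim σ)) ℝ) (c : ℝ),
      ‖X‖ ≤ c → ‖r.inn σ * X * r.out σ‖ ≤ b * c * b := by
    intro σ hσ X c hX
    have hc := (norm_nonneg _).trans hX
    exact (Matrix.linfty_opNorm_mul _ _).trans (mul_le_mul ((Matrix.linfty_opNorm_mul _ _).trans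
      (mul_le_mul (hinn σ hσ) hX (norm_nonneg _) hb)) (hout σ hσ) (norm_nonneg _)
      (mul_nonneg hb hc))
  have hbdd : ∀ T : ℝ, ∃ c, ∀ σ ∈ K, ∀ t ∈ Set.Icc 0 T, ‖r.prop σ t‖ ≤ c := by
    intro T
    refine ⟨b * (1 + T * b * Real.exp (T * b)) * b, fun σ hσ t ht => hsand σ hσ _ _ ?_⟩
    refine (norm_matrix_exp_le _).trans ?_
    have h := hexpn σ hσ T t ht
    have h0 := (norm_nonneg _).trans h
    gcongr
  obtain ⟨C₁, hC₁0, hC₁⟩ := exists_norm_semigroup_le hK r.prop (fun σ hσ => r.prop_add hσ) hcont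
    hbdd hmode hη
  let T : Set (S × ℝ) := {p | p.1 ∈ K ∧ τ ≤ p.2 ∧ 0 < p.2}
  have hstep : ∀ p ∈ T, ‖r.step p‖ ≤ b * C₁ * Real.exp ((μ + η) * p.2) := by
    intro p hp
    rw [mul_assoc]
    exact (norm_mul_le _ _).trans
      (mul_le_mul (hreset _ hp.1) (hC₁ _ hp.1 _ hp.2.2.le) (norm_nonneg _) hb)
  -- Products of total duration at most one. Under a positive dwell time they have fewer than `N`
  -- factors; otherwise each step is an `O(t)` perturbation of its value at duration zero, and
  -- products of those values are bounded.
  have hlocal : ∃ b', ∀ L : List (S × ℝ), (∀ p ∈ L, p ∈ T) → (L.map Prod.snd).sum ≤ 1 →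
      ‖(L.map r.step).prod‖ ≤ b' := by
    have hsnd : ∀ L : List (S × ℝ), (∀ p ∈ L, p ∈ T) → ∀ p ∈ L, p.2 ≤ (L.map Prod.snd).sum := by
      intro L hL p hp
      refine List.single_le_sum ?_ _ (List.mem_map_of_mem hp)
      intro x hx
      obtain ⟨q, hq, rfl⟩ := List.mem_map.1 hx
      exact (hL q hq).2.2.le
    rcases hdisc with hτ | ⟨C, hC⟩
    · obtain ⟨c, hc⟩ := hbdd 1
      obtain ⟨N, hN⟩ := exists_nat_gt (1 / τ)
      set c' := max 1 (b * c) with hc'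
      have h1c : 1 ≤ c' := le_max_left _ _
      refine ⟨c' ^ N, fun L hL hL1 => ?_⟩
      have hcp : ∀ L : List (S × ℝ), (∀ p ∈ L, p ∈ T ∧ p.2 ≤ 1) →
          ‖(L.map r.step).prod‖ ≤ c' ^ L.length ∧ L.length * τ ≤ (L.map Prod.snd).sum := by
        intro L
        induction L with
        | nil => intro _; simpa using norm_matrix_one_le
        | cons p L ih =>
          intro hL
          obtain ⟨h1, h2⟩ := ih fun q hq => hL q (List.mem_cons_of_mem _ hq)
          obtain ⟨hp, hp1⟩ := hL p List.mem_cons_self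
          have h3 : ‖r.step p‖ ≤ c' := le_max_of_le_right <| (norm_mul_le _ _).trans
            (mul_le_mul (hreset _ hp.1) (hc _ hp.1 _ ⟨hp.2.2.le, hp1⟩) (norm_nonneg _) hb)
          constructor
          · rw [List.map_cons, List.prod_cons, List.length_cons, pow_succ, mul_comm (c' ^ _)]
            exact (norm_mul_le _ _).trans
              (mul_le_mul h3 h1 (norm_nonneg _) (zero_le_one.trans h1c))
          · rw [List.map_cons, List.sum_cons, List.length_cons]
            push_cast
            linarith [hp.2.1]
      obtain ⟨h1, h2⟩ := hcp L fun p hp => ⟨hL p hp, (hsnd L hL p hp).trans hL1⟩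
      refine h1.trans (pow_le_pow_right₀ h1c ?_)
      rw [div_lt_iff₀ hτ] at hN
      have : (L.length : ℝ) * τ ≤ N * τ := by linarith
      exact_mod_cast le_of_mul_le_mul_right this hτ
    · have hC0 : 0 ≤ C := (norm_nonneg _).trans (hC [] (by simp))
      set k := b * (b * (b * Real.exp b) * b) with hk
      have hk0 : 0 ≤ k := by positivity
      refine ⟨C * Real.exp (C * k * 1), fun L hL hL1 => ?_⟩
      refine (norm_prod_perturbed_le (T ∩ {p | p.2 ≤ 1})
        (fun p => r.reset p.1 * (r.inn p.1 * r.out p.1)) r.step hC0 (fun L hL => ?_) (k := k)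
        Prod.snd ?_ L fun p hp => ⟨hL p hp, (hsnd L hL p hp).trans hL1⟩).trans ?_
      · have h := hC (L.map Prod.fst) (by
          intro σ hσ
          obtain ⟨p, hp, rfl⟩ := List.mem_map.1 hσ
          exact (hL p hp).1.1)
        rwa [List.map_map] at h
      · rintro ⟨σ, t⟩ ⟨⟨hσ, -, ht⟩, ht1⟩
        have ht0 : 0 < t := ht
        have ht1' : t ≤ 1 := ht1
        have h1 : r.step (σ, t) - r.reset σ * (r.inn σ * r.out σ) =
            r.reset σ * (r.inn σ * (NormedSpace.exp (t • Sys.gen σ) - 1) * r.out σ) := by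
          simp only [step, prop, Matrix.mul_sub, Matrix.sub_mul, Matrix.mul_one]
        change ‖r.step (σ, t) - r.reset σ * (r.inn σ * r.out σ)‖ ≤ k * t
        rw [h1]
        have h2 : ‖NormedSpace.exp (t • Sys.gen σ) - 1‖ ≤ t * b * Real.exp b := by
          have h3 := hexpn σ hσ t t ⟨ht0.le, le_rfl⟩
          refine (norm_exp_sub_one_le _).trans (mul_le_mul h3 (Real.exp_le_exp.2 (h3.trans ?_))
            (Real.exp_pos _).le (by positivity))
          nlinarith
        refine (norm_mul_le _ _).trans ((mul_le_mul (hreset σ hσ) (hsand σ hσ _ _ h2)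
          (norm_nonneg _) hb).trans (le_of_eq ?_))
        rw [hk]; ring
      · gcongr
  obtain ⟨b', hb'⟩ := hlocal
  obtain ⟨C₂, hC₂⟩ := exists_norm_prod_le_of_specBound T (w := Prod.snd) (fun p hp => hp.2.2.le)
    r.step hstep hb' (fun L hL hLT z hz => (hlist L hL hLT z hz).trans (Real.exp_le_exp.2 (by
      have h0 : 0 ≤ (L.map Prod.snd).sum := List.sum_nonneg (by
        intro x hx
        obtain ⟨p, hp, rfl⟩ := List.mem_map.1 hx
        exact (hLT p hp).2.2.le)
      nlinarith))) hη
  have hC₂0 : 0 ≤ C₂ := by simpa using (norm_nonneg _).trans (hC₂ [] (by simp))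
  refine lyapunovExponent_le_of_bound (C := d * (b * (C₁ * C₂) * b)) fun s t ht => ?_
  rw [r.flow_eq s ht]
  obtain ⟨hk, hkt, -⟩ := s.index_spec ht
  generalize s.index t = k at hk hkt ⊢
  refine (opNorm_le _).trans ?_
  have hd : (Sys.dim (s.mode k) : ℝ) ≤ d := by exact_mod_cast hdim _
  have h1 := hC₂ (s.steps k) (s.steps_mem hk)
  rw [s.sum_steps] at h1
  have htk : 0 ≤ t - s.time k := sub_nonneg.2 hkt
  have h2 := hC₁ _ (s.mode_mem k hk) _ htk
  have h3 : ‖r.prop (s.mode k) (t - s.time k) * ((s.steps k).map r.step).prod‖ ≤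
      C₁ * C₂ * Real.exp ((μ + η + η) * t) := by
    refine (norm_mul_le _ _).trans ((mul_le_mul h2 h1 (norm_nonneg _) (by positivity)).trans ?_)
    rw [mul_mul_mul_comm, ← Real.exp_add]
    refine mul_le_mul_of_nonneg_left (Real.exp_le_exp.2 ?_) (by positivity)
    nlinarith
  have h4 : ‖r.out (s.mode k) * (r.prop (s.mode k) (t - s.time k) *
      ((s.steps k).map r.step).prod) * r.inn (s.mode 0)‖ ≤
      b * (C₁ * C₂ * Real.exp ((μ + η + η) * t)) * b :=
    (Matrix.linfty_opNorm_mul _ _).trans (mul_le_mul ((Matrix.linfty_opNorm_mul _ _).trans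
      (mul_le_mul (hout _ (s.mode_mem k hk)) h3 (norm_nonneg _) hb))
      (hinn _ (s.mode_mem 0 (by simp))) (norm_nonneg _) (by positivity))
  refine (mul_le_mul hd h4 (norm_nonneg _) (by positivity)).trans (le_of_eq (by ring))

end Realization

end SingPert

namespace SingPert

open scoped Matrix.Norms.Operator

/-! ### Trajectories with prescribed growth -/

section RealEigenvector

variable {n : Type}

/-- The real part of a multiple of a complex vector. -/
def realPart (u : ℂ) (v : n → ℂ) : n → ℝ := fun i => (u * v i).re

theorem mulVec_realPart [Fintype n] (A : Matrix n n ℝ) {z : ℂ} {v : n → ℂ}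
    (hv : (A.map (algebraMap ℝ ℂ)).mulVec v = z • v) (u : ℂ) :
    A.mulVec (realPart u v) = realPart (u * z) v := by
  ext i
  have h := congrArg (fun x => (u * x).re) (congrFun hv i)
  simp only [Pi.smul_apply, smul_eq_mul, ← mul_assoc] at h
  rw [realPart, ← h]
  simp only [Matrix.mulVec, dotProduct, Finset.mul_sum, Complex.re_sum]
  refine Finset.sum_congr rfl fun j _ => ?_
  rw [mul_left_comm]
  simp [realPart]

theorem pow_mulVec_realPart [Fintype n] [DecidableEq n] (A : Matrix n n ℝ) {z : ℂ} {v : n → ℂ}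
    (hv : (A.map (algebraMap ℝ ℂ)).mulVec v = z • v) (u : ℂ) (N : ℕ) :
    (A ^ N).mulVec (realPart u v) = realPart (u * z ^ N) v := by
  induction N generalizing u with
  | zero => simp
  | succ N ih =>
    rw [pow_succ, ← Matrix.mulVec_mulVec, mulVec_realPart A hv, ih, mul_assoc, ← pow_succ']

theorem realPart_real_mul (a : ℝ) (u : ℂ) (v : n → ℂ) : realPart (a * u) v = a • realPart u v := by
  ext i
  simp [realPart, mul_assoc]

/-- A complex eigenvalue of a real matrix governs the growth of some real trajectory. -/
theorem exists_pow_mulVec_growth [Fintype n] [DecidableEq n] (A : Matrix n n ℝ) {z : ℂ}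
    (hz : z ∈ spectrum ℂ (A.map (algebraMap ℝ ℂ))) (hz0 : z ≠ 0) :
    ∃ c > (0 : ℝ), ∃ x : n → ℝ, x ≠ 0 ∧ ∀ N : ℕ, c * ‖z‖ ^ N ≤ ‖(A ^ N).mulVec x‖ := by
  obtain ⟨v, hv, hv0⟩ := ((hasEigenvalue_complexOperator A z).2 hz).exists_hasEigenvector
  rw [Module.End.mem_eigenspace_iff] at hv
  change (A.map (algebraMap ℝ ℂ)).mulVec v = z • v at hv
  have hcont : Continuous fun u : ℂ => ‖realPart u v‖ := by
    refine continuous_norm.comp (continuous_pi fun i => ?_)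
    exact Complex.continuous_re.comp (continuous_id.mul continuous_const)
  -- The orbit of the real part of `v` is `|z|^N` times the real part of `u v` with `|u| = 1`, so
  -- the minimum over the circle bounds it below for every `N`, provided that it is positive.
  obtain ⟨u₀, hu₀, hmin⟩ := (isCompact_sphere (0 : ℂ) 1).exists_isMinOn ⟨1, by simp⟩
    hcont.continuousOn
  have hu₀' : u₀ ≠ 0 := by
    rintro rfl; simp at hu₀
  have hnz : (‖z‖ : ℂ) ≠ 0 := by simpa using hz0
  rcases eq_or_ne (realPart u₀ v) 0 with h0 | h0
  -- Zero minimum: `u₀ v` is purely imaginary, so `v` is a complex multiple of the real vector `x`,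
  -- the eigenvalue is real, and the growth of `x` is exact.
  · set x := realPart (-Complex.I * u₀) v with hx
    have hxv : ∀ i, (x i : ℂ) = -Complex.I * (u₀ * v i) := by
      intro i
      have h1 : (u₀ * v i).re = 0 := congrFun h0 i
      apply Complex.ext
      · simp [hx, realPart, mul_assoc]
      · rw [Complex.ofReal_im, Complex.mul_im, h1]; simp
    have hx0 : x ≠ 0 := by
      intro h
      refine hv0 (funext fun i => ?_)
      have h2 := hxv i
      rw [h] at h2
      have h3 : u₀ * v i = 0 := by simpa using h2.symm
      simpa [hu₀'] using h3
    have hAx : ∀ i, ((A.mulVec x i : ℝ) : ℂ) = z * x i := by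
      intro i
      have h2 := congrFun hv i
      simp only [Matrix.mulVec, dotProduct, Pi.smul_apply, smul_eq_mul] at h2
      simp only [Matrix.mulVec, dotProduct, Complex.ofReal_sum, Complex.ofReal_mul, hxv]
      rw [← mul_left_comm (-Complex.I), ← mul_left_comm u₀, ← h2, Finset.mul_sum, Finset.mul_sum]
      refine Finset.sum_congr rfl fun j _ => ?_
      simp only [Matrix.map_apply, Complex.coe_algebraMap]
      ring
    obtain ⟨j, hj⟩ := Function.ne_iff.1 hx0
    have hj' : (x j : ℂ) ≠ 0 := by simpa using hj
    obtain ⟨a, rfl⟩ : ∃ a : ℝ, z = a :=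
      ⟨A.mulVec x j / x j, by rw [Complex.ofReal_div, hAx j, mul_div_cancel_right₀ _ hj']⟩
    have hAx' : A.mulVec x = a • x := by
      ext i
      have := hAx i
      rw [Pi.smul_apply, smul_eq_mul]
      exact_mod_cast this
    have hpow : ∀ N : ℕ, (A ^ N).mulVec x = a ^ N • x := by
      intro N
      induction N with
      | zero => simp
      | succ N ih =>
        rw [pow_succ, ← Matrix.mulVec_mulVec, hAx', Matrix.mulVec_smul, ih, smul_smul, pow_succ,
          mul_comm]
    refine ⟨‖x‖, norm_pos_iff.2 hx0, x, hx0, fun N => ?_⟩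
    rw [hpow, norm_smul, norm_pow, Complex.norm_real, mul_comm]
  · have hc : 0 < ‖realPart u₀ v‖ := norm_pos_iff.2 h0
    have hge : ∀ N : ℕ, ‖realPart u₀ v‖ * ‖z‖ ^ N ≤ ‖(A ^ N).mulVec (realPart 1 v)‖ := by
      intro N
      have h1 : z ^ N = ((‖z‖ ^ N : ℝ) : ℂ) * (z / ‖z‖) ^ N := by
        rw [div_pow, Complex.ofReal_pow, mul_div_cancel₀ _ (pow_ne_zero _ hnz)]
      rw [pow_mulVec_realPart A hv, one_mul, h1, realPart_real_mul, norm_smul, norm_pow, norm_norm,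
        mul_comm]
      refine mul_le_mul_of_nonneg_left (hmin ?_) (by positivity)
      have : ‖z‖ ≠ 0 := norm_ne_zero_iff.2 hz0
      simp [this]
    refine ⟨_, hc, realPart 1 v, ?_, hge⟩
    intro h
    have h2 := hge 0
    rw [h, Matrix.mulVec_zero, norm_zero, pow_zero, mul_one] at h2
    linarith

end RealEigenvector

/-- Some trajectory grows at least like `e^{μ t}`. -/
def ImpulsiveSystem.HasGrowth {S : Type*} (Sys : ImpulsiveSystem S) (K : Set S) (τ μ : ℝ) : Prop :=
  ∃ c > (0 : ℝ), ∃ s : Signal K τ,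
    ∃ x₀ : EuclideanSpace ℝ (Fin (Sys.dim (s.mode 0))), x₀ ≠ 0 ∧
      ∀ t : ℝ, 0 ≤ t →
        c * Real.exp (μ * t) * ‖x₀‖ ≤ ‖Matrix.toEuclideanLin (Sys.flow s t) x₀‖

theorem ImpulsiveSystem.HasGrowth.le_lyapunovExponent {S : Type*} {Sys : ImpulsiveSystem S}
    {K : Set S} {τ μ : ℝ} (h : Sys.HasGrowth K τ μ) : (μ : EReal) ≤ Sys.lyapunovExponent K τ := by
  obtain ⟨c, hc, s, x, hx, h⟩ := h
  exact le_lyapunovExponent_of_trajectory hc s x hx h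

theorem ImpulsiveSystem.HasGrowth.expUnstable {S : Type*} {Sys : ImpulsiveSystem S}
    {K : Set S} {τ μ : ℝ} (h : Sys.HasGrowth K τ μ) (hμ : 0 < μ) : Sys.ExpUnstable K τ := by
  obtain ⟨c, hc, s, x, hx, h⟩ := h
  exact ⟨c, hc, μ, hμ, s, x, hx, h⟩

/-! ### Trajectories of the perturbed system under constant and periodic signals -/

noncomputable section Periodic

variable {d : ℕ} {K : Set (Mode d)} {τ ε : ℝ}

/-- The generator of the singularly perturbed system. -/
def epsGen (ε : ℝ) (σ : Mode d) : Matrix (Fin d) (Fin d) ℝ := (σ.E ε * σ.P)⁻¹ * σ.Lam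

/-- The flow of the singularly perturbed system, as a `d × d` matrix. -/
def epsFlow (ε : ℝ) (s : Signal K τ) (t : ℝ) : Matrix (Fin d) (Fin d) ℝ := (sysEps d ε).flow s t

/-- The singularly perturbed system as a realization of itself. -/
def epsRealization (d : ℕ) (K : Set (Mode d)) (ε : ℝ) : Realization (sysEps d ε) K d where
  inn _ := (1 : Matrix (Fin d) (Fin d) ℝ)
  out _ := (1 : Matrix (Fin d) (Fin d) ℝ)
  reset σ := σ.R
  out_mul_inn _ _ := Matrix.one_mul (1 : Matrix (Fin d) (Fin d) ℝ)
  jump_eq _ _ old _ :=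
    ((Matrix.mul_one (1 * old.R)).trans (Matrix.one_mul old.R)).symm

theorem epsRealization_prop (σ : Mode d) (t : ℝ) :
    (epsRealization d K ε).prop σ t = NormedSpace.exp (t • epsGen ε σ) :=
  have h (X : Matrix (Fin d) (Fin d) ℝ) : 1 * X * 1 = X := by rw [mul_one, one_mul]
  h (NormedSpace.exp (t • epsGen ε σ))

theorem epsFlow_eq (s : Signal K τ) {t : ℝ} (ht : 0 ≤ t) :
    epsFlow ε s t =
      (epsRealization d K ε).prop (s.mode (s.index t)) (t - s.time (s.index t)) *
        ((s.steps (s.index t)).map (epsRealization d K ε).step).prod := by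
  refine ((epsRealization d K ε).flow_eq s ht).trans ?_
  exact (Matrix.mul_one _).trans (Matrix.one_mul _)

/-- Growth of a trajectory that returns to the powers of a fixed matrix. -/
theorem hasGrowth_of_return {μ W : ℝ} (s : Signal K τ) (A : Matrix (Fin d) (Fin d) ℝ)
    {z : ℂ} (hz : z ∈ spectrum ℂ (A.map (algebraMap ℝ ℂ))) (hzW : Real.exp (μ * W) ≤ ‖z‖) {C : ℝ}
    (hret : ∀ t : ℝ, 0 ≤ t → ∃ (N : ℕ) (Q : Matrix (Fin d) (Fin d) ℝ), ‖Q‖ ≤ C ∧ t ≤ N * W ∧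
      N * W ≤ t + W ∧ A ^ N = Q * epsFlow ε s t) :
    (sysEps d ε).HasGrowth K τ μ := by
  have hz0 : z ≠ 0 := by
    rintro rfl
    rw [norm_zero] at hzW
    exact absurd hzW (not_le.2 (Real.exp_pos _))
  obtain ⟨c, hc, x, hx, hgrow⟩ := exists_pow_mulVec_growth A hz hz0
  set x₀ : EuclideanSpace ℝ (Fin d) := WithLp.toLp 2 x with hx₀
  have hx₀0 : x₀ ≠ 0 := by simpa [hx₀] using hx
  have hx₀n : 0 < ‖x₀‖ := norm_pos_iff.2 hx₀0
  -- `Q` completes the flow from `t` to the end of a period, so the state at `t` is at least `‖A^N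
  -- x‖ / (|C| + 1)`. The time shift is at most `W` and `μ` may have either sign, which costs
  -- `e^{-|μ||W|}`.
  refine ⟨c * Real.exp (-(|μ| * |W|)) / (|C| + 1) / ‖x₀‖, by positivity, s, x₀, hx₀0,
    fun t ht => ?_⟩
  obtain ⟨N, Q, hQ, h1, h2, hA⟩ := hret t ht
  have h3 := hgrow N
  rw [hA, ← Matrix.mulVec_mulVec] at h3
  set y : Fin d → ℝ := (epsFlow ε s t).mulVec x with hy
  have h4 : ‖y‖ ≤ ‖Matrix.toEuclideanLin ((sysEps d ε).flow s t) x₀‖ := by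
    refine (pi_norm_le_iff_of_nonneg (norm_nonneg _)).2 fun j => ?_
    exact PiLp.norm_apply_le (Matrix.toEuclideanLin ((sysEps d ε).flow s t) x₀) j
  have h5 : c * ‖z‖ ^ N ≤ (|C| + 1) * ‖y‖ :=
    h3.trans ((Matrix.linfty_opNorm_mulVec _ _).trans (mul_le_mul_of_nonneg_right
      (hQ.trans ((le_abs_self C).trans (by linarith))) (norm_nonneg _)))
  have h6 : Real.exp (-(|μ| * |W|)) * Real.exp (μ * t) ≤ ‖z‖ ^ N := by
    refine le_trans ?_ (pow_le_pow_left₀ (Real.exp_pos _).le hzW N)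
    rw [← Real.exp_add, ← Real.exp_nat_mul]
    refine Real.exp_le_exp.2 ?_
    have h7 : |N * W - t| ≤ |W| := by
      rw [abs_of_nonneg (by linarith)]
      exact le_trans (by linarith) (le_abs_self W)
    have h8 : |μ * (N * W - t)| ≤ |μ| * |W| := by
      rw [abs_mul]; exact mul_le_mul_of_nonneg_left h7 (abs_nonneg _)
    have h9 := neg_le_of_abs_le h8
    nlinarith
  refine le_trans ?_ h4
  have h10 : c * Real.exp (-(|μ| * |W|)) / (|C| + 1) / ‖x₀‖ * Real.exp (μ * t) * ‖x₀‖ =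
      (c * (Real.exp (-(|μ| * |W|)) * Real.exp (μ * t))) / (|C| + 1) := by
    field_simp
  refine h10.le.trans ?_
  rw [div_le_iff₀ (by positivity), mul_comm ‖y‖]
  exact (mul_le_mul_of_nonneg_left h6 hc.le).trans h5

theorem norm_exp_epsGen_le (σ : Mode d) (T : ℝ) : ∃ c, ∀ t ∈ Set.Icc 0 T,
    ‖NormedSpace.exp (t • epsGen ε σ)‖ ≤ c := by
  set g := epsGen ε σ
  refine ⟨1 + T * ‖g‖ * Real.exp (T * ‖g‖), fun t ht => (norm_matrix_exp_le _).trans ?_⟩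
  have h : ‖t • g‖ ≤ T * ‖g‖ := by
    rw [norm_smul, Real.norm_of_nonneg ht.1]
    exact mul_le_mul_of_nonneg_right ht.2 (norm_nonneg _)
  have h0 := (norm_nonneg _).trans h
  gcongr

/-- Growth under a constant mode. -/
theorem hasGrowth_of_mode {σ : Mode d} (hσ : σ ∈ K) {μ W : ℝ} (hW : 0 < W) {z : ℂ}
    (hz : z ∈ spectrum ℂ (((epsRealization d K ε).prop σ W).map (algebraMap ℝ ℂ)))
    (hzW : Real.exp (μ * W) ≤ ‖z‖) : (sysEps d ε).HasGrowth K τ μ := by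
  -- No switching at all, so the dwell time imposes nothing, even if `W < τ`, and no reset
  -- intervenes.
  let s : Signal K τ :=
    { num := 0
      time := fun k => k
      mode := fun _ => σ
      time_zero := by simp
      time_lt := fun k hk => by simp at hk
      dwell := fun k hk => by simp at hk
      locallyFinite := fun h => by simp at h
      mode_mem := fun _ _ => hσ }
  obtain ⟨c, hc⟩ := norm_exp_epsGen_le (ε := ε) σ W
  refine hasGrowth_of_return s _ hz hzW (C := c) fun t ht => ?_
  have hidx : s.index t = 0 := by
    have := (s.index_spec ht).1
    have h0 : s.num = 0 := rfl
    rw [h0] at this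
    exact_mod_cast le_antisymm this (by simp)
  set N := ⌊t / W⌋₊ + 1 with hN
  have h1 : t ≤ N * W := by
    rw [← div_le_iff₀ hW, hN]; push_cast; exact (Nat.lt_floor_add_one _).le
  have h2 : N * W ≤ t + W := by
    have := Nat.floor_le (div_nonneg ht hW.le)
    rw [le_div_iff₀ hW] at this
    rw [hN]; push_cast; linarith
  refine ⟨N, NormedSpace.exp ((N * W - t) • epsGen ε σ),
    hc _ ⟨by linarith, by linarith⟩, h1, h2, ?_⟩
  have hflow : epsFlow ε s t = NormedSpace.exp (t • epsGen ε σ) := by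
    rw [epsFlow_eq s ht, hidx]
    simp only [Signal.steps, List.map_nil, List.prod_nil, mul_one, epsRealization_prop,
      s.time_zero, sub_zero]
    rfl
  rw [epsRealization_prop, hflow]
  refine Eq.trans ?_ (exp_add_smul _ _ _)
  rw [← Matrix.exp_nsmul, ← Nat.cast_smul_eq_nsmul ℝ, smul_smul]
  congr 2; ring

/-- The first `k` values of a sequence, latest first. -/
def revPrefix {α : Type*} (f : ℕ → α) : ℕ → List α
  | 0 => []
  | k + 1 => f k :: revPrefix f k

theorem revPrefix_add_period {α : Type*} {f : ℕ → α} {m : ℕ} (hf : ∀ j, f (j + m) = f j) (k : ℕ) :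
    revPrefix f (k + m) = revPrefix f k ++ revPrefix f m := by
  induction k with
  | zero => simp [revPrefix]
  | succ k ih => rw [Nat.add_right_comm, revPrefix, ih, hf]; rfl

theorem exists_periodic_revPrefix {α : Type*} (L : List α) (hL : L ≠ []) :
    ∃ f : ℕ → α, (∀ j, f (j + L.length) = f j) ∧ revPrefix f L.length = L ∧ ∀ j, f j ∈ L := by
  have hm : 0 < L.length := List.length_pos_iff.2 hL
  have hlt : ∀ j, L.length - 1 - j % L.length < L.length := fun j => by omega
  -- The latest value stands first in `revPrefix`, so the sequence runs through `L` backwards.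
  refine ⟨fun j => L[L.length - 1 - j % L.length]'(hlt j), fun j => by simp, ?_,
    fun j => List.getElem_mem _⟩
  have h : ∀ k, k ≤ L.length →
      revPrefix (fun j => L[L.length - 1 - j % L.length]'(hlt j)) k = L.drop (L.length - k) := by
    intro k
    induction k with
    | zero => simp [revPrefix]
    | succ k ih =>
      intro hk
      have hk' : L.length - (k + 1) < L.length := by omega
      rw [revPrefix, ih (by omega), List.drop_eq_getElem_cons hk']
      have e1 : L.length - 1 - k % L.length = L.length - (k + 1) := by
        rw [Nat.mod_eq_of_lt (by omega)]; omega
      have e2 : L.length - (k + 1) + 1 = L.length - k := by omega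
      simp only [e1, e2]
  simpa using h L.length le_rfl

/-- Growth under a periodic signal. -/
theorem hasGrowth_of_list {L : List (Mode d × ℝ)} (hL0 : L ≠ [])
    (hL : ∀ p ∈ L, p.1 ∈ K ∧ τ ≤ p.2 ∧ 0 < p.2) {μ : ℝ} {z : ℂ}
    (hz : z ∈ spectrum ℂ ((L.map (epsRealization d K ε).step).prod.map (algebraMap ℝ ℂ)))
    (hzW : Real.exp (μ * (L.map Prod.snd).sum) ≤ ‖z‖) : (sysEps d ε).HasGrowth K τ μ := by
  obtain ⟨f, hf, hfL, hfm⟩ := exists_periodic_revPrefix L hL0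
  set m := L.length with hm
  have hm0 : 0 < m := List.length_pos_iff.2 hL0
  set T : ℕ → ℝ := fun k => ((revPrefix f k).map Prod.snd).sum with hT
  have hTs : ∀ k, T (k + 1) = (f k).2 + T k := fun k => by simp [hT, revPrefix]
  have hTm : StrictMono T := strictMono_nat_of_lt_succ fun k => by
    rw [hTs]; linarith [(hL _ (hfm k)).2.2]
  -- A least duration, which makes the switching times tend to infinity.
  obtain ⟨δ, hδ, hδL⟩ : ∃ δ > (0 : ℝ), ∀ p ∈ L, δ ≤ p.2 := by
    clear hz hzW hfL hfm hf hL0 hm hm0 hTs hTm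
    induction L with
    | nil => exact ⟨1, one_pos, by simp⟩
    | cons p L ih =>
      obtain ⟨δ, hδ, h⟩ := ih fun q hq => hL q (List.mem_cons_of_mem _ hq)
      refine ⟨min δ p.2, lt_min hδ (hL p List.mem_cons_self).2.2, fun q hq => ?_⟩
      rcases List.mem_cons.1 hq with rfl | hq
      · exact min_le_right _ _
      · exact (min_le_left _ _).trans (h q hq)
  -- Bounds every partial step of the word, so that completing a period from any time costs at most
  -- `β ^ m`.
  obtain ⟨β, hβ1, hβ⟩ : ∃ β ≥ (1 : ℝ), ∀ p ∈ L, ∀ t ∈ Set.Icc 0 p.2,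
      ‖(epsRealization d K ε).step (p.1, t)‖ ≤ β := by
    clear hz hzW hfL hfm hf hL0 hm hm0 hTs hTm hδL
    induction L with
    | nil => exact ⟨1, le_rfl, by simp⟩
    | cons p L ih =>
      obtain ⟨β, hβ, h⟩ := ih fun q hq => hL q (List.mem_cons_of_mem _ hq)
      obtain ⟨c, hc⟩ := norm_exp_epsGen_le (ε := ε) p.1 p.2
      refine ⟨max β (‖p.1.R‖ * c), le_max_of_le_left hβ, fun q hq t ht => ?_⟩
      rcases List.mem_cons.1 hq with rfl | hq
      · refine le_max_of_le_right ((norm_mul_le _ _).trans ?_)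
        rw [epsRealization_prop]
        exact mul_le_mul_of_nonneg_left (hc t ht) (norm_nonneg _)
      · exact le_max_of_le_left (h q hq t ht)
  have hTδ : ∀ k : ℕ, k * δ ≤ T k := by
    intro k
    induction k with
    | zero => simp [hT, revPrefix]
    | succ k ih => rw [hTs]; push_cast; linarith [hδL _ (hfm k)]
  let s : Signal K τ :=
    { num := ⊤
      time := T
      mode := fun k => (f k).1
      time_zero := by simp [hT, revPrefix]
      time_lt := fun k _ => hTm k.lt_succ_self
      dwell := fun k _ => by rw [hTs]; linarith [(hL _ (hfm k)).2.1]
      locallyFinite := fun _ => tendsto_atTop_mono hTδ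
        (tendsto_natCast_atTop_atTop.atTop_mul_const hδ)
      mode_mem := fun k _ => (hL _ (hfm k)).1 }
  have hsteps : ∀ k, s.steps k = revPrefix f k := by
    intro k
    induction k with
    | zero => rfl
    | succ k ih =>
      rw [Signal.steps, revPrefix, ih]
      congr 1
      refine Prod.ext rfl ?_
      change T (k + 1) - T k = _
      rw [hTs]; ring
  set P : ℕ → Matrix (Fin d) (Fin d) ℝ := fun k =>
    ((revPrefix f k).map (epsRealization d K ε).step).prod with hP
  set A := (L.map (epsRealization d K ε).step).prod with hA
  set W := (L.map Prod.snd).sum with hW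
  have hPN : ∀ N : ℕ, P (N * m) = A ^ N ∧ T (N * m) = N * W := by
    intro N
    induction N with
    | zero => simp [hP, hT, revPrefix]
    | succ N ih =>
      have h1 : revPrefix f ((N + 1) * m) = revPrefix f (N * m) ++ L := by
        rw [add_mul, one_mul, revPrefix_add_period hf, hfL]
      constructor
      · simp only [hP, h1, List.map_append, List.prod_append]
        rw [pow_succ, ← ih.1]
      · simp only [hT, h1, List.map_append, List.sum_append]
        have h2 := ih.2
        simp only [hT] at h2
        rw [h2]; push_cast; ring
  have hPi : ∀ k i : ℕ, ∃ Q : Matrix (Fin d) (Fin d) ℝ, ‖Q‖ ≤ β ^ i ∧ P (k + i) = Q * P k := by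
    intro k i
    induction i with
    | zero => exact ⟨1, by simpa using norm_matrix_one_le, by simp⟩
    | succ i ih =>
      obtain ⟨Q, hQ, hPQ⟩ := ih
      refine ⟨(epsRealization d K ε).step (f (k + i)) * Q, ?_, ?_⟩
      · rw [pow_succ']
        exact (norm_mul_le _ _).trans (mul_le_mul
          (hβ _ (hfm _) (f (k + i)).2 ⟨(hL _ (hfm _)).2.2.le, le_rfl⟩) hQ (norm_nonneg _)
          (by positivity))
      · rw [mul_assoc, ← hPQ, ← add_assoc]
        simp only [hP, revPrefix, List.map_cons, List.prod_cons]
  refine hasGrowth_of_return s A hz hzW (C := β ^ m) fun t ht => ?_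
  obtain ⟨-, hk1, hk2⟩ := s.index_spec ht
  rw [epsFlow_eq s ht, hsteps]
  generalize s.index t = k at hk1 hk2 ⊢
  change T k ≤ t at hk1
  have hk2 : t < T (k + 1) := hk2 (k + 1) le_top k.lt_succ_self
  -- The end of the period containing step `k`: after the rest of that step there remain `i ≤ m - 1`
  -- full steps.
  set N := k / m + 1 with hN
  have hdm := Nat.div_add_mod k m
  have hml := Nat.mod_lt k hm0
  have hNm : N * m = m * (k / m) + m := by rw [hN]; ring
  obtain ⟨i, hi⟩ : ∃ i, N * m = k + 1 + i := ⟨N * m - (k + 1), by omega⟩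
  have him : i + 1 ≤ m := by omega
  obtain ⟨Q, hQ, hPQ⟩ := hPi (k + 1) i
  refine ⟨N, Q * (epsRealization d K ε).step ((f k).1, T (k + 1) - t), ?_, ?_, ?_, ?_⟩
  · have h1 := hβ _ (hfm k) (T (k + 1) - t) ⟨by linarith, by
      have := hTs k; linarith⟩
    refine (norm_mul_le _ _).trans ((mul_le_mul hQ h1 (norm_nonneg _) (by positivity)).trans ?_)
    rw [← pow_succ]
    exact pow_le_pow_right₀ hβ1 him
  · rw [← (hPN N).2, hi]
    exact hk2.le.trans (hTm.monotone (by omega))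
  · have h1 : (N : ℝ) * W = (k / m : ℕ) * W + W := by rw [hN]; push_cast; ring
    rw [h1, ← (hPN (k / m)).2]
    have h2 : T (k / m * m) ≤ T k := hTm.monotone (Nat.div_mul_le_self k m)
    linarith
  · rw [← (hPN N).1, hi, hPQ]
    have h1 : P (k + 1) = (epsRealization d K ε).step ((f k).1, T (k + 1) - t) *
        ((epsRealization d K ε).prop (f k).1 (t - T k) * P k) := by
      have h2 : (f k).2 = (T (k + 1) - t) + (t - T k) := by rw [hTs]; ring
      simp only [hP, revPrefix, List.map_cons, List.prod_cons]
      rw [Realization.step, h2, Realization.prop_add _ (hL _ (hfm k)).1, Realization.step]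
      simp only [mul_assoc]
    rw [h1, ← mul_assoc]

end Periodic

end SingPert

namespace SingPert

/-! ### The slow limit of a slow-fast semigroup -/

section SlowFast

variable {𝔸 : Type*} [NormedRing 𝔸] [NormedAlgebra ℝ 𝔸] [CompleteSpace 𝔸]

theorem norm_exp_smul_le (A : 𝔸) {t T : ℝ} (ht : 0 ≤ t) (htT : t ≤ T) :
    ‖NormedSpace.exp (t • A)‖ ≤ ‖(1 : 𝔸)‖ + T * ‖A‖ * Real.exp (T * ‖A‖) := by
  have h := norm_add_le (1 : 𝔸) (NormedSpace.exp (t • A) - 1)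
  rw [add_sub_cancel] at h
  have h1 : ‖t • A‖ ≤ T * ‖A‖ := by
    rw [norm_smul, Real.norm_of_nonneg ht]
    exact mul_le_mul_of_nonneg_right htT (norm_nonneg _)
  have h0 := (norm_nonneg _).trans h1
  refine h.trans (add_le_add le_rfl ((norm_exp_sub_one_le _).trans ?_))
  gcongr

theorem hasDerivAt_exp_backward (A : 𝔸) (c T t : ℝ) :
    HasDerivAt (fun u : ℝ => NormedSpace.exp ((c * (T - u)) • A))
      (-(c • (NormedSpace.exp ((c * (T - t)) • A) * A))) t := by
  have h1 : HasDerivAt (fun u : ℝ => c * (T - u)) (-c) t := by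
    simpa using ((hasDerivAt_id t).const_sub T).const_mul c
  have h2 := (hasDerivAt_exp_smul_const A (c * (T - t))).scomp t h1
  simpa using! h2

variable {p q D J N : 𝔸} {C α : ℝ}

/-- Variation of constants: the derivative of `G` contains the coupling `q N` but no factor `ε⁻¹`.
It is damped by `e^{-α(T-t)/ε}`, whose integral is at most `ε / α`; `B` is the primitive of that
bound. -/
theorem norm_fast_sub_le (hqD : q * D = D) (hDq : D * q = D) (hα : 0 < α)
    (hC : ∀ t : ℝ, 0 ≤ t → ‖NormedSpace.exp (t • D) * q‖ ≤ C * Real.exp (-(α * t)))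
    {ε : ℝ} (hε : 0 < ε) {T n : ℝ}
    (hn : ∀ t ∈ Set.Icc 0 T, ‖NormedSpace.exp (t • (ε⁻¹ • D + N))‖ ≤ n) (hT : 0 ≤ T) :
    ‖q * NormedSpace.exp (T • (ε⁻¹ • D + N)) - NormedSpace.exp ((ε⁻¹ * T) • D) * q‖ ≤
      ε * (C * ‖N‖ / α * n) := by
  have hC0 : 0 ≤ C := by simpa using (norm_nonneg _).trans (hC 0 le_rfl)
  have hn0 : 0 ≤ n := (norm_nonneg _).trans (hn 0 ⟨le_rfl, hT⟩)
  set Γ := ε⁻¹ • D + N with hΓ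
  set G : ℝ → 𝔸 := fun t => NormedSpace.exp ((ε⁻¹ * (T - t)) • D) * (q * NormedSpace.exp (t • Γ))
    with hG
  have hderiv : ∀ t, HasDerivAt G
      (NormedSpace.exp ((ε⁻¹ * (T - t)) • D) * q * N * NormedSpace.exp (t • Γ)) t := by
    intro t
    have h := (hasDerivAt_exp_backward D ε⁻¹ T t).mul
      ((hasDerivAt_exp_smul_const' Γ t).const_mul q)
    convert! h using 1
    generalize NormedSpace.exp ((ε⁻¹ * (T - t)) • D) = X
    generalize NormedSpace.exp (t • Γ) = Y
    have e1 : q * (Γ * Y) = ε⁻¹ • (D * Y) + q * N * Y := by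
      rw [hΓ, add_mul, mul_add, smul_mul_assoc, mul_smul_comm, ← mul_assoc, hqD, ← mul_assoc]
    have e2 : X * D * (q * Y) = X * (D * Y) := by
      rw [mul_assoc, ← mul_assoc D, hDq]
    rw [e1, neg_mul, smul_mul_assoc, e2, mul_add, mul_smul_comm]
    simp only [mul_assoc]
    abel
  set B : ℝ → ℝ := fun t => C * ‖N‖ * n * (ε / α) *
    (Real.exp (-(α * (ε⁻¹ * (T - t)))) - Real.exp (-(α * (ε⁻¹ * T)))) with hB
  have hBderiv : ∀ t, HasDerivAt B (C * Real.exp (-(α * (ε⁻¹ * (T - t)))) * ‖N‖ * n) t := by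
    intro t
    have h1 : HasDerivAt (fun u : ℝ => -(α * (ε⁻¹ * (T - u)))) (α * ε⁻¹) t := by
      have := ((((hasDerivAt_id t).const_sub T).const_mul ε⁻¹).const_mul α).neg
      convert! this using 1
      ring
    have h2 := ((h1.exp).sub_const (Real.exp (-(α * (ε⁻¹ * T))))).const_mul
      (C * ‖N‖ * n * (ε / α))
    convert! h2 using 1
    field_simp
  have hmain := image_norm_le_of_norm_deriv_right_le_deriv_boundary (f := fun t => G t - G 0)
    (a := 0) (b := T) (B := B)
    (fun t _ => ((hderiv t).continuousAt.sub continuousAt_const).continuousWithinAt)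
    (fun t _ => ((hderiv t).sub_const (G 0)).hasDerivWithinAt) (by simp [hB]) hBderiv
    (fun t ht => by
      have h1 := hC (ε⁻¹ * (T - t)) (mul_nonneg (inv_pos.2 hε).le (by linarith [ht.2]))
      have h2 := hn t ⟨ht.1, ht.2.le⟩
      exact (norm_mul_le _ _).trans (mul_le_mul ((norm_mul_le _ _).trans
        (mul_le_mul_of_nonneg_right h1 (norm_nonneg _))) h2 (norm_nonneg _) (by positivity)))
    (show T ∈ Set.Icc 0 T from ⟨hT, le_rfl⟩)
  have hGT : G T = q * NormedSpace.exp (T • Γ) := by simp [hG]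
  have hG0 : G 0 = NormedSpace.exp ((ε⁻¹ * T) • D) * q := by simp [hG]
  rw [hGT, hG0] at hmain
  refine hmain.trans ?_
  have h3 : Real.exp (-(α * (ε⁻¹ * (T - T)))) - Real.exp (-(α * (ε⁻¹ * T))) ≤ 1 := by
    have := Real.exp_pos (-(α * (ε⁻¹ * T)))
    simp only [sub_self, mul_zero, neg_zero, Real.exp_zero]
    linarith
  calc B T ≤ C * ‖N‖ * n * (ε / α) * 1 := mul_le_mul_of_nonneg_left h3 (by positivity)
    _ = _ := by ring

/-- The projection `p` alone leaves the coupling `p N q`, which is not small. The corrected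
observable `u = p - ε p N J` removes it, since `J D = q`: it satisfies `u Γ = A u + ε V` with `V`
independent of `ε`, and variation of constants leaves an `O(ε)` error. -/
theorem norm_slow_sub_le (hpq : p + q = 1) (hpp : p * p = p) (hpD : p * D = 0) (hJD : J * D = q)
    {ε : ℝ} (hε : 0 < ε) {T n : ℝ}
    (hn : ∀ t ∈ Set.Icc 0 T, ‖NormedSpace.exp (t • (ε⁻¹ • D + N))‖ ≤ n) (hT : 0 ≤ T) {E : ℝ}
    (hE : ∀ t ∈ Set.Icc 0 T, ‖NormedSpace.exp (t • (p * N * p))‖ ≤ E) :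
    ‖p * NormedSpace.exp (T • (ε⁻¹ • D + N)) - NormedSpace.exp (T • (p * N * p)) * p‖ ≤
      ε * (E * ‖p * N * J‖ + (‖p * N * J‖ + E * ‖p * N * p * N * J - p * N * J * N‖ * T) * n) := by
  have hn0 : 0 ≤ n := (norm_nonneg _).trans (hn 0 ⟨le_rfl, hT⟩)
  have hE0 : 0 ≤ E := (norm_nonneg _).trans (hE 0 ⟨le_rfl, hT⟩)
  set Γ := ε⁻¹ • D + N with hΓ
  set A := p * N * p with hA
  set V := p * N * p * N * J - p * N * J * N with hV
  set u := p - ε • (p * N * J) with hu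
  have huΓ : u * Γ = A * u + ε • V := by
    have e1 : u * Γ = p * N - p * N * q - ε • (p * N * J * N) := by
      have e2 : p * N * J * D = p * N * q := by rw [mul_assoc, hJD]
      rw [hu, hΓ, sub_mul, mul_add, mul_add, mul_smul_comm, hpD, smul_zero, zero_add,
        smul_mul_assoc, mul_smul_comm, e2, smul_mul_assoc, smul_smul, mul_inv_cancel₀ hε.ne',
        one_smul, sub_add_eq_sub_sub]
    have e3 : A * u = p * N * p - ε • (p * N * p * N * J) := by
      have e4 : p * N * p * (p * N * J) = p * N * (p * p) * N * J := by simp only [mul_assoc]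
      rw [hu, hA, mul_sub, mul_smul_comm, e4, hpp, mul_assoc (p * N) p p, hpp]
    have e5 : p * N - p * N * q = p * N * p := by
      rw [sub_eq_iff_eq_add, ← mul_add, hpq, mul_one]
    rw [e1, e3, e5, hV, smul_sub]; abel
  set H : ℝ → 𝔸 := fun t => NormedSpace.exp ((1 * (T - t)) • A) * (u * NormedSpace.exp (t • Γ))
    with hH
  have hderiv : ∀ t, HasDerivAt H
      (NormedSpace.exp ((1 * (T - t)) • A) * (ε • V) * NormedSpace.exp (t • Γ)) t := by
    intro t
    have h := (hasDerivAt_exp_backward A 1 T t).mul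
      ((hasDerivAt_exp_smul_const' Γ t).const_mul u)
    convert! h using 1
    generalize NormedSpace.exp ((1 * (T - t)) • A) = X
    generalize NormedSpace.exp (t • Γ) = Y
    rw [← mul_assoc u, huΓ, one_smul]
    noncomm_ring
  have hmain := norm_image_sub_le_of_norm_deriv_right_le_segment (f := H) (a := 0) (b := T)
    (C := E * (ε * ‖V‖) * n)
    (fun t _ => (hderiv t).continuousAt.continuousWithinAt)
    (fun t _ => (hderiv t).hasDerivWithinAt)
    (fun t ht => by
      have h1 := hE (1 * (T - t)) ⟨by linarith [ht.2], by linarith [ht.1]⟩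
      have h2 := hn t ⟨ht.1, ht.2.le⟩
      have h3 : ‖ε • V‖ = ε * ‖V‖ := by rw [norm_smul, Real.norm_of_nonneg hε.le]
      exact (norm_mul_le _ _).trans (mul_le_mul ((norm_mul_le _ _).trans
        (mul_le_mul h1 h3.le (norm_nonneg _) hE0)) h2 (norm_nonneg _) (by positivity)))
    T ⟨hT, le_rfl⟩
  have hHT : H T = u * NormedSpace.exp (T • Γ) := by simp [hH]
  have hH0 : H 0 = NormedSpace.exp (T • A) * u := by simp [hH]
  rw [hHT, hH0, sub_zero] at hmain
  have hsplit : p * NormedSpace.exp (T • Γ) - NormedSpace.exp (T • A) * p =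
      (u * NormedSpace.exp (T • Γ) - NormedSpace.exp (T • A) * u) +
        (ε • (p * N * J * NormedSpace.exp (T • Γ)) - ε • (NormedSpace.exp (T • A) * (p * N * J))) := by
    rw [hu, sub_mul, mul_sub, smul_mul_assoc, mul_smul_comm]; abel
  have h4 : ‖ε • (p * N * J * NormedSpace.exp (T • Γ))‖ ≤ ε * (‖p * N * J‖ * n) := by
    rw [norm_smul, Real.norm_of_nonneg hε.le]
    exact mul_le_mul_of_nonneg_left ((norm_mul_le _ _).trans
      (mul_le_mul_of_nonneg_left (hn T ⟨hT, le_rfl⟩) (norm_nonneg _))) hε.le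
  have h5 : ‖ε • (NormedSpace.exp (T • A) * (p * N * J))‖ ≤ ε * (E * ‖p * N * J‖) := by
    rw [norm_smul, Real.norm_of_nonneg hε.le]
    exact mul_le_mul_of_nonneg_left ((norm_mul_le _ _).trans
      (mul_le_mul_of_nonneg_right (hE T ⟨hT, le_rfl⟩) (norm_nonneg _))) hε.le
  rw [hsplit]
  refine (norm_add_le _ _).trans ((add_le_add hmain ((norm_sub_le _ _).trans
    (add_le_add h4 h5))).trans (le_of_eq ?_))
  ring

/-- **Tikhonov limit** of a linear slow-fast system: the fast variable collapses and the slow one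
follows the averaged generator. -/
theorem tendsto_exp_slow_fast (hpq : p + q = 1) (hpp : p * p = p) (hpD : p * D = 0)
    (hqD : q * D = D) (hDq : D * q = D) (hJD : J * D = q) (hα : 0 < α)
    (hC : ∀ t : ℝ, 0 ≤ t → ‖NormedSpace.exp (t • D) * q‖ ≤ C * Real.exp (-(α * t)))
    {T : ℝ} (hT : 0 < T) :
    Tendsto (fun ε : ℝ => NormedSpace.exp (T • (ε⁻¹ • D + N))) (𝓝[>] 0)
      (𝓝 (NormedSpace.exp (T • (p * N * p)) * p)) := by
  have hC0 : 0 ≤ C := by simpa using (norm_nonneg _).trans (hC 0 le_rfl)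
  set E : ℝ := ‖(1 : 𝔸)‖ + T * ‖p * N * p‖ * Real.exp (T * ‖p * N * p‖) with hEdef
  have hE : ∀ t ∈ Set.Icc 0 T, ‖NormedSpace.exp (t • (p * N * p))‖ ≤ E := fun t ht =>
    norm_exp_smul_le _ ht.1 ht.2
  have hE0 : 0 ≤ E := by positivity
  set k₁ := E * ‖p * N * J‖ with hk₁
  set k₂ := ‖p * N * J‖ + E * ‖p * N * p * N * J - p * N * J * N‖ * T + C * ‖N‖ / α with hk₂
  have hk₁0 : 0 ≤ k₁ := by positivity
  have hk₂0 : 0 ≤ k₂ := by positivity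
  -- The error is affine in the still unknown bound `n` of the semigroup, with the small slope `ε
  -- k₂`.
  have hbound : ∀ ε : ℝ, 0 < ε → ∀ n : ℝ,
      (∀ t ∈ Set.Icc 0 T, ‖NormedSpace.exp (t • (ε⁻¹ • D + N))‖ ≤ n) → ∀ t ∈ Set.Icc 0 T,
      ‖NormedSpace.exp (t • (ε⁻¹ • D + N)) - NormedSpace.exp (t • (p * N * p)) * p -
        NormedSpace.exp ((ε⁻¹ * t) • D) * q‖ ≤ ε * (k₁ + k₂ * n) := by
    intro ε hε n hn t ht
    have hn0 : 0 ≤ n := (norm_nonneg _).trans (hn t ht)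
    have hsub : ∀ r ∈ Set.Icc 0 t, r ∈ Set.Icc 0 T := fun r hr => ⟨hr.1, hr.2.trans ht.2⟩
    have h1 := norm_fast_sub_le (N := N) hqD hDq hα hC hε (fun r hr => hn r (hsub r hr)) ht.1
    have h2 := norm_slow_sub_le (N := N) hpq hpp hpD hJD hε (fun r hr => hn r (hsub r hr)) ht.1
      (fun r hr => hE r (hsub r hr))
    set Y := NormedSpace.exp (t • (ε⁻¹ • D + N))
    have h3 : Y - NormedSpace.exp (t • (p * N * p)) * p - NormedSpace.exp ((ε⁻¹ * t) • D) * q =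
        (p * Y - NormedSpace.exp (t • (p * N * p)) * p) +
          (q * Y - NormedSpace.exp ((ε⁻¹ * t) • D) * q) := by
      have : Y = p * Y + q * Y := by rw [← add_mul, hpq, one_mul]
      nth_rewrite 1 [this]; abel
    rw [h3]
    refine (norm_add_le _ _).trans ((add_le_add h2 h1).trans ?_)
    rw [← mul_add]
    refine mul_le_mul_of_nonneg_left ?_ hε.le
    have h4 : E * ‖p * N * p * N * J - p * N * J * N‖ * t ≤
        E * ‖p * N * p * N * J - p * N * J * N‖ * T :=
      mul_le_mul_of_nonneg_left ht.2 (by positivity)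
    rw [hk₁, hk₂, add_assoc, ← add_mul]
    gcongr
  set n' := 2 * (E * ‖p‖ + C + k₁) with hn'
  -- Apply the bound with `n` the actual maximum over `[0, T]`; as `ε k₂ ≤ 1/2`, the term in `n` is
  -- absorbed on the left.
  have hunif : ∀ ε : ℝ, 0 < ε → ε ≤ 1 → ε * k₂ ≤ 1 / 2 → ∀ t ∈ Set.Icc 0 T,
      ‖NormedSpace.exp (t • (ε⁻¹ • D + N))‖ ≤ n' := by
    intro ε hε hε1 hεk
    have hcont : ContinuousOn (fun t : ℝ => ‖NormedSpace.exp (t • (ε⁻¹ • D + N))‖) (Set.Icc 0 T) :=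
      fun t _ => (hasDerivAt_exp_smul_const (ε⁻¹ • D + N) t).continuousAt.norm.continuousWithinAt
    obtain ⟨t₀, ht₀, hmax⟩ := isCompact_Icc.exists_isMaxOn ⟨0, le_rfl, hT.le⟩ hcont
    set n := ‖NormedSpace.exp (t₀ • (ε⁻¹ • D + N))‖ with hn
    have h1 := hbound ε hε n (fun t ht => hmax ht) t₀ ht₀
    have h2 : n ≤ ε * (k₁ + k₂ * n) + (E * ‖p‖ + C) := by
      have e1 : ‖NormedSpace.exp (t₀ • (p * N * p)) * p‖ ≤ E * ‖p‖ :=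
        (norm_mul_le _ _).trans (mul_le_mul_of_nonneg_right (hE t₀ ht₀) (norm_nonneg _))
      have e2 : ‖NormedSpace.exp ((ε⁻¹ * t₀) • D) * q‖ ≤ C := by
        have h0 : 0 ≤ ε⁻¹ * t₀ := mul_nonneg (inv_pos.2 hε).le ht₀.1
        refine (hC _ h0).trans (mul_le_of_le_one_right hC0 ?_)
        rw [Real.exp_le_one_iff]
        nlinarith
      have e3 := norm_sub_norm_le (NormedSpace.exp (t₀ • (ε⁻¹ • D + N)) -
        NormedSpace.exp (t₀ • (p * N * p)) * p) (NormedSpace.exp ((ε⁻¹ * t₀) • D) * q)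
      have e4 := norm_sub_norm_le (NormedSpace.exp (t₀ • (ε⁻¹ • D + N)))
        (NormedSpace.exp (t₀ • (p * N * p)) * p)
      linarith
    have hn0 : 0 ≤ n := norm_nonneg _
    have h3 : ε * k₂ * n ≤ 1 / 2 * n := mul_le_mul_of_nonneg_right hεk hn0
    have h4 : ε * k₁ ≤ k₁ := mul_le_of_le_one_left hk₁0 hε1
    intro t ht
    have h5 : ‖NormedSpace.exp (t • (ε⁻¹ • D + N))‖ ≤ n := hmax ht
    rw [hn']
    nlinarith
  rw [tendsto_iff_norm_sub_tendsto_zero]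
  -- The second term is the boundary layer of the fast variable; it vanishes because `T > 0`.
  have hlim : Tendsto (fun ε : ℝ => ε * (k₁ + k₂ * n') + C * Real.exp (-(α * (ε⁻¹ * T))))
      (𝓝[>] 0) (𝓝 0) := by
    have h1 : Tendsto (fun ε : ℝ => ε * (k₁ + k₂ * n')) (𝓝[>] 0) (𝓝 0) := by
      have : Tendsto (fun ε : ℝ => ε * (k₁ + k₂ * n')) (𝓝 0) (𝓝 (0 * (k₁ + k₂ * n'))) :=
        tendsto_id.mul_const _
      rw [zero_mul] at this
      exact this.mono_left nhdsWithin_le_nhds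
    have h2 : Tendsto (fun ε : ℝ => α * (ε⁻¹ * T)) (𝓝[>] 0) atTop :=
      (tendsto_inv_nhdsGT_zero.atTop_mul_const hT).const_mul_atTop hα
    have h3 := (Real.tendsto_exp_neg_atTop_nhds_zero.comp h2).const_mul C
    simpa using h1.add h3
  have hsmall : ∀ᶠ ε : ℝ in 𝓝[>] 0, ε ≤ 1 ∧ ε * k₂ ≤ 1 / 2 := by
    have h1 : ∀ᶠ ε : ℝ in 𝓝 0, ε < 1 := gt_mem_nhds one_pos
    have h2 : ∀ᶠ ε : ℝ in 𝓝 0, ε * k₂ < 1 / 2 := by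
      have : Tendsto (fun ε : ℝ => ε * k₂) (𝓝 0) (𝓝 (0 * k₂)) := tendsto_id.mul_const _
      rw [zero_mul] at this
      exact this.eventually_lt_const (by norm_num)
    filter_upwards [nhdsWithin_le_nhds h1, nhdsWithin_le_nhds h2] with ε a b using ⟨a.le, b.le⟩
  refine squeeze_zero' (Eventually.of_forall fun _ => norm_nonneg _) ?_ hlim
  filter_upwards [hsmall, self_mem_nhdsWithin] with ε hεs hε
  have hε : 0 < ε := hε
  have h1 := hbound ε hε n' (hunif ε hε hεs.1 hεs.2) T ⟨hT.le, le_rfl⟩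
  have h2 := hC (ε⁻¹ * T) (mul_nonneg (inv_pos.2 hε).le hT.le)
  have h3 := norm_add_le (NormedSpace.exp (T • (ε⁻¹ • D + N)) -
    NormedSpace.exp (T • (p * N * p)) * p - NormedSpace.exp ((ε⁻¹ * T) • D) * q)
    (NormedSpace.exp ((ε⁻¹ * T) • D) * q)
  rw [sub_add_cancel] at h3
  exact h3.trans (add_le_add h1 h2)

end SlowFast

/-! ### Lower semicontinuity of the spectral radius -/

section Spectrum

variable {n : Type} [Fintype n] [DecidableEq n]

/-- The characteristic polynomial of `B i` at `z` tends to `0`. If all its roots had modulus at most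
`ρ`, its modulus at `z` would be at least `(‖z‖ - ρ)^n`, a positive constant. -/
theorem eventually_exists_mem_spectrum {ι : Type*} {l : Filter ι} {A : Matrix n n ℝ}
    {B : ι → Matrix n n ℝ} (hB : Tendsto B l (𝓝 A)) {z : ℂ}
    (hz : z ∈ spectrum ℂ (A.map (algebraMap ℝ ℂ))) {ρ : ℝ} (hρ : ρ < ‖z‖) :
    ∀ᶠ i in l, ∃ z' ∈ spectrum ℂ ((B i).map (algebraMap ℝ ℂ)), ρ < ‖z'‖ := by
  have hcont : Continuous fun X : Matrix n n ℝ =>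
      ‖(Matrix.scalar n z - X.map (algebraMap ℝ ℂ)).det‖ := by
    refine continuous_norm.comp (Continuous.matrix_det (continuous_const.sub ?_))
    exact continuous_id.matrix_map Complex.continuous_ofReal
  have h0 : ‖(Matrix.scalar n z - A.map (algebraMap ℝ ℂ)).det‖ = 0 := by
    rw [Matrix.mem_spectrum_iff_isRoot_charpoly, Polynomial.IsRoot, Matrix.eval_charpoly] at hz
    rw [hz, norm_zero]
  have hlim := (hcont.tendsto A).comp hB
  rw [h0] at hlim
  have hpos : 0 < (‖z‖ - ρ) ^ Fintype.card n := pow_pos (sub_pos.2 hρ) _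
  filter_upwards [hlim.eventually_lt_const hpos] with i hi
  by_contra! hcon
  refine absurd hi (not_lt.2 ?_)
  set X := (B i).map (algebraMap ℝ ℂ) with hX
  have hsplit : X.charpoly.Splits := IsAlgClosed.splits _
  have hprod : X.charpoly.eval z = (X.charpoly.roots.map fun a => z - a).prod := by
    conv_lhs => rw [hsplit.eq_prod_roots_of_monic X.charpoly_monic]
    rw [Polynomial.eval_multiset_prod, Multiset.map_map]
    simp
  have hcard : X.charpoly.roots.card = Fintype.card n := by
    rw [← hsplit.natDegree_eq_card_roots, Matrix.charpoly_natDegree_eq_dim]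
  simp only [Function.comp_apply]
  rw [← Matrix.eval_charpoly, hprod, ← hcard]
  have hroots : ∀ a ∈ X.charpoly.roots, ‖a‖ ≤ ρ := fun a ha => hcon a
    (Matrix.mem_spectrum_iff_isRoot_charpoly.2 (Polynomial.mem_roots'.1 ha).2)
  have hgen : ∀ s : Multiset ℂ, (∀ a ∈ s, ‖a‖ ≤ ρ) →
      (‖z‖ - ρ) ^ s.card ≤ ‖(s.map fun a => z - a).prod‖ := by
    intro s
    induction s using Multiset.induction with
    | empty => simp
    | cons a s ih =>
      intro hs
      rw [Multiset.card_cons, pow_succ', Multiset.map_cons, Multiset.prod_cons, norm_mul]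
      have h1 : ‖z‖ - ρ ≤ ‖z - a‖ :=
        le_trans (by linarith [hs a (Multiset.mem_cons_self a s)]) (norm_sub_norm_le z a)
      exact mul_le_mul h1 (ih fun b hb => hs b (Multiset.mem_cons_of_mem hb))
        (pow_nonneg (sub_pos.2 hρ).le _) (norm_nonneg _)
  exact hgen _ hroots

end Spectrum

end SingPert

namespace SingPert

open scoped Matrix.Norms.Operator

/-! ### Exponential stability of Hurwitz matrices -/

section Hurwitz

/-- The eigenvalues of `exp B` are exponentials of eigenvalues of `B`. -/
theorem exists_exp_eq_of_mem_spectrum {n : Type} [Fintype n] [DecidableEq n] (B : Matrix n n ℂ)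
    {w : ℂ} (hw : w ∈ spectrum ℂ (NormedSpace.exp B)) : ∃ z ∈ spectrum ℂ B, w = Complex.exp z := by
  rw [← Matrix.spectrum_toLin', ← Module.End.hasEigenvalue_iff_mem_spectrum] at hw
  set f : Module.End ℂ (n → ℂ) := Matrix.toLin' B with hf
  set g : Module.End ℂ (n → ℂ) := Matrix.toLin' (NormedSpace.exp B) with hg
  have hcomm : Commute g f := by
    have h : Commute (NormedSpace.exp B) B := (Commute.refl B).exp_left
    rw [commute_iff_eq, hf, hg, Module.End.mul_eq_comp, Module.End.mul_eq_comp, ← Matrix.toLin'_mul,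
      ← Matrix.toLin'_mul, h.eq]
  -- The eigenspace of `exp B` is stable under `B`, hence contains an eigenvector of `B`; the
  -- exponential series evaluates `exp B` on it.
  have hinv : ∀ x ∈ g.eigenspace w, f x ∈ g.eigenspace w := fun x hx =>
    Module.End.mapsTo_genEigenspace_of_comm hcomm w 1 hx
  have : Nontrivial (g.eigenspace w) := Submodule.nontrivial_iff_ne_bot.2 hw
  obtain ⟨z, hz⟩ := Module.End.exists_eigenvalue (f.restrict hinv)
  obtain ⟨v, hv, hv0⟩ := hz.exists_hasEigenvector
  rw [Module.End.mem_eigenspace_iff] at hv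
  have hfv : B.mulVec (v : n → ℂ) = z • (v : n → ℂ) := congrArg Subtype.val hv
  have hv0' : (v : n → ℂ) ≠ 0 := by simpa using hv0
  refine ⟨z, ?_, ?_⟩
  · rw [← Matrix.spectrum_toLin', ← Module.End.hasEigenvalue_iff_mem_spectrum]
    refine Module.End.hasEigenvalue_of_hasEigenvector (x := (v : n → ℂ)) ⟨?_, hv0'⟩
    rw [Module.End.mem_eigenspace_iff]
    exact hfv
  · have hgv : (NormedSpace.exp B).mulVec (v : n → ℂ) = w • (v : n → ℂ) :=
      Module.End.mem_eigenspace_iff.1 v.2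
    have hpow : ∀ k : ℕ, (B ^ k).mulVec (v : n → ℂ) = z ^ k • (v : n → ℂ) := by
      intro k
      induction k with
      | zero => simp
      | succ k ih =>
        rw [pow_succ, ← Matrix.mulVec_mulVec, hfv, Matrix.mulVec_smul, ih, smul_smul, pow_succ']
    have h1 := (NormedSpace.exp_series_hasSum_exp' (𝕂 := ℂ) B).map
      (AddMonoidHom.mk' (fun X : Matrix n n ℂ => X.mulVec (v : n → ℂ))
        fun X Y => Matrix.add_mulVec X Y _) (continuous_id.matrix_mulVec continuous_const)
    have h2 := (NormedSpace.exp_series_hasSum_exp' (𝕂 := ℂ) z).smul_const (v : n → ℂ)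
    have h3 : HasSum (fun k : ℕ => ((k.factorial : ℂ)⁻¹ • z ^ k) • (v : n → ℂ))
        ((NormedSpace.exp B).mulVec (v : n → ℂ)) := by
      refine h1.congr_fun ?_
      intro k
      simp [Matrix.smul_mulVec, hpow, smul_smul]
    have h4 := h3.unique h2
    rw [hgv, ← Complex.exp_eq_exp_ℂ] at h4
    rw [← sub_eq_zero, ← sub_smul] at h4
    exact sub_eq_zero.1 ((smul_eq_zero.1 h4).resolve_right hv0')

theorem IsHurwitz.isUnit_det {n : ℕ} {D : Matrix (Fin n) (Fin n) ℝ} (hD : IsHurwitz D) :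
    IsUnit D.det := by
  rw [isUnit_iff_ne_zero]
  intro h0
  have h1 : (0 : ℂ) ∈ spectrum ℂ (D.map (algebraMap ℝ ℂ)) := by
    rw [spectrum.zero_mem_iff, Matrix.isUnit_iff_isUnit_det, isUnit_iff_ne_zero, not_not]
    have := RingHom.map_det (algebraMap ℝ ℂ) D
    rw [h0, map_zero] at this
    exact this.symm
  simpa using hD 0 h1

/-- The exponential of a Hurwitz matrix decays. -/
theorem IsHurwitz.exists_norm_exp_le {n : ℕ} {D : Matrix (Fin n) (Fin n) ℝ} (hD : IsHurwitz D) :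
    ∃ C > (0 : ℝ), ∃ α > (0 : ℝ), ∀ t : ℝ, 0 ≤ t →
      ‖NormedSpace.exp (t • D)‖ ≤ C * Real.exp (-(α * t)) := by
  set Dc := D.map (algebraMap ℝ ℂ) with hDc
  -- The spectrum is finite, so its real parts stay away from `0`. Half of this margin is spent in
  -- the semigroup bound.
  obtain ⟨α, hα, hαD⟩ : ∃ α > (0 : ℝ), ∀ z ∈ spectrum ℂ Dc, z.re ≤ -α := by
    have hfin := Matrix.finite_spectrum Dc
    rcases (spectrum ℂ Dc).eq_empty_or_nonempty with h | h
    · exact ⟨1, one_pos, by simp [h]⟩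
    · obtain ⟨z, hz, hmax⟩ := Set.exists_max_image _ Complex.re hfin h
      exact ⟨-z.re, neg_pos.2 (hD z hz), fun w hw => by simpa using hmax w hw⟩
  obtain ⟨C, hC, h⟩ := exists_norm_semigroup_le (K := (Set.univ : Set Unit)) isCompact_univ
    (fun _ t => NormedSpace.exp (t • D)) (fun _ _ s t => exp_add_smul D s t)
    (fun _ => continuousOn_const) (fun T => ⟨_, fun _ _ t ht => norm_exp_smul_le D ht.1 ht.2⟩)
    (μ := -α) (fun _ _ t ht w hw => by
      have hmap : (NormedSpace.exp (t • D)).map (algebraMap ℝ ℂ) =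
          NormedSpace.exp ((t : ℂ) • Dc) := by
        have h1 := NormedSpace.map_exp (algebraMap ℝ ℂ).mapMatrix
          (continuous_id.matrix_map Complex.continuous_ofReal) (t • D)
        have h2 : (algebraMap ℝ ℂ).mapMatrix (t • D) = (t : ℂ) • Dc := by
          ext i j; simp [hDc]
        rw [h2] at h1
        exact h1
      rw [hmap] at hw
      obtain ⟨z, hz, rfl⟩ := exists_exp_eq_of_mem_spectrum _ hw
      have ht0 : (t : ℂ) ≠ 0 := by exact_mod_cast ht.ne'
      have hz' : (t : ℂ)⁻¹ * z ∈ spectrum ℂ Dc := by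
        have := spectrum.smul_mem_smul_iff (s := z) (a := (t : ℂ) • Dc)
          (r := (Units.mk0 (t : ℂ) ht0)⁻¹)
        have h2 : (t : ℂ)⁻¹ • z ∈ spectrum ℂ ((t : ℂ)⁻¹ • (t : ℂ) • Dc) := this.2 hz
        rwa [inv_smul_smul₀ ht0] at h2
      have h3 := hαD _ hz'
      rw [Complex.norm_exp]
      refine Real.exp_le_exp.2 ?_
      have h4 : z.re = t * ((t : ℂ)⁻¹ * z).re := by
        rw [← Complex.re_ofReal_mul, mul_inv_cancel_left₀ ht0]
      rw [h4]
      nlinarith) (half_pos hα)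
  refine ⟨C, hC, α / 2, half_pos hα, fun t ht => (h () trivial t ht).trans (le_of_eq ?_)⟩
  congr 2; ring

end Hurwitz

end SingPert

namespace SingPert

open scoped Matrix.Norms.Operator

/-! ### Block calculus for the modes -/

theorem norm_le_of_entries {m n : ℕ} {A : Matrix (Fin m) (Fin n) ℝ} {c : ℝ} (hc : 0 ≤ c)
    (hA : ∀ i j, ‖A i j‖ ≤ c) : ‖A‖ ≤ n * c := by
  rw [Matrix.linfty_opNorm_def]
  have h : (Finset.univ.sup fun i => ∑ j, ‖A i j‖₊) ≤ n * c.toNNReal := by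
    refine Finset.sup_le fun i _ => ?_
    refine (Finset.sum_le_sum fun j _ => show ‖A i j‖₊ ≤ c.toNNReal from ?_).trans ?_
    · rw [← NNReal.coe_le_coe, Real.coe_toNNReal _ hc]; exact hA i j
    · simp
  have h' := NNReal.coe_le_coe.2 h
  rwa [NNReal.coe_mul, Real.coe_toNNReal _ hc, NNReal.coe_natCast] at h'

noncomputable section

namespace Mode

variable {d : ℕ} (σ : Mode d)

theorem ofBlocks_mul (A A' : Matrix (Fin σ.ell) (Fin σ.ell) ℝ)
    (B B' : Matrix (Fin σ.ell) (Fin (d - σ.ell)) ℝ) (C C' : Matrix (Fin (d - σ.ell)) (Fin σ.ell) ℝ)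
    (D D' : Matrix (Fin (d - σ.ell)) (Fin (d - σ.ell)) ℝ) :
    σ.ofBlocks A B C D * σ.ofBlocks A' B' C' D' =
      σ.ofBlocks (A * A' + B * C') (A * B' + B * D') (C * A' + D * C') (C * B' + D * D') := by
  rw [ofBlocks, ofBlocks, Matrix.submatrix_mul_equiv, Matrix.fromBlocks_multiply, ofBlocks]

theorem ofBlocks_add (A A' : Matrix (Fin σ.ell) (Fin σ.ell) ℝ)
    (B B' : Matrix (Fin σ.ell) (Fin (d - σ.ell)) ℝ) (C C' : Matrix (Fin (d - σ.ell)) (Fin σ.ell) ℝ)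
    (D D' : Matrix (Fin (d - σ.ell)) (Fin (d - σ.ell)) ℝ) :
    σ.ofBlocks A B C D + σ.ofBlocks A' B' C' D' =
      σ.ofBlocks (A + A') (B + B') (C + C') (D + D') := by
  rw [ofBlocks, ofBlocks, ofBlocks, ← Matrix.fromBlocks_add]
  rfl

theorem smul_ofBlocks (c : ℝ) (A : Matrix (Fin σ.ell) (Fin σ.ell) ℝ)
    (B : Matrix (Fin σ.ell) (Fin (d - σ.ell)) ℝ) (C : Matrix (Fin (d - σ.ell)) (Fin σ.ell) ℝ)
    (D : Matrix (Fin (d - σ.ell)) (Fin (d - σ.ell)) ℝ) :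
    c • σ.ofBlocks A B C D = σ.ofBlocks (c • A) (c • B) (c • C) (c • D) := by
  rw [ofBlocks, ofBlocks, ← Matrix.fromBlocks_smul]
  rfl

theorem ofBlocks_one : σ.ofBlocks 1 0 0 1 = 1 := by
  rw [ofBlocks, Matrix.fromBlocks_one, Matrix.submatrix_one_equiv]

theorem ofBlocks_zero : σ.ofBlocks 0 0 0 0 = 0 := by
  rw [ofBlocks, Matrix.fromBlocks_zero]
  rfl

/-- The projection onto the slow variables. -/
def slow : Matrix (Fin d) (Fin d) ℝ := σ.ofBlocks 1 0 0 0

/-- The projection onto the fast variables. -/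
def fast : Matrix (Fin d) (Fin d) ℝ := σ.ofBlocks 0 0 0 1

theorem slow_add_fast : σ.slow + σ.fast = 1 := by
  simp [slow, fast, ofBlocks_add, ofBlocks_one]

theorem slow_eq_diagonal :
    σ.slow = Matrix.diagonal fun i : Fin d => if (i : ℕ) < σ.ell then 1 else 0 := by
  ext i j
  obtain ⟨a, rfl⟩ := σ.split.surjective i
  obtain ⟨b, rfl⟩ := σ.split.surjective j
  rw [slow, ofBlocks, Matrix.submatrix_apply, Equiv.symm_apply_apply, Equiv.symm_apply_apply,
    Matrix.diagonal_apply]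
  rcases a with a | a <;> rcases b with b | b <;>
    simp [split, Matrix.one_apply, Fin.ext_iff]
  omega

theorem E_eq (ε : ℝ) : σ.E ε = σ.slow + ε • σ.fast := by
  have h : σ.fast = 1 - σ.slow := eq_sub_of_add_eq' σ.slow_add_fast
  rw [h, slow_eq_diagonal, ← Matrix.diagonal_one, Matrix.diagonal_sub, ← Matrix.diagonal_smul,
    Matrix.diagonal_add, E]
  congr 1
  ext i
  by_cases hi : (i : ℕ) < σ.ell <;> simp [hi]

/-- `Λ P⁻¹`. -/
def L : Matrix (Fin d) (Fin d) ℝ := σ.Lam * σ.P⁻¹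

theorem L_eq : σ.L = σ.ofBlocks σ.A σ.B σ.C σ.D := by
  rw [ofBlocks, A, B, C, D, Matrix.fromBlocks_toBlocks, LamPinv, Matrix.submatrix_submatrix]
  simp [L]

theorem P_inv_eq : σ.P⁻¹ = ((σ.2.1⁻¹ : GL (Fin d) ℝ) : Matrix (Fin d) (Fin d) ℝ) :=
  (Matrix.coe_units_inv σ.2.1).symm

theorem P_mul_inv : σ.P * σ.P⁻¹ = 1 := by
  rw [P_inv_eq]; exact σ.2.1.mul_inv

theorem P_inv_mul : σ.P⁻¹ * σ.P = 1 := by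
  rw [P_inv_eq]; exact σ.2.1.inv_mul

/-- The shear in the definition of `T`. -/
def shear : Matrix (Fin d) (Fin d) ℝ := σ.ofBlocks 1 0 (σ.D⁻¹ * σ.C) 1

/-- The inverse of the shear. -/
def shearInv : Matrix (Fin d) (Fin d) ℝ := σ.ofBlocks 1 0 (-(σ.D⁻¹ * σ.C)) 1

theorem shear_mul_shearInv : σ.shear * σ.shearInv = 1 := by
  simp [shear, shearInv, ofBlocks_mul, ofBlocks_one]

theorem T_eq : σ.T = σ.shear * σ.P := rfl

theorem T_mul : σ.T * (σ.P⁻¹ * σ.shearInv) = 1 := by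
  rw [T_eq, mul_assoc, ← mul_assoc σ.P, P_mul_inv, one_mul, shear_mul_shearInv]

theorem T_inv_eq : σ.T⁻¹ = σ.P⁻¹ * σ.shearInv := Matrix.inv_eq_right_inv σ.T_mul

theorem T_mul_inv : σ.T * σ.T⁻¹ = 1 := by rw [T_inv_eq, T_mul]

theorem T_inv_mul : σ.T⁻¹ * σ.T = 1 := mul_eq_one_comm.1 σ.T_mul_inv

/-- `D`, acting on all variables. -/
def fastGen : Matrix (Fin d) (Fin d) ℝ := σ.ofBlocks 0 0 0 σ.D

/-- `M`, acting on all variables. -/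
def slowGen : Matrix (Fin d) (Fin d) ℝ := σ.ofBlocks σ.M 0 0 0

/-- `D⁻¹`, acting on all variables. -/
def fastInv : Matrix (Fin d) (Fin d) ℝ := σ.ofBlocks 0 0 0 σ.D⁻¹

/-- The regular part of the generator in the coordinates given by `T`. -/
def regGen : Matrix (Fin d) (Fin d) ℝ :=
  σ.ofBlocks σ.M σ.B (σ.D⁻¹ * σ.C * σ.M) (σ.D⁻¹ * σ.C * σ.B)

theorem slow_regGen_slow : σ.slow * σ.regGen * σ.slow = σ.slowGen := by
  simp [slow, regGen, slowGen, ofBlocks_mul]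

/-- The shear by `D⁻¹ C` cancels the off-diagonal entry of order `ε⁻¹`. In the coordinates `T X` the
singular part is exactly `diag(0, D)`, and the rest, `regGen`, is independent of `ε` with slow block
`M`. -/
theorem T_mul_epsGen (hD : IsUnit σ.D.det) {ε : ℝ} (hε : ε ≠ 0) :
    σ.T * epsGen ε σ = (ε⁻¹ • σ.fastGen + σ.regGen) * σ.T := by
  have hE : (σ.E ε)⁻¹ = σ.slow + ε⁻¹ • σ.fast := by
    refine Matrix.inv_eq_right_inv ?_
    rw [E_eq]
    simp [slow, fast, smul_ofBlocks, ofBlocks_add, ofBlocks_mul, smul_smul, hε, ofBlocks_one]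
  have hLam : σ.Lam = σ.L * σ.P := by rw [L, mul_assoc, P_inv_mul, mul_one]
  have h1 : σ.T * epsGen ε σ = σ.shear * (σ.slow + ε⁻¹ • σ.fast) * σ.L * σ.P := by
    rw [epsGen, Matrix.mul_inv_rev, hE, T_eq, hLam]
    calc _ = σ.shear * (σ.P * σ.P⁻¹) * (σ.slow + ε⁻¹ • σ.fast) * σ.L * σ.P := by
          simp only [mul_assoc]
      _ = _ := by rw [P_mul_inv, mul_one]
  have h2 : σ.shear * (σ.slow + ε⁻¹ • σ.fast) * σ.L = (ε⁻¹ • σ.fastGen + σ.regGen) * σ.shear := by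
    have hDD : σ.D * σ.D⁻¹ = 1 := Matrix.mul_nonsing_inv _ hD
    have hM : σ.A = σ.M + σ.B * (σ.D⁻¹ * σ.C) := by rw [M, Matrix.mul_assoc]; abel
    have hC : σ.C = σ.D * (σ.D⁻¹ * σ.C) := by
      rw [← Matrix.mul_assoc, hDD, Matrix.one_mul]
    rw [L_eq]
    simp only [shear, slow, fast, fastGen, regGen, smul_ofBlocks, ofBlocks_add, ofBlocks_mul]
    congr 1
    · simp [hM]
    · simp
    · have hC' : σ.D * (σ.D⁻¹ * σ.C) = σ.C := hC.symm
      simp only [smul_zero, Matrix.one_mul, Matrix.mul_zero, add_zero, zero_add,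
        Matrix.mul_one, Matrix.smul_mul, hM, Matrix.mul_add, Matrix.add_mul, hC']
      simp only [Matrix.mul_assoc]
      abel
    · simp [add_comm]
  rw [h1, h2, T_eq, mul_assoc]

/-- The matrix of the injection of coordinates `e`. -/
def _root_.SingPert.coordInj {m d : ℕ} (e : Fin m → Fin d) : Matrix (Fin d) (Fin m) ℝ :=
  fun i j => if i = e j then 1 else 0

theorem _root_.SingPert.norm_coordInj_le {m d : ℕ} (e : Fin m → Fin d) : ‖coordInj e‖ ≤ m := by
  have h := norm_le_of_entries (A := coordInj e) zero_le_one fun i j => by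
    rw [coordInj]; split_ifs <;> simp
  simpa using h

theorem _root_.SingPert.norm_coordInj_transpose_le {m d : ℕ} (e : Fin m → Fin d) :
    ‖(coordInj e).transpose‖ ≤ d := by
  have h := norm_le_of_entries (A := (coordInj e).transpose) zero_le_one fun i j => by
    rw [Matrix.transpose_apply, coordInj]; split_ifs <;> simp
  simpa using h

theorem _root_.SingPert.coordInj_transpose_mul_mul {m n d : ℕ} (e : Fin m → Fin d)
    (f : Fin n → Fin d) (X : Matrix (Fin d) (Fin d) ℝ) :
    (coordInj e).transpose * X * coordInj f = X.submatrix e f := by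
  ext i j
  simp [Matrix.mul_apply, coordInj]

/-- The injection of the slow variables. -/
def slowInj : Matrix (Fin d) (Fin σ.ell) ℝ := coordInj fun i => σ.split (Sum.inl i)

/-- The injection of the fast variables. -/
def fastInj : Matrix (Fin d) (Fin (d - σ.ell)) ℝ := coordInj fun i => σ.split (Sum.inr i)

theorem slowInj_transpose_mul : σ.slowInj.transpose * σ.slowInj = 1 := by
  ext i j
  simp [Matrix.mul_apply, slowInj, coordInj, Matrix.one_apply, eq_comm]

theorem slowInj_mul (X : Matrix (Fin σ.ell) (Fin σ.ell) ℝ) :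
    σ.slowInj * X * σ.slowInj.transpose = σ.ofBlocks X 0 0 0 := by
  ext i j
  obtain ⟨a, rfl⟩ := σ.split.surjective i
  obtain ⟨b, rfl⟩ := σ.split.surjective j
  rw [ofBlocks, Matrix.submatrix_apply, Equiv.symm_apply_apply, Equiv.symm_apply_apply]
  rcases a with a | a <;> rcases b with b | b <;>
    simp [Matrix.mul_apply, slowInj, coordInj]

theorem fastInj_mul (X : Matrix (Fin (d - σ.ell)) (Fin (d - σ.ell)) ℝ) :
    σ.fastInj * X * σ.fastInj.transpose = σ.ofBlocks 0 0 0 X := by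
  ext i j
  obtain ⟨a, rfl⟩ := σ.split.surjective i
  obtain ⟨b, rfl⟩ := σ.split.surjective j
  rw [ofBlocks, Matrix.submatrix_apply, Equiv.symm_apply_apply, Equiv.symm_apply_apply]
  rcases a with a | a <;> rcases b with b | b <;>
    simp [Matrix.mul_apply, fastInj, coordInj]

theorem fastInj_transpose_mul : σ.fastInj.transpose * σ.fastInj = 1 := by
  ext i j
  simp [Matrix.mul_apply, fastInj, coordInj, Matrix.one_apply, eq_comm]

/-- The exponential of `diag(M, 0)` is the identity on the fast variables; the factor `slow` removes
it. -/
theorem exp_slowGen_mul (t : ℝ) : NormedSpace.exp (t • σ.slowGen) * σ.slow =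
    σ.slowInj * NormedSpace.exp (t • σ.M) * σ.slowInj.transpose := by
  have h : (t • σ.slowGen) * σ.slowInj = σ.slowInj * (t • σ.M) := by
    rw [slowGen, ← slowInj_mul, Matrix.smul_mul, Matrix.mul_assoc, slowInj_transpose_mul,
      Matrix.mul_one, Matrix.mul_smul]
  rw [slow, ← slowInj_mul, Matrix.mul_one, ← exp_mul_of_intertwine h, Matrix.mul_assoc]

theorem exp_fastGen_mul (t : ℝ) : NormedSpace.exp (t • σ.fastGen) * σ.fast =
    σ.fastInj * NormedSpace.exp (t • σ.D) * σ.fastInj.transpose := by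
  have h : (t • σ.fastGen) * σ.fastInj = σ.fastInj * (t • σ.D) := by
    rw [fastGen, ← fastInj_mul, Matrix.smul_mul, Matrix.mul_assoc, fastInj_transpose_mul,
      Matrix.mul_one, Matrix.mul_smul]
  rw [fast, ← fastInj_mul, Matrix.mul_one, ← exp_mul_of_intertwine h, Matrix.mul_assoc]

theorem exp_epsGen (hD : IsUnit σ.D.det) {ε : ℝ} (hε : ε ≠ 0) (t : ℝ) :
    NormedSpace.exp (t • epsGen ε σ) =
      σ.T⁻¹ * NormedSpace.exp (t • (ε⁻¹ • σ.fastGen + σ.regGen)) * σ.T := by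
  have h : (t • (ε⁻¹ • σ.fastGen + σ.regGen)) * σ.T = σ.T * (t • epsGen ε σ) := by
    rw [smul_mul_assoc, ← T_mul_epsGen σ hD hε, mul_smul_comm]
  rw [mul_assoc, exp_mul_of_intertwine h, ← mul_assoc, T_inv_mul, one_mul]

/-- On the slow time scale, the propagators of the singularly perturbed system converge to those of
the reduced one. -/
theorem tendsto_exp_epsGen_slow (hD : IsHurwitz σ.D) {t : ℝ} (ht : 0 < t) :
    Tendsto (fun ε : ℝ => NormedSpace.exp (t • epsGen ε σ)) (𝓝[>] 0)
      (𝓝 (σ.T⁻¹ * (NormedSpace.exp (t • σ.slowGen) * σ.slow) * σ.T)) := by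
  obtain ⟨C, hC, α, hα, h⟩ := hD.exists_norm_exp_le
  have hJD : σ.fastInv * σ.fastGen = σ.fast := by
    simp [fastInv, fastGen, fast, ofBlocks_mul, Matrix.nonsing_inv_mul _ hD.isUnit_det]
  have hlim := tendsto_exp_slow_fast (p := σ.slow) (q := σ.fast) (D := σ.fastGen)
    (J := σ.fastInv) (N := σ.regGen) (C := ‖σ.fastInj‖ * C * ‖σ.fastInj.transpose‖) (α := α)
    σ.slow_add_fast (by simp [slow, ofBlocks_mul]) (by simp [slow, fastGen, ofBlocks_mul, ofBlocks_zero])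
    (by simp [fast, fastGen, ofBlocks_mul]) (by simp [fast, fastGen, ofBlocks_mul]) hJD hα
    (fun t ht => by
      refine (congrArg norm (σ.exp_fastGen_mul t)).trans_le ?_
      refine (Matrix.linfty_opNorm_mul _ _).trans ((mul_le_mul_of_nonneg_right
        ((Matrix.linfty_opNorm_mul _ _).trans (mul_le_mul_of_nonneg_left (h t ht) (norm_nonneg _)))
        (norm_nonneg _)).trans (le_of_eq (by ring)))) ht
  rw [slow_regGen_slow] at hlim
  refine ((hlim.const_mul σ.T⁻¹).mul_const σ.T).congr' ?_
  filter_upwards [self_mem_nhdsWithin] with ε hε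
  exact (exp_epsGen σ hD.isUnit_det (ne_of_gt hε) t).symm

/-- On the fast time scale, the propagators of the singularly perturbed system converge to those of
the transient one. -/
theorem tendsto_exp_epsGen_fast (hD : IsHurwitz σ.D) (t : ℝ) :
    Tendsto (fun ε : ℝ => NormedSpace.exp ((ε * t) • epsGen ε σ)) (𝓝[>] 0)
      (𝓝 (σ.T⁻¹ * NormedSpace.exp (t • σ.fastGen) * σ.T)) := by
  -- Over time `ε t` the factor `ε⁻¹` cancels, and the regular part becomes a vanishing
  -- perturbation.
  have hlin : Tendsto (fun ε : ℝ => t • σ.fastGen + (ε * t) • σ.regGen) (𝓝[>] 0)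
      (𝓝 (t • σ.fastGen)) := by
    have h1 : Tendsto (fun ε : ℝ => t • σ.fastGen + (ε * t) • σ.regGen) (𝓝 0)
        (𝓝 (t • σ.fastGen + ((0 : ℝ) * t) • σ.regGen)) :=
      tendsto_const_nhds.add ((tendsto_id.mul_const t).smul_const _)
    rw [zero_mul, zero_smul, add_zero] at h1
    exact h1.mono_left nhdsWithin_le_nhds
  have hexp := (NormedSpace.exp_continuous.tendsto (t • σ.fastGen)).comp hlin
  refine ((hexp.const_mul σ.T⁻¹).mul_const σ.T).congr' ?_
  filter_upwards [self_mem_nhdsWithin] with ε hε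
  have hε0 : ε ≠ 0 := ne_of_gt hε
  rw [exp_epsGen σ hD.isUnit_det hε0, Function.comp_apply, smul_add, smul_smul,
    mul_right_comm, mul_inv_cancel₀ hε0, one_mul]
  rfl

end Mode

end

end SingPert

namespace SingPert

open scoped Matrix.Norms.Operator

/-! ### Continuous dependence on the mode -/

section Continuity

variable {d : ℕ} {K : Set (Mode d)}

theorem continuousOn_matrix_inv {X : Type*} [TopologicalSpace X] {s : Set X}
    {f : X → Matrix (Fin d) (Fin d) ℝ} (hf : ContinuousOn f s) (h : ∀ x ∈ s, IsUnit (f x)) :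
    ContinuousOn (fun x => (f x)⁻¹) s := by
  intro x hx
  obtain ⟨u, hu⟩ := h x hx
  simp only [Matrix.nonsing_inv_eq_ringInverse]
  have h1 := NormedRing.inverse_continuousAt u
  rw [hu] at h1
  exact h1.comp_continuousWithinAt (hf x hx)

namespace Mode

/-- Blocks have mode-dependent sizes, so continuity is proved for their `d × d` extensions, built
from `Λ P⁻¹` with the projections `slow` and `fast`. These depend only on `ℓ`, which ranges over a
discrete space. -/
theorem continuous_slow : Continuous (slow : Mode d → Matrix (Fin d) (Fin d) ℝ) := by
  have h : (slow : Mode d → Matrix (Fin d) (Fin d) ℝ) =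
      (fun l : ↥(Set.Icc 1 (d - 1)) => Matrix.diagonal fun i : Fin d =>
        if (i : ℕ) < (l : ℕ) then (1 : ℝ) else 0) ∘ Prod.fst := by
    funext σ
    exact σ.slow_eq_diagonal
  rw [h]
  exact continuous_of_discreteTopology.comp continuous_fst

theorem continuous_fast : Continuous (fast : Mode d → Matrix (Fin d) (Fin d) ℝ) := by
  have h : (fast : Mode d → Matrix (Fin d) (Fin d) ℝ) = fun σ => 1 - σ.slow := by
    funext σ
    exact eq_sub_of_add_eq' σ.slow_add_fast
  rw [h]
  exact continuous_const.sub continuous_slow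

theorem continuous_P : Continuous (P : Mode d → Matrix (Fin d) (Fin d) ℝ) :=
  Units.continuous_val.comp (continuous_fst.comp continuous_snd)

theorem continuous_P_inv : Continuous fun σ : Mode d => σ.P⁻¹ := by
  simp only [P_inv_eq]
  exact Units.continuous_val.comp (continuous_inv.comp (continuous_fst.comp continuous_snd))

theorem continuous_R : Continuous (R : Mode d → Matrix (Fin d) (Fin d) ℝ) :=
  continuous_snd.comp (continuous_snd.comp continuous_snd)

theorem continuous_L : Continuous (L : Mode d → Matrix (Fin d) (Fin d) ℝ) :=
  (continuous_fst.comp (continuous_snd.comp continuous_snd)).mul continuous_P_inv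

theorem fastGen_eq (σ : Mode d) : σ.fastGen = σ.fast * σ.L * σ.fast := by
  simp [L_eq, fast, fastGen, ofBlocks_mul]

theorem continuous_fastGen : Continuous (fastGen : Mode d → Matrix (Fin d) (Fin d) ℝ) := by
  have h : (fastGen : Mode d → Matrix (Fin d) (Fin d) ℝ) = fun σ => σ.fast * σ.L * σ.fast :=
    funext fastGen_eq
  rw [h]
  exact (continuous_fast.mul continuous_L).mul continuous_fast

/-- Adding `slow` completes `diag(0, D)` to an invertible `d × d` matrix, to which continuity of
inversion applies. -/
theorem continuousOn_fastInv (hD : ∀ σ ∈ K, IsHurwitz σ.D) :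
    ContinuousOn (fastInv : Mode d → Matrix (Fin d) (Fin d) ℝ) K := by
  have hinv : ∀ σ ∈ K, (σ.fastGen + σ.slow) * (σ.fastInv + σ.slow) = 1 := by
    intro σ hσ
    simp [fastGen, slow, fastInv, ofBlocks_add, ofBlocks_mul,
      Matrix.mul_nonsing_inv _ (hD σ hσ).isUnit_det, ofBlocks_one]
  have h : ∀ σ ∈ K, σ.fastInv = (σ.fastGen + σ.slow)⁻¹ - σ.slow := fun σ hσ => by
    rw [Matrix.inv_eq_right_inv (hinv σ hσ), add_sub_cancel_right]
  refine ContinuousOn.congr ?_ h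
  refine (continuousOn_matrix_inv (continuous_fastGen.add continuous_slow).continuousOn ?_).sub
    continuous_slow.continuousOn
  exact fun σ hσ => IsUnit.of_mul_eq_one _ (hinv σ hσ)

theorem continuousOn_coupling (hD : ∀ σ ∈ K, IsHurwitz σ.D) :
    ContinuousOn (fun σ : Mode d => σ.fastInv * σ.L * σ.slow) K :=
  ((continuousOn_fastInv hD).mul continuous_L.continuousOn).mul continuous_slow.continuousOn

theorem continuousOn_T (hD : ∀ σ ∈ K, IsHurwitz σ.D) :
    ContinuousOn (T : Mode d → Matrix (Fin d) (Fin d) ℝ) K := by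
  have h : ∀ σ ∈ K, σ.T = (1 + σ.fastInv * σ.L * σ.slow) * σ.P := fun σ _ => by
    rw [T_eq, ← ofBlocks_one σ]
    simp [shear, L_eq, slow, fastInv, ofBlocks_mul, ofBlocks_add]
  exact ((continuousOn_const.add (continuousOn_coupling hD)).mul continuous_P.continuousOn).congr h

theorem continuousOn_T_inv (hD : ∀ σ ∈ K, IsHurwitz σ.D) :
    ContinuousOn (fun σ : Mode d => σ.T⁻¹) K :=
  continuousOn_matrix_inv (continuousOn_T hD) fun σ _ => IsUnit.of_mul_eq_one _ σ.T_mul_inv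

theorem continuousOn_slowGen (hD : ∀ σ ∈ K, IsHurwitz σ.D) :
    ContinuousOn (slowGen : Mode d → Matrix (Fin d) (Fin d) ℝ) K := by
  have h : ∀ σ ∈ K, σ.slowGen =
      σ.slow * σ.L * σ.slow - σ.slow * σ.L * (σ.fastInv * σ.L * σ.slow) := fun σ _ => by
    rw [eq_sub_iff_add_eq]
    simp [slowGen, M, L_eq, slow, fastInv, ofBlocks_mul, ofBlocks_add, Matrix.mul_assoc]
  have h1 := (continuous_slow (d := d)).mul continuous_L
  exact ((h1.mul continuous_slow).continuousOn.sub
    (h1.continuousOn.mul (continuousOn_coupling hD))).congr h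

end Mode

end Continuity

/-! ### The reduced and the transient systems -/

section Realizations

variable {d : ℕ} {K : Set (Mode d)} {τ : ℝ}

noncomputable section

/-- The reduced system in the original coordinates. -/
def barRealization (K : Set (Mode d)) : Realization (sysBar d) K d where
  inn σ := σ.T⁻¹ * σ.slowInj
  out σ := σ.slowInj.transpose * σ.T
  reset σ := σ.R
  out_mul_inn σ _ := by
    have h : σ.slowInj.transpose * σ.T * (σ.T⁻¹ * σ.slowInj) =
        σ.slowInj.transpose * (σ.T * σ.T⁻¹) * σ.slowInj := by simp only [Matrix.mul_assoc]
    rw [σ.T_mul_inv, Matrix.mul_one, σ.slowInj_transpose_mul] at h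
    exact h
  jump_eq new _ old _ := by
    have h := coordInj_transpose_mul_mul (fun i => new.split (Sum.inl i))
      (fun i => old.split (Sum.inl i)) (new.T * old.R * old.T⁻¹)
    have h' : new.slowInj.transpose * (new.T * old.R * old.T⁻¹) * old.slowInj =
        new.slowInj.transpose * new.T * old.R * (old.T⁻¹ * old.slowInj) := by
      simp only [Matrix.mul_assoc]
    exact h.symm.trans h'

theorem barRealization_prop (σ : Mode d) (t : ℝ) : (barRealization K).prop σ t =
    σ.T⁻¹ * (NormedSpace.exp (t • σ.slowGen) * σ.slow) * σ.T := by
  rw [σ.exp_slowGen_mul]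
  have h : σ.T⁻¹ * σ.slowInj * NormedSpace.exp (t • σ.M) * (σ.slowInj.transpose * σ.T) =
      σ.T⁻¹ * (σ.slowInj * NormedSpace.exp (t • σ.M) * σ.slowInj.transpose) * σ.T := by
    simp only [Matrix.mul_assoc]
  exact h

/-- The propagator at duration zero. Multiplied by `R`, it gives the elements of `setRbar`, so
instantaneous switching in the reduced system is the discrete system on that set. -/
theorem barRealization_inn_mul_out (σ : Mode d) :
    (barRealization K).inn σ * (barRealization K).out σ = σ.T⁻¹ * σ.slow * σ.T := by
  have h : σ.T⁻¹ * σ.slowInj * (σ.slowInj.transpose * σ.T) =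
      σ.T⁻¹ * (σ.slowInj * (1 : Matrix (Fin σ.ell) (Fin σ.ell) ℝ) * σ.slowInj.transpose) * σ.T := by
    simp only [Matrix.mul_one, Matrix.mul_assoc]
  exact h.trans (by rw [σ.slowInj_mul, Mode.slow])

/-- The transient system in the original coordinates. -/
def hatRealization (K : Set (Mode d)) : Realization (sysHat d) K d where
  inn σ := (show Matrix (Fin d) (Fin d) ℝ from σ.T⁻¹)
  out σ := σ.T
  reset σ := σ.R
  out_mul_inn σ _ := σ.T_mul_inv
  jump_eq _ _ _ _ := rfl

end

theorem exists_norm_list_prod_le {Y : Set (Matrix (Fin d) (Fin d) ℝ)} (hY : DiscreteBounded Y)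
    (f : Mode d → Matrix (Fin d) (Fin d) ℝ) (hf : ∀ σ ∈ K, f σ ∈ Y) :
    ∃ C, ∀ L : List (Mode d), (∀ σ ∈ L, σ ∈ K) → ‖(L.map f).prod‖ ≤ C := by
  obtain ⟨C, -, hC⟩ := hY
  obtain ⟨c, hc, h⟩ := exists_norm_le_opNorm (m := d) (n := d)
  refine ⟨c * C, fun L hL => (h _).trans (mul_le_mul_of_nonneg_left (hC _ fun A hA => ?_) hc)⟩
  obtain ⟨σ, hσ, rfl⟩ := List.mem_map.1 hA
  exact hf σ (hL σ hσ)

theorem sysBar_lyapunovExponent_le (hK : IsCompact K) (hD : ∀ σ ∈ K, IsHurwitz σ.D)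
    (hτ : 0 < τ ∨ DiscreteBounded (setRbar K)) {μ : ℝ}
    (hmode : ∀ σ ∈ K, ∀ t, 0 < t → SpecBound ((barRealization K).prop σ t) (Real.exp (μ * t)))
    (hlist : ∀ L : List (Mode d × ℝ), L ≠ [] → (∀ p ∈ L, p.1 ∈ K ∧ τ ≤ p.2 ∧ 0 < p.2) →
      SpecBound (L.map (barRealization K).step).prod (Real.exp (μ * (L.map Prod.snd).sum))) :
    (sysBar d).lyapunovExponent K τ ≤ μ := by
  obtain ⟨b₁, h₁⟩ := hK.exists_bound_of_continuousOn (Mode.continuousOn_T hD)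
  obtain ⟨b₂, h₂⟩ := hK.exists_bound_of_continuousOn (Mode.continuousOn_T_inv hD)
  obtain ⟨b₃, h₃⟩ := hK.exists_bound_of_continuousOn Mode.continuous_R.continuousOn
  obtain ⟨b₄, h₄⟩ := hK.exists_bound_of_continuousOn (Mode.continuousOn_slowGen hD)
  have hell : ∀ σ : Mode d, σ.ell ≤ d := fun σ => by have := σ.ell_add; omega
  have hinj : ∀ σ : Mode d, ‖σ.slowInj‖ ≤ d := fun σ =>
    (norm_coordInj_le _).trans (by exact_mod_cast hell σ)
  have hinj' : ∀ σ : Mode d, ‖σ.slowInj.transpose‖ ≤ d := fun σ => norm_coordInj_transpose_le _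
  set b := |b₁| * d + |b₂| * d + |b₃| + d * |b₄| * d with hb
  have p₁ : 0 ≤ |b₁| * d := by positivity
  have p₂ : 0 ≤ |b₂| * d := by positivity
  have p₄ : 0 ≤ d * |b₄| * d := by positivity
  refine (barRealization K).lyapunovExponent_le hK hell (b := b) (by positivity)
    (fun σ hσ => ?_) (fun σ hσ => ?_) (fun σ hσ => ?_) (fun σ hσ => ?_) (fun t => ?_) ?_ hmode hlist
  · refine le_trans ((Matrix.linfty_opNorm_mul _ _).trans (mul_le_mul
      ((h₂ σ hσ).trans (le_abs_self _)) (hinj σ) (norm_nonneg _) (abs_nonneg _))) ?_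
    linarith [abs_nonneg b₃]
  · refine le_trans ((Matrix.linfty_opNorm_mul _ _).trans (mul_le_mul (hinj' σ)
      ((h₁ σ hσ).trans (le_abs_self _)) (norm_nonneg _) (by positivity))) ?_
    linarith [abs_nonneg b₃, mul_comm (d : ℝ) |b₁|]
  · exact ((h₃ σ hσ).trans (le_abs_self _)).trans (by linarith)
  -- `M` has mode-dependent size; its bound is read off the continuous `d × d` extension `slowGen`.
  · have hM : σ.slowInj.transpose * σ.slowGen * σ.slowInj = σ.M := by
      rw [Mode.slowGen, ← σ.slowInj_mul]
      calc _ = (σ.slowInj.transpose * σ.slowInj) * σ.M * (σ.slowInj.transpose * σ.slowInj) := by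
            simp only [Matrix.mul_assoc]
        _ = _ := by rw [σ.slowInj_transpose_mul, Matrix.one_mul, Matrix.mul_one]
    have h : ‖σ.M‖ ≤ d * |b₄| * d := by
      rw [← hM]
      exact (Matrix.linfty_opNorm_mul _ _).trans (mul_le_mul ((Matrix.linfty_opNorm_mul _ _).trans
        (mul_le_mul (hinj' σ) ((h₄ σ hσ).trans (le_abs_self _)) (norm_nonneg _) (by positivity)))
        (hinj σ) (norm_nonneg _) (by positivity))
    exact h.trans (by linarith [abs_nonneg b₃])
  · simp only [barRealization_prop]
    refine ((Mode.continuousOn_T_inv hD).mul (ContinuousOn.mul ?_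
      Mode.continuous_slow.continuousOn)).mul (Mode.continuousOn_T hD)
    exact NormedSpace.exp_continuous.comp_continuousOn
      ((Mode.continuousOn_slowGen hD).const_smul t)
  · refine hτ.imp id fun hdisc => exists_norm_list_prod_le hdisc
      (fun σ => (barRealization K).reset σ * ((barRealization K).inn σ * (barRealization K).out σ))
      fun σ hσ => show _ ∈ setRbar K from ⟨σ, hσ, ?_⟩
    rw [barRealization_inn_mul_out, Mode.slow]
    simp only [barRealization, mul_assoc]

theorem sysHat_lyapunovExponent_le (hK : IsCompact K) (hD : ∀ σ ∈ K, IsHurwitz σ.D)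
    (hR : DiscreteBounded (setR K)) {μ : ℝ}
    (hmode : ∀ σ ∈ K, ∀ t, 0 < t → SpecBound ((hatRealization K).prop σ t) (Real.exp (μ * t)))
    (hlist : ∀ L : List (Mode d × ℝ), L ≠ [] → (∀ p ∈ L, p.1 ∈ K ∧ τ ≤ p.2 ∧ 0 < p.2) →
      SpecBound (L.map (hatRealization K).step).prod (Real.exp (μ * (L.map Prod.snd).sum))) :
    (sysHat d).lyapunovExponent K τ ≤ μ := by
  obtain ⟨b₁, h₁⟩ := hK.exists_bound_of_continuousOn (Mode.continuousOn_T hD)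
  obtain ⟨b₂, h₂⟩ := hK.exists_bound_of_continuousOn (Mode.continuousOn_T_inv hD)
  obtain ⟨b₃, h₃⟩ := hK.exists_bound_of_continuousOn Mode.continuous_R.continuousOn
  obtain ⟨b₄, h₄⟩ := hK.exists_bound_of_continuousOn Mode.continuous_fastGen.continuousOn
  have q₁ := abs_nonneg b₁
  have q₂ := abs_nonneg b₂
  have q₃ := abs_nonneg b₃
  have q₄ := abs_nonneg b₄
  refine (hatRealization K).lyapunovExponent_le hK (fun _ => le_rfl)
    (b := |b₁| + |b₂| + |b₃| + |b₄|) (by positivity)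
    (fun σ hσ => ?_) (fun σ hσ => ?_) (fun σ hσ => ?_) (fun σ hσ => ?_) (fun t => ?_)
    (Or.inr (exists_norm_list_prod_le hR
      (fun σ => (hatRealization K).reset σ * ((hatRealization K).inn σ * (hatRealization K).out σ))
      fun σ hσ => show _ ∈ setR K from ⟨σ, hσ, ?_⟩)) hmode hlist
  · exact ((h₂ σ hσ).trans (le_abs_self _)).trans (by linarith)
  · exact ((h₁ σ hσ).trans (le_abs_self _)).trans (by linarith)
  · exact ((h₃ σ hσ).trans (le_abs_self _)).trans (by linarith)
  · exact ((h₄ σ hσ).trans (le_abs_self _)).trans (by linarith)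
  · refine ((Mode.continuousOn_T_inv hD).mul ?_).mul (Mode.continuousOn_T hD)
    exact NormedSpace.exp_continuous.comp_continuousOn
      (Mode.continuous_fastGen.continuousOn.const_smul t)
  · change σ.R * (σ.T⁻¹ * σ.T) = σ.R
    rw [σ.T_inv_mul, mul_one]

end Realizations

/-! ### Transfer of growth to the singularly perturbed system -/

section Transfer

variable {d : ℕ} {K : Set (Mode d)} {τ : ℝ}

/-- The room left by the strict inequality yields a rate strictly above `μ`, which at `μ = 0` gives
instability and the constant `c` of the bound `c / ε`. -/
theorem exists_exp_mul_lt {μ W x : ℝ} (hW : 0 < W) (h : Real.exp (μ * W) < x) :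
    ∃ μ' > μ, Real.exp (μ' * W) < x := by
  have hx : 0 < x := (Real.exp_pos _).trans h
  rw [← Real.lt_log_iff_exp_lt hx, ← lt_div_iff₀ hW] at h
  obtain ⟨μ', h1, h2⟩ := exists_between h
  exact ⟨μ', h1, by rwa [← Real.lt_log_iff_exp_lt hx, ← lt_div_iff₀ hW]⟩

theorem tendsto_list_prod {ι : Type*} {f : ℝ → ι → Matrix (Fin d) (Fin d) ℝ}
    {g : ι → Matrix (Fin d) (Fin d) ℝ} {l : Filter ℝ} (L : List ι)
    (h : ∀ i ∈ L, Tendsto (fun ε => f ε i) l (𝓝 (g i))) :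
    Tendsto (fun ε => (L.map (f ε)).prod) l (𝓝 (L.map g).prod) := by
  induction L with
  | nil => exact tendsto_const_nhds
  | cons i L ih =>
    simp only [List.map_cons, List.prod_cons]
    exact (h i List.mem_cons_self).mul (ih fun j hj => h j (List.mem_cons_of_mem _ hj))

/-- If the propagators of the singularly perturbed system, on the time scale `c ε`, converge to
those of a limit system, then the growth of the limit system is inherited. -/
theorem eventually_hasGrowth {Sys : ImpulsiveSystem (Mode d)} (r : Realization Sys K d)
    (hr : ∀ σ, r.reset σ = σ.R) {c : ℝ → ℝ} (hc : ∀ ε, 0 < ε → 0 < c ε)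
    (hcτ : ∀ ε, 0 < ε → ∀ t, 0 < t → τ ≤ t → τ ≤ c ε * t)
    (hlim : ∀ σ ∈ K, ∀ t, 0 < t →
      Tendsto (fun ε => NormedSpace.exp ((c ε * t) • epsGen ε σ)) (𝓝[>] 0) (𝓝 (r.prop σ t)))
    {μ : ℝ} (hup : (∀ σ ∈ K, ∀ t, 0 < t → SpecBound (r.prop σ t) (Real.exp (μ * t))) →
      (∀ L : List (Mode d × ℝ), L ≠ [] → (∀ p ∈ L, p.1 ∈ K ∧ τ ≤ p.2 ∧ 0 < p.2) →
        SpecBound (L.map r.step).prod (Real.exp (μ * (L.map Prod.snd).sum))) →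
      Sys.lyapunovExponent K τ ≤ μ) (hμ : (μ : EReal) < Sys.lyapunovExponent K τ) :
    ∃ μ' > μ, ∀ᶠ ε in 𝓝[>] 0, (sysEps d ε).HasGrowth K τ (μ' / c ε) := by
  -- By `hup`, either a single propagator or a product of steps violates the spectral bound at rate
  -- `μ`. The violation persists for small `ε`, with durations multiplied by `c ε` and rates divided
  -- by it.
  by_cases hmode : ∀ σ ∈ K, ∀ t, 0 < t → SpecBound (r.prop σ t) (Real.exp (μ * t))
  · have hlist : ¬ ∀ L : List (Mode d × ℝ), L ≠ [] → (∀ p ∈ L, p.1 ∈ K ∧ τ ≤ p.2 ∧ 0 < p.2) →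
        SpecBound (L.map r.step).prod (Real.exp (μ * (L.map Prod.snd).sum)) :=
      fun h => absurd (hup hmode h) (not_le.2 hμ)
    push Not at hlist
    obtain ⟨L, hL0, hL, hspec⟩ := hlist
    rw [SpecBound] at hspec
    push Not at hspec
    obtain ⟨z, hz, hzW⟩ := hspec
    have hW : 0 < (L.map Prod.snd).sum := by
      refine List.sum_pos _ ?_ (by simpa using hL0)
      intro x hx
      obtain ⟨p, hp, rfl⟩ := List.mem_map.1 hx
      exact (hL p hp).2.2
    obtain ⟨μ', hμ', hzμ'⟩ := exists_exp_mul_lt hW hzW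
    refine ⟨μ', hμ', ?_⟩
    have ht : Tendsto (fun ε : ℝ => (L.map fun p =>
        (epsRealization d K ε).step (p.1, c ε * p.2)).prod) (𝓝[>] 0) (𝓝 (L.map r.step).prod) := by
      refine tendsto_list_prod L fun p hp => ?_
      have h1 := (hlim p.1 (hL p hp).1 p.2 (hL p hp).2.2).const_mul p.1.R
      rw [Realization.step, hr]
      refine h1.congr fun ε => ?_
      rw [Realization.step, epsRealization_prop]
      rfl
    filter_upwards [eventually_exists_mem_spectrum ht hz hzμ', self_mem_nhdsWithin]
      with ε ⟨z', hz', hz'W⟩ hε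
    have hcε := hc ε hε
    refine hasGrowth_of_list (L := L.map fun p => (p.1, c ε * p.2)) (by simpa using hL0) ?_
      (z := z') ?_ ?_
    · intro p hp
      obtain ⟨q, hq, rfl⟩ := List.mem_map.1 hp
      obtain ⟨h1, h2, h3⟩ := hL q hq
      exact ⟨h1, hcτ ε hε _ h3 h2, mul_pos hcε h3⟩
    · rw [List.map_map]; exact hz'
    · have hsum : ((L.map fun p => (p.1, c ε * p.2)).map Prod.snd).sum =
          c ε * (L.map Prod.snd).sum := by
        rw [List.map_map, ← List.sum_map_mul_left]; rfl
      rw [hsum, ← mul_assoc, div_mul_cancel₀ _ hcε.ne']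
      exact hz'W.le
  · push Not at hmode
    obtain ⟨σ, hσ, t, ht, hspec⟩ := hmode
    rw [SpecBound] at hspec
    push Not at hspec
    obtain ⟨z, hz, hzW⟩ := hspec
    obtain ⟨μ', hμ', hzμ'⟩ := exists_exp_mul_lt ht hzW
    refine ⟨μ', hμ', ?_⟩
    filter_upwards [eventually_exists_mem_spectrum (hlim σ hσ t ht) hz hzμ', self_mem_nhdsWithin]
      with ε ⟨z', hz', hz'W⟩ hε
    have hcε := hc ε hε
    refine hasGrowth_of_mode hσ (mul_pos hcε ht) (z := z') ?_ ?_
    · rw [epsRealization_prop]; exact hz'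
    · rw [← mul_assoc, div_mul_cancel₀ _ hcε.ne']
      exact hz'W.le

theorem eventually_hasGrowth_of_sysBar (hK : IsCompact K) (hD : ∀ σ ∈ K, IsHurwitz σ.D)
    (hτ : 0 < τ ∨ DiscreteBounded (setRbar K)) {μ : ℝ}
    (hμ : (μ : EReal) < (sysBar d).lyapunovExponent K τ) :
    ∃ μ' > μ, ∀ᶠ ε in 𝓝[>] 0, (sysEps d ε).HasGrowth K τ μ' := by
  have h := eventually_hasGrowth (barRealization K) (fun _ => rfl) (c := fun _ => 1)
    (fun _ _ => one_pos) (fun _ _ _ _ ht => by rwa [one_mul]) (fun σ hσ t ht => by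
      simp only [one_mul]
      rw [barRealization_prop]
      exact σ.tendsto_exp_epsGen_slow (hD σ hσ) ht)
    (sysBar_lyapunovExponent_le hK hD hτ) hμ
  simpa only [div_one] using h

theorem eventually_hasGrowth_of_sysHat (hK : IsCompact K) (hD : ∀ σ ∈ K, IsHurwitz σ.D)
    (hR : DiscreteBounded (setR K)) {μ : ℝ}
    (hμ : (μ : EReal) < (sysHat d).lyapunovExponent K 0) :
    ∃ μ' > μ, ∀ᶠ ε in 𝓝[>] 0, (sysEps d ε).HasGrowth K 0 (μ' / ε) :=
  eventually_hasGrowth (hatRealization K) (fun _ => rfl) (c := fun ε => ε)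
    (fun _ hε => hε) (fun _ hε _ ht _ => (mul_pos hε ht).le)
    (fun σ hσ t _ => σ.tendsto_exp_epsGen_fast (hD σ hσ) t)
    (sysHat_lyapunovExponent_le hK hD hR) hμ

theorem ImpulsiveSystem.ExpUnstable.lyapunovExponent_pos {S : Type*} {Sys : ImpulsiveSystem S}
    {K : Set S} {τ : ℝ} (h : Sys.ExpUnstable K τ) :
    ((0 : ℝ) : EReal) < Sys.lyapunovExponent K τ := by
  obtain ⟨c, hc, δ, hδ, s, x, hx, h⟩ := h
  exact lt_of_lt_of_le (by exact_mod_cast hδ) (le_lyapunovExponent_of_trajectory hc s x hx h)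

theorem sysBar_bound (hK : IsCompact K) (hD : ∀ σ ∈ K, IsHurwitz σ.D)
    (hτ : 0 < τ ∨ DiscreteBounded (setRbar K)) :
    (sysBar d).lyapunovExponent K τ ≤
        liminf (fun ε : ℝ => (sysEps d ε).lyapunovExponent K τ) (𝓝[>] 0) ∧
      ((sysBar d).ExpUnstable K τ → ∀ᶠ ε : ℝ in 𝓝[>] 0, (sysEps d ε).ExpUnstable K τ) := by
  constructor
  · refine EReal.ge_of_forall_gt_iff_ge.1 fun z hz => ?_
    obtain ⟨μ', hμ', h⟩ := eventually_hasGrowth_of_sysBar hK hD hτ hz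
    refine le_liminf_of_le (h := ?_)
    filter_upwards [h] with ε hε
    exact le_trans (by exact_mod_cast hμ'.le) hε.le_lyapunovExponent
  · intro hEU
    obtain ⟨μ', hμ', h⟩ := eventually_hasGrowth_of_sysBar hK hD hτ hEU.lyapunovExponent_pos
    filter_upwards [h] with ε hε using hε.expUnstable hμ'

theorem sysHat_bound (hK : IsCompact K) (hD : ∀ σ ∈ K, IsHurwitz σ.D)
    (hR : DiscreteBounded (setR K)) :
    (sysHat d).lyapunovExponent K 0 ≤
        liminf (fun ε : ℝ => (ε : EReal) * (sysEps d ε).lyapunovExponent K 0) (𝓝[>] 0) := by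
  refine EReal.ge_of_forall_gt_iff_ge.1 fun z hz => ?_
  obtain ⟨μ', hμ', h⟩ := eventually_hasGrowth_of_sysHat hK hD hR hz
  refine le_liminf_of_le (h := ?_)
  filter_upwards [h, self_mem_nhdsWithin] with ε hε hε0
  have hε0 : 0 < ε := hε0
  have h1 := mul_le_mul_of_nonneg_left hε.le_lyapunovExponent
    (show (0 : EReal) ≤ (ε : EReal) by exact_mod_cast hε0.le)
  rw [← EReal.coe_mul, mul_div_cancel₀ _ hε0.ne'] at h1
  exact le_trans (by exact_mod_cast hμ'.le) h1

end Transfer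

end SingPert

/-! ### The three statements -/

theorem mainTheorem1 (d : ℕ) (hd : 2 ≤ d) (K : Set (SingPert.Mode d)) (hK : IsCompact K)
    (hD : ∀ σ ∈ K, SingPert.IsHurwitz σ.D) :
    -- positive dwell time
    (∀ τ : ℝ, 0 < τ →
      (SingPert.sysBar d).lyapunovExponent K τ ≤
          liminf (fun ε : ℝ => (SingPert.sysEps d ε).lyapunovExponent K τ) (𝓝[>] 0) ∧
      ((SingPert.sysBar d).ExpUnstable K τ →
        ∀ᶠ ε : ℝ in 𝓝[>] 0, (SingPert.sysEps d ε).ExpUnstable K τ)) ∧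
    -- no dwell time
    (SingPert.DiscreteBounded (SingPert.setR K) → SingPert.DiscreteBounded (SingPert.setRbar K) →
      (SingPert.sysBar d).lyapunovExponent K 0 ≤
          liminf (fun ε : ℝ => (SingPert.sysEps d ε).lyapunovExponent K 0) (𝓝[>] 0) ∧
      ((SingPert.sysBar d).ExpUnstable K 0 →
        ∀ᶠ ε : ℝ in 𝓝[>] 0, (SingPert.sysEps d ε).ExpUnstable K 0)) ∧
    -- transient dynamics
    (SingPert.DiscreteBounded (SingPert.setR K) →
      (SingPert.sysHat d).lyapunovExponent K 0 ≤
          max 0 (liminf (fun ε : ℝ =>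
            (ε : EReal) * (SingPert.sysEps d ε).lyapunovExponent K 0) (𝓝[>] 0)) ∧
      ((SingPert.sysHat d).ExpUnstable K 0 →
        (∀ᶠ ε : ℝ in 𝓝[>] 0, (SingPert.sysEps d ε).ExpUnstable K 0) ∧
        ∃ c : ℝ, 0 < c ∧ ∀ᶠ ε : ℝ in 𝓝[>] 0,
          ((c / ε : ℝ) : EReal) ≤ (SingPert.sysEps d ε).lyapunovExponent K 0)) := by
  refine ⟨fun τ hτ => SingPert.sysBar_bound hK hD (Or.inl hτ),
    fun _ hRbar => SingPert.sysBar_bound hK hD (Or.inr hRbar), fun hR =>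
    ⟨(SingPert.sysHat_bound hK hD hR).trans (le_max_right _ _), fun hEU => ?_⟩⟩
  -- The transfer at `μ = 0` gives one `c > 0` with growth rate `c / ε` for all small `ε`, hence
  -- both remaining claims.
  obtain ⟨c, hc, h⟩ :=
    SingPert.eventually_hasGrowth_of_sysHat hK hD hR hEU.lyapunovExponent_pos
  refine ⟨?_, c, hc, ?_⟩
  · filter_upwards [h, self_mem_nhdsWithin] with ε hε hε0
    exact hε.expUnstable (div_pos hc hε0)
  · filter_upwards [h] with ε hε using hε.le_lyapunovExponent
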